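/- Let $\kappa>0$ and let $(N,g)$ be a smooth time-oriented Lorentzian manifold of dimension $n+1$ (signature $(n,1)$) with constant sectional curvature $-\kappa$. Let $M$ be a smooth $n$-dimensional manifold without boundary, let $T>0$, and let $F:M\times[0,T)\to N$ be a smooth family of spacelike immersions with $$\frac{\partial F}{\partial t}(p,t)=\phi(p,t)\,\nu(p,t)\qquad\text{for all }p\in M,\ t\in[0,T).$$ Here $\nu(p,t)$ is the future directed timelike unit normal of $F(\cdot,t)$ at $F(p,t)$, $g_{ij}$ is the induced metric $F^*g$ with Levi-Civita connection $\nabla$, $h_{ij}=-g(A_{ij},\nu)$ with $A=\nabla dF$ is the second fundamental form, the principal curvatures $\lambda_1,\dots,\lambda_n$ are the eigenvalues (with multiplicity) of the Weingarten map $h^k{}_i=g^{kl}h_{li}$, and $$\phi=\frac1{\sqrt\kappa}\sum_{i=1}^n\arctan\frac{\lambda_i}{\sqrt\kappa}$$ is the Lagrangian angle. Then $\phi(\cdot,t)$ is smooth on $M$ for every $t\in[0,T)$, $\phi(p,\cdot)$ is differentiable on $[0,T)$ for every $p\in M$ (one-sided at $t=0$), and at every $(p,t)\in M\times[0,T)$,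 in any local coordinates, $$\frac{\partial\phi}{\partial t}=\sigma^{ij}\nabla_i\nabla_j\phi-n\phi,$$ where $(\sigma^{ij})$ is the inverse matrix of $\sigma_{ij}=\kappa g_{ij}+h_i{}^l h_{lj}$ (indices raised with $g^{ij}$, repeated indices summed). -/

import Mathlib

open Set Matrix
open scoped Manifold ContDiff Bundle

noncomputable section

namespace LorentzFlow

/-- `ℝᵐ`, the model space of `m`-dimensional manifolds. -/
abbrev E (m : ℕ) := EuclideanSpace ℝ (Fin m)

/-! ### Tensor calculus in an open set of `ℝᵐ` -/

/-- The partial derivative `∂f/∂zⁱ`. -/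
def pd {m : ℕ} (i : Fin m) (f : E m → ℝ) (z : E m) : ℝ :=
  fderiv ℝ f z (EuclideanSpace.single i 1)

/-- The Christoffel symbols
`Γᵏᵢⱼ = ½ gᵏˡ (∂ᵢ gⱼₗ + ∂ⱼ gᵢₗ - ∂ₗ gᵢⱼ)` of a (pseudo-)Riemannian metric `gᵢⱼ`. -/
def christoffel {m : ℕ} (g : E m → Matrix (Fin m) (Fin m) ℝ) (k i j : Fin m) (z : E m) : ℝ :=
  (1 / 2) * ∑ l, (g z)⁻¹ k l *
    (pd i (fun w => g w j l) z + pd j (fun w => g w i l) z - pd l (fun w => g w i j) z)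

/-- The components of the curvature tensor `R(X, Y)Z = ∇_X ∇_Y Z - ∇_Y ∇_X Z - ∇_[X,Y] Z`:
`R(∂ᵢ, ∂ⱼ)∂ₖ = Rˡₖᵢⱼ ∂ₗ`. -/
def curvature {m : ℕ} (g : E m → Matrix (Fin m) (Fin m) ℝ) (l k i j : Fin m) (z : E m) : ℝ :=
  pd i (christoffel g l j k) z - pd j (christoffel g l i k) z
    + ∑ a, (christoffel g l i a z * christoffel g a j k z
      - christoffel g l j a z * christoffel g a i k z)

/-- `g(R(u, v)v, u)` for vectors with components `uⁱ`, `vⁱ` at the point `z`. -/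
def curvatureForm {m : ℕ} (g : E m → Matrix (Fin m) (Fin m) ℝ) (z : E m) (u v : E m) : ℝ :=
  ∑ i, ∑ j, ∑ k, ∑ l, ∑ a,
    g z a l * curvature g l k i j z * u i * v j * v k * u a

/-- The Hessian `∇ᵢ∇ⱼ f = ∂ᵢ∂ⱼ f - Γᵏᵢⱼ ∂ₖ f`. -/
def hessian {m : ℕ} (g : E m → Matrix (Fin m) (Fin m) ℝ) (f : E m → ℝ) (z : E m) :
    Matrix (Fin m) (Fin m) ℝ :=
  Matrix.of fun i j => pd i (pd j f) z - ∑ k, christoffel g k i j z * pd k f z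

/-- The metric `gᵢⱼ = g_{αβ} Fᵅᵢ Fᵝⱼ` induced by a map `F : ℝᵐ → ℝᵈ` from a metric `g_{αβ}`. -/
def inducedMetric {m d : ℕ} (g : E d → Matrix (Fin d) (Fin d) ℝ) (F : E m → E d) (z : E m) :
    Matrix (Fin m) (Fin m) ℝ :=
  Matrix.of fun i j => ∑ α, ∑ β,
    g (F z) α β * pd i (fun w => F w α) z * pd j (fun w => F w β) z

/-- The components `Aᵅᵢⱼ = ∂ᵢ∂ⱼFᵅ - Γᵏᵢⱼ Fᵅₖ + Γᵅ_{βγ} Fᵝᵢ Fᵞⱼ` of the second fundamental tensor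
`A = ∇dF` of a map `F : ℝᵐ → ℝᵈ`. -/
def secondFundamentalTensor {m d : ℕ} (g : E d → Matrix (Fin d) (Fin d) ℝ) (F : E m → E d)
    (z : E m) (α : Fin d) (i j : Fin m) : ℝ :=
  pd i (pd j (fun w => F w α)) z
    - ∑ k, christoffel (inducedMetric g F) k i j z * pd k (fun w => F w α) z
    + ∑ β, ∑ γ, christoffel g α β γ (F z)
        * pd i (fun w => F w β) z * pd j (fun w => F w γ) z

/-- The second fundamental form `hᵢⱼ = -g(Aᵢⱼ, ν)` at `z`, for a normal vector with components
`νᵅ` at `F z`. -/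
def secondFundamentalForm {m d : ℕ} (g : E d → Matrix (Fin d) (Fin d) ℝ) (F : E m → E d)
    (ν : E d) (z : E m) : Matrix (Fin m) (Fin m) ℝ :=
  Matrix.of fun i j => - ∑ α, ∑ β, g (F z) α β * secondFundamentalTensor g F z α i j * ν β

/-! ### Lorentzian manifolds of dimension `n + 1` -/

section Lorentzian

variable {n : ℕ} {N : Type*} [TopologicalSpace N] [ChartedSpace (E (n + 1)) N]
  [IsManifold 𝓘(ℝ, E (n + 1)) ∞ N]

variable (n N) in
/-- A smooth Lorentzian metric of signature `(n, 1)` on `N`. -/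
structure LorentzianMetric where
  val (q : N) : TangentSpace 𝓘(ℝ, E (n + 1)) q →L[ℝ] TangentSpace 𝓘(ℝ, E (n + 1)) q →L[ℝ] ℝ
  symm (q : N) (u v : TangentSpace 𝓘(ℝ, E (n + 1)) q) : val q u v = val q v u
  signature (q : N) : ∃ b : Module.Basis (Fin (n + 1)) ℝ (TangentSpace 𝓘(ℝ, E (n + 1)) q),
    ∀ α β, val q (b α) (b β) = if α = β then (if α = Fin.last n then -1 else 1) else 0
  contMDiff :
    ContMDiff 𝓘(ℝ, E (n + 1))
      (𝓘(ℝ, E (n + 1)).prod 𝓘(ℝ, E (n + 1) →L[ℝ] E (n + 1) →L[ℝ] ℝ)) ∞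
      (fun q => Bundle.TotalSpace.mk' (E (n + 1) →L[ℝ] E (n + 1) →L[ℝ] ℝ)
        (E := fun q : N => TangentSpace 𝓘(ℝ, E (n + 1)) q →L[ℝ]
          TangentSpace 𝓘(ℝ, E (n + 1)) q →L[ℝ] ℝ) q (val q))

/-- A time orientation: a continuous timelike vector field, which singles out the future cones. -/
structure TimeOrientation (g : LorentzianMetric n N) where
  field (q : N) : TangentSpace 𝓘(ℝ, E (n + 1)) q
  continuous : Continuous fun q => (⟨q, field q⟩ : TangentBundle 𝓘(ℝ, E (n + 1)) N)
  timelike (q : N) : g.val q (field q) (field q) < 0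

/-- A timelike vector is future directed if it lies in the time cone of the orienting field. -/
def TimeOrientation.FutureDirected {g : LorentzianMetric n N} (τ : TimeOrientation g) {q : N}
    (v : TangentSpace 𝓘(ℝ, E (n + 1)) q) : Prop :=
  g.val q v v < 0 ∧ g.val q v (τ.field q) < 0

/-- The components `g_{αβ} = g(∂/∂yᵅ, ∂/∂yᵝ)` of the metric in the chart `y`. -/
def LorentzianMetric.inChart (g : LorentzianMetric n N)
    (y : OpenPartialHomeomorph N (E (n + 1))) (z : E (n + 1)) :
    Matrix (Fin (n + 1)) (Fin (n + 1)) ℝ :=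
  Matrix.of fun α β => g.val (y.symm z)
    (mfderiv 𝓘(ℝ, E (n + 1)) 𝓘(ℝ, E (n + 1)) y.symm z (EuclideanSpace.single α (1 : ℝ)))
    (mfderiv 𝓘(ℝ, E (n + 1)) 𝓘(ℝ, E (n + 1)) y.symm z (EuclideanSpace.single β (1 : ℝ)))

/-- The components `vᵅ` of a tangent vector `v` at `q` in the chart `y`. -/
def components (y : OpenPartialHomeomorph N (E (n + 1))) {q : N}
    (v : TangentSpace 𝓘(ℝ, E (n + 1)) q) : E (n + 1) :=
  mfderiv 𝓘(ℝ, E (n + 1)) 𝓘(ℝ, E (n + 1)) y q v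

/-- The sectional curvature `g(R(u, v)v, u) / (g(u, u) g(v, v) - g(u, v)²)` of the plane spanned by
`u, v`, computed in the chart `y`; meaningful if this plane is nondegenerate. -/
def LorentzianMetric.sectionalCurvature (g : LorentzianMetric n N)
    (y : OpenPartialHomeomorph N (E (n + 1))) {q : N}
    (u v : TangentSpace 𝓘(ℝ, E (n + 1)) q) : ℝ :=
  curvatureForm (g.inChart y) (y q) (components y u) (components y v) /
    (g.val q u u * g.val q v v - g.val q u v ^ 2)

/-- All nondegenerate tangent planes have sectional curvature `c`. -/
def LorentzianMetric.HasConstantSectionalCurvature (g : LorentzianMetric n N) (c : ℝ) : Prop :=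
  ∀ y ∈ IsManifold.maximalAtlas 𝓘(ℝ, E (n + 1)) ∞ N, ∀ q ∈ y.source,
    ∀ u v : TangentSpace 𝓘(ℝ, E (n + 1)) q,
      g.val q u u * g.val q v v - g.val q u v ^ 2 ≠ 0 → g.sectionalCurvature y u v = c

end Lorentzian

/-! ### Spacelike hypersurfaces -/

section Hypersurface

variable {n : ℕ} {M : Type*} [TopologicalSpace M] [ChartedSpace (E n) M]
  {N : Type*} [TopologicalSpace N] [ChartedSpace (E (n + 1)) N]
  [IsManifold 𝓘(ℝ, E (n + 1)) ∞ N]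

/-- `F` is a spacelike immersion: the bilinear form `F^*g` is positive definite everywhere (in
particular every `dF_p` is injective). -/
def IsSpacelikeImmersion (g : LorentzianMetric n N) (F : M → N) : Prop :=
  ContMDiff 𝓘(ℝ, E n) 𝓘(ℝ, E (n + 1)) ∞ F ∧
  ∀ (p : M) (v : TangentSpace 𝓘(ℝ, E n) p), v ≠ 0 →
    0 < g.val (F p) (mfderiv 𝓘(ℝ, E n) 𝓘(ℝ, E (n + 1)) F p v)
      (mfderiv 𝓘(ℝ, E n) 𝓘(ℝ, E (n + 1)) F p v)

/-- `ν` is the future directed timelike unit normal along `F`. -/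
def IsFutureUnitNormal {g : LorentzianMetric n N} (τ : TimeOrientation g) (F : M → N)
    (ν : ∀ p : M, TangentSpace 𝓘(ℝ, E (n + 1)) (F p)) : Prop :=
  ∀ p : M, g.val (F p) (ν p) (ν p) = -1 ∧ τ.FutureDirected (ν p) ∧
    ∀ v : TangentSpace 𝓘(ℝ, E n) p,
      g.val (F p) (mfderiv 𝓘(ℝ, E n) 𝓘(ℝ, E (n + 1)) F p v) (ν p) = 0

/-- The coordinate expression `y ∘ F ∘ x⁻¹` of `F`. -/
def localMap (F : M → N) (x : OpenPartialHomeomorph M (E n))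
    (y : OpenPartialHomeomorph N (E (n + 1))) (z : E n) : E (n + 1) :=
  y (F (x.symm z))

/-- The components `gᵢⱼ` of the first fundamental form `F^*g` in the chart `x` of `M`, as a function
of the coordinates (computed with the chart `y` of `N`). -/
def firstForm (g : LorentzianMetric n N) (F : M → N) (x : OpenPartialHomeomorph M (E n))
    (y : OpenPartialHomeomorph N (E (n + 1))) : E n → Matrix (Fin n) (Fin n) ℝ :=
  inducedMetric (g.inChart y) (localMap F x y)

/-- The components `hᵢⱼ` at `p` of the second fundamental form with respect to the normal `ν`, in
the chart `x` of `M` (computed with the chart `y` of `N`). -/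
def secondForm (g : LorentzianMetric n N) (F : M → N)
    (ν : ∀ p : M, TangentSpace 𝓘(ℝ, E (n + 1)) (F p)) (x : OpenPartialHomeomorph M (E n))
    (y : OpenPartialHomeomorph N (E (n + 1))) (p : M) : Matrix (Fin n) (Fin n) ℝ :=
  secondFundamentalForm (g.inChart y) (localMap F x y) (components y (ν p)) (x p)

/-- The Weingarten map `hᵏᵢ = gᵏˡ hₗᵢ` at `p`, in the preferred charts at `p` and at `F p`. -/
def weingarten (g : LorentzianMetric n N) (F : M → N)
    (ν : ∀ p : M, TangentSpace 𝓘(ℝ, E (n + 1)) (F p)) (p : M) : Matrix (Fin n) (Fin n) ℝ :=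
  (firstForm g F (chartAt (E n) p) (chartAt (E (n + 1)) (F p)) (chartAt (E n) p p))⁻¹ *
    secondForm g F ν (chartAt (E n) p) (chartAt (E (n + 1)) (F p)) p

/-- The principal curvatures `λ₁, …, λₙ` at `p`: the eigenvalues of the Weingarten map, with
multiplicity. -/
def principalCurvatures (g : LorentzianMetric n N) (F : M → N)
    (ν : ∀ p : M, TangentSpace 𝓘(ℝ, E (n + 1)) (F p)) (p : M) : Multiset ℝ :=
  (weingarten g F ν p).charpoly.roots

/-- The Lagrangian angle `φ = κ^{-1/2} ∑ᵢ arctan (λᵢ / κ^{1/2})`. -/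
def lagrangianAngle (κ : ℝ) (g : LorentzianMetric n N) (F : M → N)
    (ν : ∀ p : M, TangentSpace 𝓘(ℝ, E (n + 1)) (F p)) (p : M) : ℝ :=
  (1 / √κ) * ((principalCurvatures g F ν p).map fun l => Real.arctan (l / √κ)).sum

/-- The tensor `σᵢⱼ = κ gᵢⱼ + hᵢˡ hₗⱼ` at `p`, in the chart `x` of `M` (computed with the chart `y`
of `N`). -/
def sigma (κ : ℝ) (g : LorentzianMetric n N) (F : M → N)
    (ν : ∀ p : M, TangentSpace 𝓘(ℝ, E (n + 1)) (F p)) (x : OpenPartialHomeomorph M (E n))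
    (y : OpenPartialHomeomorph N (E (n + 1))) (p : M) : Matrix (Fin n) (Fin n) ℝ :=
  κ • firstForm g F x y (x p) +
    secondForm g F ν x y p * (firstForm g F x y (x p))⁻¹ * secondForm g F ν x y p

end Hypersurface

end LorentzFlow

end

/-! Write `W = g⁻¹h`. The angle is a trace of `arctan(W/√κ)`, so a variation of `W` should change it
by `tr((κ + W²)⁻¹ δW)`. Since `σ = g(κ + W²)`, we have `(κ + W²)⁻¹ g⁻¹ = σ⁻¹`.

For a flow with `∂ₜF = φν`, exchanging covariant derivatives gives `g' = 2φh`
(`NormalFlow.dd_time_formI`) and `h' = ∇²φ + φ h g⁻¹ h + φB` with `Bᵢⱼ = g(R(ν, Fᵢ)ν, Fⱼ)`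
(`NormalFlow.dd_time_formII`). Hence `δW = g⁻¹(h' - g'W) = g⁻¹(∇²φ - φ h g⁻¹ h + φB)`. Constant
curvature makes the symmetric part of `B` equal to `-κg` (`curvature_normal_add_transpose`), and
`σ⁻¹` sees only this part. The terms of order zero add up to `-φ tr(σ⁻¹(κg + h g⁻¹ h)) = -φ tr(σ⁻¹σ)
= -nφ` (`trace_evolution`).

Three points need care beyond this computation.

Eigenvalues are not smooth where they collide. The sum of arctangents is therefore written as `∫
tr(W(1 + s²W²)⁻¹) ds`, which is smooth in `W` and has the expected derivative
(`hasFDerivAt_arctanTrace`, `matrixAngle_eq_sum_roots`).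

The angle is defined through the preferred charts of each point, and these jump.
`charpoly_weingarten_invariant` allows one pair of charts to be used on a neighbourhood.

The normal is not assumed smooth, or even continuous. `contDiffOn_chartNormal` recovers its
smoothness from the continuous time orientation.

Time derivatives at `t = 0` are one-sided, so the calculus on space-time is done within convex
product sets `U ×ˢ J`, where derivatives within the set are unique and mixed derivatives still
commute. -/

namespace LorentzFlow

/-! ### The trace of the arctangent -/

section ArctanTrace

variable {A : Type*} [NormedRing A] [NormedAlgebra ℝ A]

/-- A linear functional on a finite dimensional algebra as a continuous one. -/
noncomputable def continuousFunctional [FiniteDimensional ℝ A] (τ : A →ₗ[ℝ] ℝ) : A →L[ℝ] ℝ :=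
  LinearMap.toContinuousLinearMap τ

/-- The functional `H ↦ τ(aH)` as a function of `a`. -/
noncomputable def traceForm (τ : A →L[ℝ] ℝ) : A →L[ℝ] A →L[ℝ] ℝ :=
  (ContinuousLinearMap.compL ℝ A A ℝ τ).comp (ContinuousLinearMap.mul ℝ A)

lemma traceForm_apply (τ : A →L[ℝ] ℝ) (a b : A) : traceForm τ a b = τ (a * b) := rfl

/-- The resolvent `(1 + s² W²)⁻¹`. -/
noncomputable def resolvent (W : A) (s : ℝ) : A := Ring.inverse (1 + s ^ 2 • (W * W))

/-- `τ (arctan (c W))` for a trace `τ`, in integral form. -/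
noncomputable def arctanTrace (τ : A →L[ℝ] ℝ) (c : ℝ) (W : A) : ℝ :=
  ∫ s in (0 : ℝ)..c, τ (W * resolvent W s)

/-- The elements `W` for which `1 + s² W²` is invertible for `0 ≤ s ≤ c`. -/
def arctanDomain (A : Type*) [NormedRing A] [NormedAlgebra ℝ A] (c : ℝ) : Set A :=
  {W | ∀ s ∈ Icc 0 c, IsUnit (1 + s ^ 2 • (W * W))}

lemma commute_resolvent (W : A) (s : ℝ) : Commute W (resolvent W s) := by
  by_cases h : IsUnit (1 + s ^ 2 • (W * W))
  · obtain ⟨u, hu⟩ := h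
    rw [resolvent, ← hu, Ring.inverse_unit]
    apply Commute.units_inv_right
    rw [hu]
    exact (Commute.one_right W).add_right
      (((Commute.refl W).mul_right (Commute.refl W)).smul_right _)
  · rw [resolvent, Ring.inverse_non_unit _ h]
    exact Commute.zero_right W

variable [CompleteSpace A]

lemma contDiffAt_resolvent {W : A} {s : ℝ} (h : IsUnit (1 + s ^ 2 • (W * W))) :
    ContDiffAt ℝ ∞ (fun p : A × ℝ => resolvent p.1 p.2) (W, s) := by
  obtain ⟨u, hu⟩ := h
  have h1 : ContDiffAt ℝ ∞ (Ring.inverse : A → A) ((1 : A) + s ^ 2 • (W * W)) :=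
    hu ▸ contDiffAt_ringInverse ℝ u
  have h2 : ContDiffAt ℝ ∞ (fun p : A × ℝ => (1 : A) + p.2 ^ 2 • (p.1 * p.1)) (W, s) := by
    fun_prop
  exact ContDiffAt.comp (W, s) h1 h2

set_option synthInstance.maxHeartbeats 200000 in
lemma hasFDerivAt_resolvent {W : A} {s : ℝ} (h : IsUnit (1 + s ^ 2 • (W * W))) :
    ∃ L : A →L[ℝ] A, HasFDerivAt (fun V => resolvent V s) L W ∧ ∀ H,
      L H = -(resolvent W s * (s ^ 2 • (W * H + H * W)) * resolvent W s) := by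
  obtain ⟨u, hu⟩ := h
  have h1 : HasFDerivAt (Ring.inverse : A → A) _ ((1 : A) + s ^ 2 • (W * W)) :=
    hu ▸ hasFDerivAt_ringInverse (𝕜 := ℝ) u
  have h2 : HasFDerivAt (fun V : A => (1 : A) + s ^ 2 • (V * V)) _ W :=
    (((hasFDerivAt_id (𝕜 := ℝ) W).mul' (hasFDerivAt_id W)).const_smul (s ^ 2)).const_add 1
  refine ⟨_, h1.comp W h2, fun H => ?_⟩
  simp [resolvent, ← hu, ContinuousLinearMap.mulLeftRight_apply, mul_add, add_mul, add_comm]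

set_option synthInstance.maxHeartbeats 200000 in
-- The right side is also the element representing the `W`-derivative of the integrand of
-- `arctanTrace`. This coincidence makes the derivative of the integral an exact boundary term.
lemma hasDerivAt_smul_resolvent {W : A} {s : ℝ} (h : IsUnit (1 + s ^ 2 • (W * W))) :
    HasDerivAt (fun r : ℝ => r • resolvent W r)
      (resolvent W s - (2 * s ^ 2) • (resolvent W s * (W * W) * resolvent W s)) s := by
  obtain ⟨u, hu⟩ := h
  have h1 : HasFDerivAt (Ring.inverse : A → A) _ ((1 : A) + s ^ 2 • (W * W)) :=
    hu ▸ hasFDerivAt_ringInverse (𝕜 := ℝ) u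
  have h2 : HasDerivAt (fun r : ℝ => (1 : A) + r ^ 2 • (W * W)) _ s :=
    (((hasDerivAt_id s).pow 2).smul_const (W * W)).const_add 1
  have h3 := (hasDerivAt_id s).smul (h1.comp_hasDerivAt s h2)
  refine h3.congr_deriv ?_
  simp only [resolvent, ← hu, Ring.inverse_unit]
  simp [ContinuousLinearMap.mulLeftRight_apply, smul_smul]
  rw [sub_eq_add_neg, add_comm]
  congr 3
  · rw [← hu, Ring.inverse_unit]
  · ring

/-- The derivative of `W ↦ τ(W (1 + s² W²)⁻¹)` represented as an element of the algebra. -/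
noncomputable def resolventDeriv (W : A) (s : ℝ) : A :=
  resolvent W s - (2 * s ^ 2) • (resolvent W s * (W * W) * resolvent W s)

/-- `W` and `H` need not commute. But `W` commutes with its resolvent, and `τ` is cyclic, so `H` can
be moved to the far right in every term, as if everything commuted. -/
lemma hasFDerivAt_trace_mul_resolvent (τ : A →L[ℝ] ℝ) (hτ : ∀ a b, τ (a * b) = τ (b * a))
    {W : A} {s : ℝ} (h : IsUnit (1 + s ^ 2 • (W * W))) :
    HasFDerivAt (fun V => τ (V * resolvent V s)) (traceForm τ (resolventDeriv W s)) W := by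
  obtain ⟨L, hL, hL'⟩ := hasFDerivAt_resolvent h
  have h1 := τ.hasFDerivAt.comp W ((hasFDerivAt_id (𝕜 := ℝ) W).mul' hL)
  refine h1.congr_fderiv ?_
  ext H
  set R := resolvent W s with hR
  have hc : W * R = R * W := commute_resolvent W s
  have e1 : τ (H * R) = τ (R * H) := hτ _ _
  have e2 : τ (W * (R * (W * H) * R)) = τ (R * (W * W) * R * H) := by
    rw [show W * (R * (W * H) * R) = (W * R * W * H) * R by noncomm_ring, hτ, hc]
    rw [show R * (R * W * W * H) = R * (R * W * W) * H by noncomm_ring,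
      show R * W * W = W * W * R by rw [mul_assoc W W R, hc, ← mul_assoc W R, hc], ← mul_assoc]
  have e3 : τ (W * (R * (H * W) * R)) = τ (R * (W * W) * R * H) := by
    rw [show W * (R * (H * W) * R) = (W * R) * (H * (W * R)) by noncomm_ring, hτ, mul_assoc, hτ,
      hc]
    rw [show R * W * (R * W) = R * W * (W * R) by rw [hc]]
    simp only [mul_assoc]
  simp [traceForm_apply, resolventDeriv, hL', ← hR, e1, mul_add, add_mul, e2, e3]
  ring

lemma continuousAt_resolventDeriv {W : A} {s : ℝ} (h : IsUnit (1 + s ^ 2 • (W * W))) :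
    ContinuousAt (fun p : A × ℝ => resolventDeriv p.1 p.2) (W, s) := by
  have h1 := (contDiffAt_resolvent h).continuousAt
  unfold resolventDeriv
  fun_prop

/-- Compactness of `[0, c]` yields one neighbourhood of `W` that serves all `s`. The bound `B` is
the dominating constant for differentiation under the integral. -/
lemma eventually_arctanDomain {c : ℝ} {W : A} (hW : W ∈ arctanDomain A c) :
    ∃ B : ℝ, ∀ᶠ V in nhds W, ∀ s ∈ Icc 0 c, IsUnit (1 + s ^ 2 • (V * V)) ∧
      ‖resolventDeriv V s‖ ≤ B := by
  have hcont : ContinuousOn (fun s => resolventDeriv W s) (Icc 0 c) := fun s hs =>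
    (ContinuousAt.comp (f := fun s : ℝ => (W, s)) (continuousAt_resolventDeriv (hW s hs))
      (by fun_prop)).continuousWithinAt
  obtain ⟨B, hB⟩ := isCompact_Icc.exists_bound_of_continuousOn hcont
  refine ⟨B + 1, isCompact_Icc.eventually_forall_of_forall_eventually
    (P := fun V s => IsUnit (1 + s ^ 2 • (V * V)) ∧ ‖resolventDeriv V s‖ ≤ B + 1)
    fun s hs => ?_⟩
  have h1 : ContinuousAt (fun p : A × ℝ => (1 : A) + p.2 ^ 2 • (p.1 * p.1)) (W, s) := by
    fun_prop
  have h2 := h1.eventually (Units.isOpen.mem_nhds (hW s hs))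
  have h3 := (continuousAt_resolventDeriv (hW s hs)).norm.eventually
    (gt_mem_nhds (lt_of_le_of_lt (hB s hs) (lt_add_one B)))
  filter_upwards [h2, h3] with p hp hp'
  exact ⟨hp, hp'.le⟩

lemma isOpen_arctanDomain (c : ℝ) : IsOpen (arctanDomain A c) := by
  rw [isOpen_iff_mem_nhds]
  intro W hW
  obtain ⟨B, hB⟩ := eventually_arctanDomain hW
  filter_upwards [hB] with V hV s hs using (hV s hs).1

/-- Under the trace, `arctan(cW)` has the scalar derivative `c(1 + c²W²)⁻¹`: differentiate under the
integral, then integrate in `s` exactly. -/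
lemma hasFDerivAt_arctanTrace (τ : A →L[ℝ] ℝ) (hτ : ∀ a b, τ (a * b) = τ (b * a)) {c : ℝ}
    (hc : 0 ≤ c) {W : A} (hW : W ∈ arctanDomain A c) :
    HasFDerivAt (arctanTrace τ c) (traceForm τ (c • resolvent W c)) W := by
  obtain ⟨B, hB⟩ := eventually_arctanDomain hW
  have hI : uIoc (0 : ℝ) c ⊆ Icc 0 c := by rw [uIoc_of_le hc]; exact Ioc_subset_Icc_self
  have hcont : ∀ V ∈ arctanDomain A c, ContinuousOn (fun s => τ (V * resolvent V s)) (Icc 0 c) := by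
    intro V hV s hs
    have := (contDiffAt_resolvent (hV s hs)).continuousAt
    have h2 : ContinuousAt (fun s => resolvent V s) s :=
      ContinuousAt.comp (f := fun s : ℝ => (V, s)) this (by fun_prop)
    exact ContinuousAt.continuousWithinAt (by fun_prop)
  have hcont' : ContinuousOn (fun s => traceForm τ (resolventDeriv W s)) (Icc 0 c) := by
    intro s hs
    have := ContinuousAt.comp (f := fun s : ℝ => (W, s)) (continuousAt_resolventDeriv (hW s hs))
      (by fun_prop)
    exact ((traceForm τ).continuous.continuousAt.comp this).continuousWithinAt
  have key := intervalIntegral.hasFDerivAt_integral_of_dominated_of_fderiv_le (𝕜 := ℝ)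
    (μ := MeasureTheory.volume) (a := 0) (b := c) (F := fun V s => τ (V * resolvent V s))
    (F' := fun V s => traceForm τ (resolventDeriv V s)) (x₀ := W)
    (bound := fun _ => ‖traceForm τ‖ * B) hB ?_ ?_ ?_ ?_ ?_ ?_
  · refine key.congr_fderiv ?_
    -- The primitive `s • resolvent W s` vanishes at `s = 0`, so only the endpoint `c` contributes.
    rw [intervalIntegral.integral_eq_sub_of_hasDerivAt
      (f := fun s => traceForm τ (s • resolvent W s))]
    · simp
    · intro s hs
      rw [uIcc_of_le hc] at hs
      exact (traceForm τ).hasFDerivAt.comp_hasDerivAt s (hasDerivAt_smul_resolvent (hW s hs))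
    · exact (hcont'.mono (by rw [uIcc_of_le hc])).intervalIntegrable
  · filter_upwards [(isOpen_arctanDomain c).mem_nhds hW] with V hV
    exact ((hcont V hV).mono hI).aestronglyMeasurable measurableSet_uIoc
  · exact ((hcont W hW).mono (by rw [uIcc_of_le hc])).intervalIntegrable
  · exact (hcont'.mono hI).aestronglyMeasurable measurableSet_uIoc
  · refine Filter.Eventually.of_forall fun s hs V hV => ?_
    exact ((traceForm τ).le_opNorm _).trans
      (mul_le_mul_of_nonneg_left (hV s (hI hs)).2 (norm_nonneg _))
  · exact intervalIntegrable_const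
  · refine Filter.Eventually.of_forall fun s hs V hV => ?_
    exact hasFDerivAt_trace_mul_resolvent τ hτ (hV s (hI hs)).1

/-- The derivative is an explicit smooth function of `W`, because inversion is smooth on units. One
differentiation under the integral thus gives all orders. -/
lemma contDiffOn_arctanTrace (τ : A →L[ℝ] ℝ) (hτ : ∀ a b, τ (a * b) = τ (b * a)) {c : ℝ}
    (hc : 0 ≤ c) : ContDiffOn ℝ ∞ (arctanTrace τ c) (arctanDomain A c) := by
  refine (contDiffOn_infty_iff_fderiv_of_isOpen (isOpen_arctanDomain c)).2
    ⟨fun W hW => (hasFDerivAt_arctanTrace τ hτ hc hW).differentiableAt.differentiableWithinAt, ?_⟩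
  refine ContDiffOn.congr (f := fun W => traceForm τ (c • resolvent W c)) ?_
    fun W hW => (hasFDerivAt_arctanTrace τ hτ hc hW).fderiv
  intro W hW
  have h1 : ContDiffAt ℝ ∞ (fun V => resolvent V c) W :=
    ContDiffAt.comp (f := fun V : A => (V, c)) W (contDiffAt_resolvent (hW c ⟨hc, le_rfl⟩))
      (by fun_prop)
  have h2 : ContDiffAt ℝ ∞ (fun V => c • resolvent V c) W := h1.const_smul c
  exact ((traceForm τ).contDiff.contDiffAt.comp W h2).contDiffWithinAt

end ArctanTrace

/-! ### Simultaneous diagonalization and the Lagrangian angle of a pair of forms -/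

section MatrixAngle

variable {n : ℕ}

lemma exists_orthogonal_diagonalization (A : Matrix (Fin n) (Fin n) ℝ) (hA : Aᵀ = A) :
    ∃ (V : Matrix (Fin n) (Fin n) ℝ) (d : Fin n → ℝ), Vᵀ * V = 1 ∧ Vᵀ * A * V = diagonal d := by
  have hH : A.IsHermitian := by
    rw [Matrix.IsHermitian, conjTranspose_eq_transpose_of_trivial, hA]
  have hs := hH.spectral_theorem
  rw [Unitary.conjStarAlgAut_apply] at hs
  set U : Matrix (Fin n) (Fin n) ℝ := (hH.eigenvectorUnitary).1 with hU
  have hU1 : Uᵀ * U = 1 := by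
    have := Unitary.coe_star_mul_self hH.eigenvectorUnitary
    rwa [star_eq_conjTranspose, conjTranspose_eq_transpose_of_trivial] at this
  rw [star_eq_conjTranspose, conjTranspose_eq_transpose_of_trivial] at hs
  refine ⟨U, RCLike.ofReal ∘ hH.eigenvalues, hU1, ?_⟩
  set D := diagonal (RCLike.ofReal ∘ hH.eigenvalues : Fin n → ℝ)
  calc Uᵀ * A * U = (Uᵀ * U) * D * (Uᵀ * U) := by
        conv_lhs => rw [hs]
        simp only [Matrix.mul_assoc]
    _ = D := by rw [hU1, Matrix.one_mul, Matrix.mul_one]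

lemma exists_simultaneous_diagonalization {g h : Matrix (Fin n) (Fin n) ℝ} (hg : g.PosDef)
    (hh : hᵀ = h) : ∃ (Q : Matrix (Fin n) (Fin n) ℝ) (d : Fin n → ℝ),
      Qᵀ * g * Q = 1 ∧ Qᵀ * h * Q = diagonal d := by
  have hgT : gᵀ = g := by
    have := hg.1
    rwa [Matrix.IsHermitian, conjTranspose_eq_transpose_of_trivial] at this
  obtain ⟨U, e, hU, hUe⟩ := exists_orthogonal_diagonalization g hgT
  have he : ∀ i, 0 < e i := by
    intro i
    have h1 : (Uᵀ * g * U) i i = U.col i ⬝ᵥ g *ᵥ U.col i := by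
      rw [Matrix.mul_assoc]
      simp [Matrix.mul_apply, dotProduct, mulVec]
    have h2 : U.col i ≠ 0 := by
      intro h0
      have h3 : (Uᵀ * U) i i = U.col i ⬝ᵥ U.col i := by
        simp [Matrix.mul_apply, dotProduct]
      rw [hU, h0] at h3
      simp at h3
    have h3 := (posDef_iff_dotProduct_mulVec.1 hg).2 h2
    rw [hUe] at h1
    simpa [← h1] using h3
  -- `B = U e^{-1/2}` turns `g` into the identity. An orthogonal `V` then diagonalizes `Bᵀ h B`
  -- without disturbing it.
  set B := U * diagonal (fun i => (√(e i))⁻¹) with hB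
  have hB1 : Bᵀ * g * B = 1 := by
    calc Bᵀ * g * B = diagonal (fun i => (√(e i))⁻¹) * (Uᵀ * g * U)
          * diagonal (fun i => (√(e i))⁻¹) := by
          rw [hB, transpose_mul, diagonal_transpose]; simp only [Matrix.mul_assoc]
      _ = 1 := by
          rw [hUe, diagonal_mul_diagonal, diagonal_mul_diagonal, ← diagonal_one]
          congr 1
          ext i
          have := Real.sq_sqrt (he i).le
          have h0 := (Real.sqrt_pos.2 (he i)).ne'
          field_simp
          exact this.symm
  obtain ⟨V, d, hV, hVd⟩ := exists_orthogonal_diagonalization (Bᵀ * h * B) (by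
    simp only [transpose_mul, transpose_transpose, hh, Matrix.mul_assoc])
  refine ⟨B * V, d, ?_, ?_⟩
  · calc (B * V)ᵀ * g * (B * V) = Vᵀ * (Bᵀ * g * B) * V := by
          rw [transpose_mul]; simp only [Matrix.mul_assoc]
      _ = 1 := by rw [hB1, Matrix.mul_one, hV]
  · rw [← hVd, transpose_mul]; simp only [Matrix.mul_assoc]

/-- `g⁻¹h` is not symmetric but is self-adjoint for `g`. A `g`-orthonormal eigenbasis `Q` has `Q⁻¹ =
Qᵀg` and `g⁻¹ = QQᵀ`. -/
lemma exists_inv_mul_eq_conj_diagonal {g h : Matrix (Fin n) (Fin n) ℝ} (hg : g.PosDef)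
    (hh : hᵀ = h) : ∃ (Q Q' : Matrix (Fin n) (Fin n) ℝ) (d : Fin n → ℝ), Q' * Q = 1 ∧
      g⁻¹ * h = Q * diagonal d * Q' := by
  obtain ⟨Q, d, h1, h2⟩ := exists_simultaneous_diagonalization hg hh
  have h3 : Q * (Qᵀ * g) = 1 := mul_eq_one_comm.1 h1
  refine ⟨Q, Qᵀ * g, d, h1, ?_⟩
  have h4 : g⁻¹ = Q * Qᵀ := by
    apply inv_eq_left_inv
    rw [Matrix.mul_assoc, h3]
  calc g⁻¹ * h = Q * Qᵀ * h * (Q * (Qᵀ * g)) := by rw [h3, h4, Matrix.mul_one]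
    _ = Q * (Qᵀ * h * Q) * (Qᵀ * g) := by simp only [Matrix.mul_assoc]
    _ = _ := by rw [h2]

lemma charpoly_conj {Q Q' : Matrix (Fin n) (Fin n) ℝ} (hQ : Q' * Q = 1)
    (A : Matrix (Fin n) (Fin n) ℝ) : (Q * A * Q').charpoly = A.charpoly := by
  have := Matrix.charpoly_units_conj (⟨Q, Q', mul_eq_one_comm.1 hQ, hQ⟩ : (Matrix (Fin n) (Fin n) ℝ)ˣ) A
  rwa [← coe_units_inv] at this

lemma roots_charpoly_conj_diagonal {Q Q' : Matrix (Fin n) (Fin n) ℝ} (hQ : Q' * Q = 1)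
    (d : Fin n → ℝ) : (Q * diagonal d * Q').charpoly.roots = Finset.univ.val.map d := by
  rw [charpoly_conj hQ, charpoly_diagonal]
  have := Polynomial.roots_multiset_prod_X_sub_C (Finset.univ.val.map d)
  rwa [Multiset.map_map] at this

lemma conj_diagonal_mul {Q Q' : Matrix (Fin n) (Fin n) ℝ} (hQ : Q' * Q = 1)
    (d e : Fin n → ℝ) : (Q * diagonal d * Q') * (Q * diagonal e * Q') =
      Q * diagonal (fun i => d i * e i) * Q' := by
  rw [← diagonal_mul_diagonal]
  calc _ = Q * (diagonal d * (Q' * Q) * diagonal e) * Q' := by simp only [Matrix.mul_assoc]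
    _ = _ := by rw [hQ, Matrix.mul_one]

lemma one_add_smul_sq_mul_conj_diagonal {Q Q' : Matrix (Fin n) (Fin n) ℝ} (hQ : Q' * Q = 1)
    (d : Fin n → ℝ) (s : ℝ) :
    (1 + s ^ 2 • ((Q * diagonal d * Q') * (Q * diagonal d * Q'))) *
      (Q * diagonal (fun i => (1 + s ^ 2 * d i ^ 2)⁻¹) * Q') = 1 := by
  have h0 : Q * Matrix.diagonal (fun _ : Fin n => (1 : ℝ)) * Q' = 1 := by
    rw [diagonal_one, Matrix.mul_one, mul_eq_one_comm.1 hQ]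
  rw [Matrix.add_mul, Matrix.one_mul, smul_mul, conj_diagonal_mul hQ, conj_diagonal_mul hQ,
    ← smul_mul, ← Matrix.mul_smul, ← diagonal_smul, ← Matrix.add_mul, ← Matrix.mul_add,
    diagonal_add]
  conv_rhs => rw [← h0]
  congr 2
  refine congrArg _ (funext fun i => ?_)
  have : 1 + s ^ 2 * d i ^ 2 ≠ 0 := by positivity
  simp only [Pi.smul_apply, smul_eq_mul]
  field_simp

attribute [local instance] Matrix.linftyOpNormedRing Matrix.linftyOpNormedAlgebra

/-- The trace as a continuous linear functional. -/
noncomputable def traceCLM (n : ℕ) :=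
  continuousFunctional (A := Matrix (Fin n) (Fin n) ℝ) (Matrix.traceLinearMap (Fin n) ℝ ℝ)

lemma traceCLM_apply (A : Matrix (Fin n) (Fin n) ℝ) : traceCLM n A = A.trace := rfl

lemma traceCLM_mul_comm (A B : Matrix (Fin n) (Fin n) ℝ) :
    traceCLM n (A * B) = traceCLM n (B * A) := Matrix.trace_mul_comm A B

/-- Real eigenvalues are essential: `1 + s²d²` never vanishes, whereas an eigenvalue `i/s` would
make `1 + s²W²` singular. -/
lemma conj_diagonal_mem_arctanDomain {Q Q' : Matrix (Fin n) (Fin n) ℝ} (hQ : Q' * Q = 1)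
    (d : Fin n → ℝ) (c : ℝ) :
    Q * diagonal d * Q' ∈ arctanDomain (Matrix (Fin n) (Fin n) ℝ) c := by
  intro s _
  rw [Matrix.isUnit_iff_isUnit_det]
  exact Matrix.isUnit_det_of_right_inverse (one_add_smul_sq_mul_conj_diagonal hQ d s)

lemma resolvent_conj_diagonal {Q Q' : Matrix (Fin n) (Fin n) ℝ} (hQ : Q' * Q = 1)
    (d : Fin n → ℝ) (s : ℝ) : resolvent (Q * diagonal d * Q') s =
      Q * diagonal (fun i => (1 + s ^ 2 * d i ^ 2)⁻¹) * Q' := by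
  rw [resolvent, ← nonsing_inv_eq_ringInverse]
  exact inv_eq_right_inv (one_add_smul_sq_mul_conj_diagonal hQ d s)

lemma integral_arctan_scaled (c l : ℝ) :
    ∫ s in (0 : ℝ)..c, l * (1 + s ^ 2 * l ^ 2)⁻¹ = Real.arctan (c * l) := by
  rw [intervalIntegral.integral_eq_sub_of_hasDerivAt (f := fun s => Real.arctan (s * l))]
  · simp
  · intro s _
    have := ((hasDerivAt_id s).mul_const l).arctan
    refine this.congr_deriv ?_
    simp [mul_pow]; ring
  · apply Continuous.intervalIntegrable
    have : ∀ s : ℝ, 1 + s ^ 2 * l ^ 2 ≠ 0 := fun s => by positivity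
    fun_prop (disch := simpa using this)

lemma arctanTrace_conj_diagonal {Q Q' : Matrix (Fin n) (Fin n) ℝ} (hQ : Q' * Q = 1)
    (d : Fin n → ℝ) (c : ℝ) :
    arctanTrace (traceCLM n) c (Q * diagonal d * Q') = ∑ i, Real.arctan (c * d i) := by
  have h1 : ∀ s, traceCLM n ((Q * diagonal d * Q') * resolvent (Q * diagonal d * Q') s) =
      ∑ i, d i * (1 + s ^ 2 * d i ^ 2)⁻¹ := by
    intro s
    rw [resolvent_conj_diagonal hQ, conj_diagonal_mul hQ, traceCLM_mul_comm, ← Matrix.mul_assoc,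
      hQ, Matrix.one_mul, traceCLM_apply, trace_diagonal]
  simp only [arctanTrace, h1]
  rw [intervalIntegral.integral_finsetSum]
  · exact Finset.sum_congr rfl fun i _ => integral_arctan_scaled c (d i)
  · intro i _
    apply Continuous.intervalIntegrable
    have : ∀ s : ℝ, 1 + s ^ 2 * d i ^ 2 ≠ 0 := fun s => by positivity
    fun_prop (disch := simpa using this)

/-- The Lagrangian angle `κ^{-1/2} ∑ arctan (λᵢ / κ^{1/2})` of a matrix, in integral form. -/
noncomputable def matrixAngle (κ : ℝ) (W : Matrix (Fin n) (Fin n) ℝ) : ℝ :=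
  (1 / √κ) * arctanTrace (traceCLM n) (1 / √κ) W

/-- The bridge from the multiset of roots, which has no evident smooth dependence on the matrix, to
the smooth integral formula. -/
lemma matrixAngle_eq_sum_roots (κ : ℝ) {g h : Matrix (Fin n) (Fin n) ℝ} (hg : g.PosDef)
    (hh : hᵀ = h) : (1 / √κ) * (((g⁻¹ * h).charpoly.roots.map
      fun l => Real.arctan (l / √κ)).sum) = matrixAngle κ (g⁻¹ * h) := by
  obtain ⟨Q, Q', d, hQQ, hQ⟩ := exists_inv_mul_eq_conj_diagonal hg hh
  rw [hQ, roots_charpoly_conj_diagonal hQQ, matrixAngle, arctanTrace_conj_diagonal hQQ, Multiset.map_map]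
  congr 1
  simp only [Finset.sum, Function.comp_def]
  congr 1
  refine Multiset.map_congr rfl fun i _ => ?_
  congr 1; ring

/-- The prefactor `1/√κ` and the endpoint `c = 1/√κ` combine: `κ⁻¹(1 + κ⁻¹W²)⁻¹ = (κ + W²)⁻¹`. -/
lemma hasFDerivAt_matrixAngle {κ : ℝ} (hκ : 0 < κ) {g h : Matrix (Fin n) (Fin n) ℝ}
    (hg : g.PosDef) (hh : hᵀ = h) :
    HasFDerivAt (matrixAngle κ) (traceForm (traceCLM n)
      (κ • (1 : Matrix (Fin n) (Fin n) ℝ) + (g⁻¹ * h) * (g⁻¹ * h))⁻¹) (g⁻¹ * h) := by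
  obtain ⟨Q, Q', d, hQQ, hQ⟩ := exists_inv_mul_eq_conj_diagonal hg hh
  have hc : (0 : ℝ) ≤ 1 / √κ := by positivity
  have hmem := conj_diagonal_mem_arctanDomain hQQ d (1 / √κ)
  rw [← hQ] at hmem
  have key := (hasFDerivAt_arctanTrace (traceCLM n) traceCLM_mul_comm hc hmem).const_mul (1 / √κ)
  refine key.congr_fderiv ?_
  rw [← map_smul]
  congr 1
  have hk : (1 / √κ) ^ 2 = κ⁻¹ := by
    rw [div_pow, Real.sq_sqrt hκ.le]; simp
  have hu := hmem _ ⟨hc, le_rfl⟩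
  set W := g⁻¹ * h
  rw [hk] at hu
  rw [resolvent, ← nonsing_inv_eq_ringInverse, hk]
  symm
  apply inv_eq_right_inv
  have hdet := (Matrix.isUnit_iff_isUnit_det _).1 hu
  have e : κ • (1 : Matrix (Fin n) (Fin n) ℝ) + W * W = κ • (1 + κ⁻¹ • (W * W)) := by
    rw [smul_add, smul_smul, mul_inv_cancel₀ hκ.ne', one_smul]
  rw [e, smul_smul, ← sq (1 / √κ), hk, smul_mul_smul_comm, mul_inv_cancel₀ hκ.ne', one_smul,
    Matrix.mul_nonsing_inv _ hdet]

lemma contDiffAt_matrixAngle {κ : ℝ} {g h : Matrix (Fin n) (Fin n) ℝ}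
    (hg : g.PosDef) (hh : hᵀ = h) : ContDiffAt ℝ ∞ (matrixAngle κ) (g⁻¹ * h) := by
  obtain ⟨Q, Q', d, hQQ, hQ⟩ := exists_inv_mul_eq_conj_diagonal hg hh
  have hmem := conj_diagonal_mem_arctanDomain hQQ d (1 / √κ)
  rw [← hQ] at hmem
  have h1 := (contDiffOn_arctanTrace (traceCLM n) traceCLM_mul_comm
    (by positivity : (0 : ℝ) ≤ 1 / √κ)).contDiffAt ((isOpen_arctanDomain _).mem_nhds hmem)
  exact contDiffAt_const.mul h1

variable {X : Type*} [NormedAddCommGroup X] [NormedSpace ℝ X]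

lemma contDiffWithinAt_matrix {f : X → Matrix (Fin n) (Fin n) ℝ} {S : Set X} {x : X}
    (hf : ∀ i j, ContDiffWithinAt ℝ ∞ (fun z => f z i j) S x) : ContDiffWithinAt ℝ ∞ f S x := by
  have : f = fun z => ∑ i, ∑ j, f z i j • single i j (1 : ℝ) := by
    ext1 z
    conv_lhs => rw [matrix_eq_sum_single (f z)]
    simp
  rw [this]
  exact ContDiffWithinAt.sum fun i _ => ContDiffWithinAt.sum fun j _ =>
    (hf i j).smul contDiffWithinAt_const

lemma hasDerivWithinAt_matrix {f : ℝ → Matrix (Fin n) (Fin n) ℝ}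
    {f' : Matrix (Fin n) (Fin n) ℝ} {S : Set ℝ} {x : ℝ}
    (hf : ∀ i j, HasDerivWithinAt (fun z => f z i j) (f' i j) S x) :
    HasDerivWithinAt f f' S x := by
  have : f = fun z => ∑ i, ∑ j, f z i j • single i j (1 : ℝ) := by
    ext1 z
    conv_lhs => rw [matrix_eq_sum_single (f z)]
    simp
  have h' : f' = ∑ i, ∑ j, f' i j • single i j (1 : ℝ) := by
    conv_lhs => rw [matrix_eq_sum_single f']
    simp
  rw [this, h']
  exact HasDerivWithinAt.fun_sum fun i _ => HasDerivWithinAt.fun_sum fun j _ =>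
    (hf i j).smul_const _

lemma contDiffWithinAt_matrix_inv {f : X → Matrix (Fin n) (Fin n) ℝ} {S : Set X} {x : X}
    (hf : ∀ i j, ContDiffWithinAt ℝ ∞ (fun z => f z i j) S x) (hx : (f x).det ≠ 0) (i j : Fin n) :
    ContDiffWithinAt ℝ ∞ (fun z => (f z)⁻¹ i j) S x := by
  obtain ⟨u, hu⟩ := (Matrix.isUnit_iff_isUnit_det (f x)).2 hx.isUnit
  have h1 : ContDiffAt ℝ ∞ (Ring.inverse : Matrix (Fin n) (Fin n) ℝ → _) (f x) :=
    hu ▸ contDiffAt_ringInverse ℝ u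
  have h2 := h1.comp_contDiffWithinAt x (contDiffWithinAt_matrix hf)
  have h3 := (continuousFunctional (A := Matrix (Fin n) (Fin n) ℝ)
    (Matrix.entryLinearMap ℝ ℝ i j)).contDiff.contDiffAt (n := ∞) |>.comp_contDiffWithinAt x h2
  simp only [nonsing_inv_eq_ringInverse]
  exact h3

lemma contDiffWithinAt_matrixAngle {κ : ℝ} {g h : X → Matrix (Fin n) (Fin n) ℝ} {S : Set X}
    {x : X} (hg : ∀ i j, ContDiffWithinAt ℝ ∞ (fun z => g z i j) S x)
    (hh : ∀ i j, ContDiffWithinAt ℝ ∞ (fun z => h z i j) S x)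
    (hgx : (g x).PosDef) (hhx : (h x)ᵀ = h x) :
    ContDiffWithinAt ℝ ∞ (fun z => matrixAngle κ ((g z)⁻¹ * h z)) S x := by
  have h1 : ContDiffWithinAt ℝ ∞ (fun z => (g z)⁻¹ * h z) S x :=
    (contDiffWithinAt_matrix (contDiffWithinAt_matrix_inv hg hgx.det_pos.ne')).mul
      (contDiffWithinAt_matrix hh)
  have h2 : ContDiffAt ℝ ∞ (matrixAngle κ) ((g x)⁻¹ * h x) := contDiffAt_matrixAngle hgx hhx
  exact ContDiffAt.comp_contDiffWithinAt (g := matrixAngle κ) x h2 h1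

/-- `(g⁻¹h)' = g⁻¹(h' - g' g⁻¹h)`. The factor `g⁻¹` is kept on the left so that it can later merge
with `(κ + W²)⁻¹` into `σ⁻¹`. -/
lemma hasDerivWithinAt_matrixAngle {κ : ℝ} (hκ : 0 < κ) {g h : ℝ → Matrix (Fin n) (Fin n) ℝ}
    {g' h' : Matrix (Fin n) (Fin n) ℝ} {S : Set ℝ} {t : ℝ}
    (hg : ∀ i j, HasDerivWithinAt (fun z => g z i j) (g' i j) S t)
    (hh : ∀ i j, HasDerivWithinAt (fun z => h z i j) (h' i j) S t)
    (hgx : (g t).PosDef) (hhx : (h t)ᵀ = h t) :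
    HasDerivWithinAt (fun z => matrixAngle κ ((g z)⁻¹ * h z))
      (trace ((κ • (1 : Matrix (Fin n) (Fin n) ℝ) +
        ((g t)⁻¹ * h t) * ((g t)⁻¹ * h t))⁻¹ *
          ((g t)⁻¹ * (h' - g' * ((g t)⁻¹ * h t))))) S t := by
  obtain ⟨u, hu⟩ := hgx.isUnit
  have h1 : HasFDerivAt (Ring.inverse : Matrix (Fin n) (Fin n) ℝ → _) _ (g t) :=
    hu ▸ hasFDerivAt_ringInverse (𝕜 := ℝ) u
  have h2 : HasDerivWithinAt (fun z => (g z)⁻¹) (-((g t)⁻¹ * g' * (g t)⁻¹)) S t := by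
    have := h1.comp_hasDerivWithinAt t (hasDerivWithinAt_matrix hg)
    simp only [Function.comp_def, ← nonsing_inv_eq_ringInverse] at this
    refine this.congr_deriv ?_
    rw [← hu]
    simp [ContinuousLinearMap.mulLeftRight_apply]
  have h3 := h2.mul (hasDerivWithinAt_matrix hh)
  refine ((hasFDerivAt_matrixAngle hκ hgx hhx).comp_hasDerivWithinAt t h3).congr_deriv ?_
  rw [traceForm_apply, traceCLM_apply]
  congr 2
  rw [mul_sub]
  simp only [neg_mul, mul_assoc]
  abel

end MatrixAngle

/-- The algebra of the evolution equation of the angle: if `g' = 2φ h` and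
`h' = H + φ h g⁻¹ h + φ B`, where the symmetric part of `B` is `-κ g`, then the angle of `g⁻¹ h`
changes by `σⁱʲ Hᵢⱼ - nφ`. -/
lemma trace_evolution {n : ℕ} {κ φ : ℝ} (hκ : 0 < κ) {g h H B : Matrix (Fin n) (Fin n) ℝ}
    (hg : g.PosDef) (hh : hᵀ = h) (hB : B + Bᵀ = -(2 * κ) • g) :
    trace ((κ • (1 : Matrix (Fin n) (Fin n) ℝ) + (g⁻¹ * h) * (g⁻¹ * h))⁻¹ *
      (g⁻¹ * (H + φ • (h * g⁻¹ * h) + φ • B - ((2 * φ) • h) * (g⁻¹ * h)))) =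
    (∑ i, ∑ j, (κ • g + h * g⁻¹ * h)⁻¹ i j * H i j) - n * φ := by
  have hgT : gᵀ = g := by
    have := hg.1
    rwa [Matrix.IsHermitian, conjTranspose_eq_transpose_of_trivial] at this
  have hgdet : IsUnit g.det := hg.det_pos.ne'.isUnit
  set σ := κ • g + h * g⁻¹ * h with hσ
  have hσg : σ = g * (κ • (1 : Matrix (Fin n) (Fin n) ℝ) + (g⁻¹ * h) * (g⁻¹ * h)) := by
    rw [hσ, mul_add, mul_smul_comm, mul_one]
    congr 1
    simp only [mul_assoc]
    rw [← mul_assoc g, mul_nonsing_inv _ hgdet, one_mul]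
  -- Simultaneous diagonalization turns `σ` into `diag(κ + dᵢ²)`, which is nonsingular because `κ >
  -- 0`.
  have hσdet : IsUnit σ.det := by
    obtain ⟨Q, d, h1, h2⟩ := exists_simultaneous_diagonalization hg hh
    have hk : Qᵀ * σ * Q = diagonal (fun i => κ + d i ^ 2) := by
      have h3 : Q * (Qᵀ * g) = 1 := mul_eq_one_comm.1 h1
      have h4 : g⁻¹ = Q * Qᵀ := by
        apply inv_eq_left_inv
        rw [Matrix.mul_assoc, h3]
      calc Qᵀ * σ * Q = κ • (Qᵀ * g * Q) + (Qᵀ * h * Q) * (Qᵀ * h * Q) := by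
            rw [hσ, h4]
            simp only [mul_add, add_mul, mul_assoc, mul_smul_comm, smul_mul_assoc]
        _ = _ := by
            rw [h1, h2, diagonal_mul_diagonal, ← diagonal_one, ← diagonal_smul, diagonal_add]
            congr 1; ext i; simp; ring
    have h5 : (Qᵀ * σ * Q).det ≠ 0 := by
      rw [hk, det_diagonal]
      exact Finset.prod_ne_zero_iff.2 fun i _ => by positivity
    rw [det_mul, det_mul] at h5
    exact (right_ne_zero_of_mul (left_ne_zero_of_mul h5)).isUnit
  have hinv : (κ • (1 : Matrix (Fin n) (Fin n) ℝ) + (g⁻¹ * h) * (g⁻¹ * h))⁻¹ * g⁻¹ = σ⁻¹ := by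
    rw [hσg, Matrix.mul_inv_rev]
  have hσT : (σ⁻¹)ᵀ = σ⁻¹ := by
    rw [transpose_nonsing_inv, hσ]
    simp only [transpose_add, transpose_smul, transpose_mul, hgT, hh, transpose_nonsing_inv,
      mul_assoc]
  -- As `σ⁻¹` is symmetric, only the symmetric part of `B` enters; no symmetry of `B` itself is
  -- needed.
  have hBtr : trace (σ⁻¹ * B) = - κ * trace (σ⁻¹ * g) := by
    have h1 : trace (σ⁻¹ * Bᵀ) = trace (σ⁻¹ * B) := by
      rw [← trace_transpose, transpose_mul, transpose_transpose, hσT, trace_mul_comm]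
    have h2 : trace (σ⁻¹ * (B + Bᵀ)) = -(2 * κ) * trace (σ⁻¹ * g) := by
      rw [hB, mul_smul_comm, trace_smul, smul_eq_mul]
    rw [mul_add, trace_add, h1] at h2
    linarith
  have hHtr : trace (σ⁻¹ * H) = ∑ i, ∑ j, σ⁻¹ i j * H i j := by
    conv_lhs => rw [← hσT]
    simp only [trace, diag, mul_apply, transpose_apply]
    rw [Finset.sum_comm]
  -- Contracting `σ` with its inverse gives the dimension. This is the origin of `-nφ`.
  have hn : κ * trace (σ⁻¹ * g) + trace (σ⁻¹ * (h * g⁻¹ * h)) = n := by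
    have h1 : trace (σ⁻¹ * σ) = n := by
      rw [nonsing_inv_mul _ hσdet, trace_one, Fintype.card_fin]
    rw [← h1]
    conv_rhs => rw [hσ]
    rw [mul_add, trace_add, mul_smul_comm, trace_smul, smul_eq_mul]
  rw [← mul_assoc, hinv, mul_sub, mul_add, mul_add, trace_sub, trace_add, trace_add, hHtr,
    smul_mul_assoc, mul_smul_comm, mul_smul_comm, mul_smul_comm, trace_smul, trace_smul, trace_smul,
    hBtr, ← hn, ← mul_assoc h]
  simp only [smul_eq_mul]
  ring

/-! ### Directional derivatives within a set -/

section DirectionalDerivative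

variable {X Y V W : Type*} [NormedAddCommGroup X] [NormedSpace ℝ X]
  [NormedAddCommGroup Y] [NormedSpace ℝ Y] [NormedAddCommGroup V] [NormedSpace ℝ V]
  [NormedAddCommGroup W] [NormedSpace ℝ W]

/-- The derivative of `f` within `S` in the direction `a`. -/
noncomputable def dd (S : Set X) (a : X) (f : X → V) (z : X) : V := fderivWithin ℝ f S z a

variable {S : Set X} {a b : X} {z : X}

lemma contDiffOn_dd (hS : UniqueDiffOn ℝ S) {f : X → V} (hf : ContDiffOn ℝ ∞ f S) :
    ContDiffOn ℝ ∞ (dd S a f) S :=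
  (hf.fderivWithin hS (m := ∞) (by simp)).clm_apply contDiffOn_const

lemma differentiableWithinAt_of_smooth {f : X → V} (hf : ContDiffOn ℝ ∞ f S) (hz : z ∈ S) :
    DifferentiableWithinAt ℝ f S z := (hf.differentiableOn (by simp)) z hz

lemma dd_congr {f g : X → V} (h : EqOn f g S) (hz : z ∈ S) : dd S a f z = dd S a g z := by
  rw [dd, dd, fderivWithin_congr h (h hz)]

lemma dd_const (c : V) : dd S a (fun _ : X => c) z = 0 := by
  simp [dd]

/-- The closure condition extends symmetry of second derivatives from interior points to the
boundary of `S`, in particular to the initial time. -/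
lemma dd_comm (hS : UniqueDiffOn ℝ S) (hS' : S ⊆ closure (interior S)) {f : X → V}
    (hf : ContDiffOn ℝ ∞ f S) (hz : z ∈ S) : dd S a (dd S b f) z = dd S b (dd S a f) z := by
  have hd : DifferentiableWithinAt ℝ (fderivWithin ℝ f S) S z :=
    (hf.fderivWithin hS (m := ∞) (by simp)).differentiableOn (by simp) z hz
  have key : ∀ c d : X, dd S c (dd S d f) z = fderivWithin ℝ (fderivWithin ℝ f S) S z c d := by
    intro c d
    have := (hd.hasFDerivWithinAt.clm_apply (hasFDerivWithinAt_const d z S)).fderivWithin (hS z hz)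
    unfold dd
    rw [this]
    simp
  rw [key, key]
  exact (hf z hz).isSymmSndFDerivWithinAt (by simpa using WithTop.coe_le_coe.2 (le_top (a := (2 : ℕ∞)))) hS (hS' hz) hz a b

lemma dd_add (hS : UniqueDiffOn ℝ S) {f g : X → V} (hf : ContDiffOn ℝ ∞ f S)
    (hg : ContDiffOn ℝ ∞ g S) (hz : z ∈ S) :
    dd S a (fun w => f w + g w) z = dd S a f z + dd S a g z := by
  rw [dd, fderivWithin_fun_add (hS z hz) (differentiableWithinAt_of_smooth hf hz)
    (differentiableWithinAt_of_smooth hg hz)]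
  rfl

lemma dd_smul (hS : UniqueDiffOn ℝ S) {f : X → ℝ} {g : X → V} (hf : ContDiffOn ℝ ∞ f S)
    (hg : ContDiffOn ℝ ∞ g S) (hz : z ∈ S) :
    dd S a (fun w => f w • g w) z = dd S a f z • g z + f z • dd S a g z := by
  rw [dd, fderivWithin_fun_smul (hS z hz) (differentiableWithinAt_of_smooth hf hz)
    (differentiableWithinAt_of_smooth hg hz)]
  simp [dd, add_comm]

lemma dd_clm_apply (hS : UniqueDiffOn ℝ S) {L : X → V →L[ℝ] W} {g : X → V}
    (hL : ContDiffOn ℝ ∞ L S) (hg : ContDiffOn ℝ ∞ g S) (hz : z ∈ S) :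
    dd S a (fun w => L w (g w)) z = dd S a L z (g z) + L z (dd S a g z) := by
  rw [dd, fderivWithin_clm_apply (hS z hz) (differentiableWithinAt_of_smooth hL hz)
    (differentiableWithinAt_of_smooth hg hz)]
  simp [dd, add_comm]

lemma dd_clm_apply₂ (hS : UniqueDiffOn ℝ S) {L : X → Y →L[ℝ] V →L[ℝ] W} {f : X → Y} {g : X → V}
    (hL : ContDiffOn ℝ ∞ L S) (hf : ContDiffOn ℝ ∞ f S) (hg : ContDiffOn ℝ ∞ g S) (hz : z ∈ S) :
    dd S a (fun w => L w (f w) (g w)) z =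
      dd S a L z (f z) (g z) + L z (dd S a f z) (g z) + L z (f z) (dd S a g z) := by
  rw [dd_clm_apply hS (hL.clm_apply hf) hg hz, dd_clm_apply hS hL hf hz]
  rfl

lemma dd_comp (hS : UniqueDiffOn ℝ S) {f : X → Y} {L : Y → V} {O : Set Y} (hO : IsOpen O)
    (hL : ContDiffOn ℝ ∞ L O) (hf : ContDiffOn ℝ ∞ f S) (hfO : MapsTo f S O) (hz : z ∈ S) :
    dd S a (fun w => L (f w)) z = fderiv ℝ L (f z) (dd S a f z) := by
  have h1 : DifferentiableAt ℝ L (f z) :=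
    (hL.contDiffAt (hO.mem_nhds (hfO hz))).differentiableAt (by simp)
  have := (h1.hasFDerivAt.comp_hasFDerivWithinAt z
    (differentiableWithinAt_of_smooth hf hz).hasFDerivWithinAt).fderivWithin (hS z hz)
  simp only [Function.comp_def] at this
  rw [dd, this]
  rfl

end DirectionalDerivative

/-! ### Covariant derivatives along a map -/

section Covariant

variable {X Y : Type*} [NormedAddCommGroup X] [NormedSpace ℝ X]
  [NormedAddCommGroup Y] [NormedSpace ℝ Y]

/-- The covariant derivative in the direction `a` of a vector field `V` along the map `F`. -/
noncomputable def cov (Γ : Y → Y →L[ℝ] Y →L[ℝ] Y) (F : X → Y) (S : Set X) (a : X) (V : X → Y)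
    (z : X) : Y :=
  dd S a V z + Γ (F z) (dd S a F z) (V z)

/-- The curvature `R(u, v)w` of the connection with Christoffel symbols `Γ`. -/
noncomputable def curv (Γ : Y → Y →L[ℝ] Y →L[ℝ] Y) (q u v w : Y) : Y :=
  fderiv ℝ Γ q u v w - fderiv ℝ Γ q v u w + Γ q u (Γ q v w) - Γ q v (Γ q u w)

set_option synthInstance.maxHeartbeats 200000 in
lemma curv_smul (Γ : Y → Y →L[ℝ] Y →L[ℝ] Y) (q u v w : Y) (c : ℝ) :
    curv Γ q (c • u) v w = c • curv Γ q u v w := by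
  simp only [curv, map_smul, _root_.smul_apply, smul_add, smul_sub]

variable {G : Y → Y →L[ℝ] Y →L[ℝ] ℝ} {Γ : Y → Y →L[ℝ] Y →L[ℝ] Y} {O : Set Y} {F : X → Y}
  {S : Set X} {a b c : X} {z : X}

lemma contDiffOn_cov (hS : UniqueDiffOn ℝ S) (hΓ : ContDiffOn ℝ ∞ Γ O)
    (hF : ContDiffOn ℝ ∞ F S) (hFO : MapsTo F S O) {V : X → Y} (hV : ContDiffOn ℝ ∞ V S) :
    ContDiffOn ℝ ∞ (cov Γ F S a V) S :=
  (contDiffOn_dd hS hV).add (((hΓ.comp hF hFO).clm_apply (contDiffOn_dd hS hF)).clm_apply hV)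

lemma cov_congr {V W : X → Y} (h : EqOn V W S) (hz : z ∈ S) :
    cov Γ F S a V z = cov Γ F S a W z := by
  rw [cov, cov, dd_congr h hz, h hz]

lemma cov_smul (hS : UniqueDiffOn ℝ S) {f : X → ℝ} {V : X → Y} (hf : ContDiffOn ℝ ∞ f S)
    (hV : ContDiffOn ℝ ∞ V S) (hz : z ∈ S) :
    cov Γ F S a (fun w => f w • V w) z = dd S a f z • V z + f z • cov Γ F S a V z := by
  rw [cov, cov, dd_smul hS hf hV hz, map_smul, smul_add, add_assoc]

/-- Vanishing torsion along a map: mixed partial derivatives commute and `Γ` is symmetric. -/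
lemma cov_dd_comm (hS : UniqueDiffOn ℝ S) (hS' : S ⊆ closure (interior S))
    (hF : ContDiffOn ℝ ∞ F S) (hsymm : ∀ q ∈ O, ∀ u v, Γ q u v = Γ q v u) (hFO : MapsTo F S O)
    (hz : z ∈ S) : cov Γ F S a (dd S b F) z = cov Γ F S b (dd S a F) z := by
  rw [cov, cov, dd_comm hS hS' hF hz, hsymm _ (hFO hz)]

lemma dd_metric (hS : UniqueDiffOn ℝ S) (hO : IsOpen O) (hG : ContDiffOn ℝ ∞ G O)
    (hcompat : ∀ q ∈ O, ∀ u v w, fderiv ℝ G q u v w = G q (Γ q u v) w + G q v (Γ q u w))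
    (hF : ContDiffOn ℝ ∞ F S) (hFO : MapsTo F S O) {V W : X → Y} (hV : ContDiffOn ℝ ∞ V S)
    (hW : ContDiffOn ℝ ∞ W S) (hz : z ∈ S) :
    dd S a (fun w => G (F w) (V w) (W w)) z =
      G (F z) (cov Γ F S a V z) (W z) + G (F z) (V z) (cov Γ F S a W z) := by
  rw [dd_clm_apply₂ hS (L := fun w => G (F w)) (hG.comp hF hFO) hV hW hz,
    dd_comp hS hO hG hF hFO hz, hcompat _ (hFO hz)]
  simp only [cov, map_add, _root_.add_apply]
  ring

/-- The Ricci identity. The directions `a`, `b` are constant, so there is no bracket term. In the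
expansion `key` everything except the terms of `curv` is symmetric in the two directions. -/
lemma cov_cov_sub (hS : UniqueDiffOn ℝ S) (hS' : S ⊆ closure (interior S)) (hO : IsOpen O)
    (hΓ : ContDiffOn ℝ ∞ Γ O) (hF : ContDiffOn ℝ ∞ F S) (hFO : MapsTo F S O) {V : X → Y}
    (hV : ContDiffOn ℝ ∞ V S) (hz : z ∈ S) :
    cov Γ F S a (cov Γ F S b V) z =
      cov Γ F S b (cov Γ F S a V) z + curv Γ (F z) (dd S a F z) (dd S b F z) (V z) := by
  have key : ∀ c d : X, cov Γ F S c (cov Γ F S d V) z = dd S c (dd S d V) z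
      + fderiv ℝ Γ (F z) (dd S c F z) (dd S d F z) (V z)
      + Γ (F z) (dd S c (dd S d F) z) (V z) + Γ (F z) (dd S d F z) (dd S c V z)
      + Γ (F z) (dd S c F z) (dd S d V z)
      + Γ (F z) (dd S c F z) (Γ (F z) (dd S d F z) (V z)) := by
    intro c d
    have hd : ContDiffOn ℝ ∞ (fun w => Γ (F w) (dd S d F w) (V w)) S :=
      ((hΓ.comp hF hFO).clm_apply (contDiffOn_dd hS hF)).clm_apply hV
    have h1 : dd S c (cov Γ F S d V) z = _ := dd_add hS (contDiffOn_dd hS hV) hd hz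
    rw [cov, h1, dd_clm_apply₂ hS (L := fun w => Γ (F w)) (hΓ.comp hF hFO) (contDiffOn_dd hS hF)
      hV hz, dd_comp hS hO hΓ hF hFO hz]
    simp only [cov, map_add]
    abel
  rw [key, key, curv, dd_comm hS hS' hV hz, dd_comm hS hS' hF hz]
  abel

end Covariant

/-! ### Evolution of the fundamental forms of a hypersurface -/

section Evolution

variable {X Y : Type*} [NormedAddCommGroup X] [NormedSpace ℝ X]
  [NormedAddCommGroup Y] [NormedSpace ℝ Y] {n : ℕ}

/-- A spacelike hypersurface in coordinates, depending on parameters: `F` is the map, `ν` its timelike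
unit normal, the directions `e i` are those tangent to the hypersurface, `S` is the domain, and `G`,
`Γ` are the metric and the Levi-Civita connection on the target domain `O`. -/
structure UnitNormalMap (G : Y → Y →L[ℝ] Y →L[ℝ] ℝ) (Γ : Y → Y →L[ℝ] Y →L[ℝ] Y) (O : Set Y)
    (F ν : X → Y) (S : Set X) (e : Fin n → X) : Prop where
  uniqueDiff : UniqueDiffOn ℝ S
  subset_closure : S ⊆ closure (interior S)
  isOpen : IsOpen O
  mapsTo : MapsTo F S O
  smooth_metric : ContDiffOn ℝ ∞ G O
  smooth_connection : ContDiffOn ℝ ∞ Γ O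
  smooth_map : ContDiffOn ℝ ∞ F S
  smooth_normal : ContDiffOn ℝ ∞ ν S
  metric_symm : ∀ q ∈ O, ∀ u v, G q u v = G q v u
  connection_symm : ∀ q ∈ O, ∀ u v, Γ q u v = Γ q v u
  compat : ∀ q ∈ O, ∀ u v w, fderiv ℝ G q u v w = G q (Γ q u v) w + G q v (Γ q u w)
  unit : ∀ z ∈ S, G (F z) (ν z) (ν z) = -1
  normal : ∀ z ∈ S, ∀ i, G (F z) (dd S (e i) F z) (ν z) = 0

/-- A hypersurface flow in coordinates: `F` moves with speed `φ` in the direction of its timelike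
unit normal `ν`, where `τ` is the time direction. -/
structure NormalFlow (G : Y → Y →L[ℝ] Y →L[ℝ] ℝ) (Γ : Y → Y →L[ℝ] Y →L[ℝ] Y) (O : Set Y)
    (F ν : X → Y) (φ : X → ℝ) (S : Set X) (e : Fin n → X) (τ : X) : Prop
    extends UnitNormalMap G Γ O F ν S e where
  smooth_speed : ContDiffOn ℝ ∞ φ S
  flow : ∀ z ∈ S, dd S τ F z = φ z • ν z

/-- The first fundamental form of a map along the directions `e i`. -/
noncomputable def formI (G : Y → Y →L[ℝ] Y →L[ℝ] ℝ) (F : X → Y) (S : Set X) (e : Fin n → X)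
    (z : X) : Matrix (Fin n) (Fin n) ℝ :=
  Matrix.of fun i j => G (F z) (dd S (e i) F z) (dd S (e j) F z)

/-- The second fundamental form of a map along the directions `e i`. -/
noncomputable def formII (G : Y → Y →L[ℝ] Y →L[ℝ] ℝ) (Γ : Y → Y →L[ℝ] Y →L[ℝ] Y) (F ν : X → Y)
    (S : Set X) (e : Fin n → X) (z : X) : Matrix (Fin n) (Fin n) ℝ :=
  Matrix.of fun i j => - G (F z) (cov Γ F S (e i) (dd S (e j) F) z) (ν z)

/-- The Hessian of `φ` with respect to the first fundamental form. -/
noncomputable def flowHessian (G : Y → Y →L[ℝ] Y →L[ℝ] ℝ) (F : X → Y) (φ : X → ℝ) (S : Set X)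
    (e : Fin n → X) (z : X) : Matrix (Fin n) (Fin n) ℝ :=
  Matrix.of fun i j => dd S (e i) (dd S (e j) φ) z - ∑ k, (1 / 2) * (∑ l, (formI G F S e z)⁻¹ k l *
    (dd S (e i) (fun w => formI G F S e w j l) z + dd S (e j) (fun w => formI G F S e w i l) z
      - dd S (e l) (fun w => formI G F S e w i j) z)) * dd S (e k) φ z

variable {G : Y → Y →L[ℝ] Y →L[ℝ] ℝ} {Γ : Y → Y →L[ℝ] Y →L[ℝ] Y} {O : Set Y} {F ν : X → Y}
  {φ : X → ℝ} {S : Set X} {e : Fin n → X} {τ : X} {z : X}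

namespace UnitNormalMap

lemma dd_metric (H : UnitNormalMap G Γ O F ν S e) {V W : X → Y} (hV : ContDiffOn ℝ ∞ V S)
    (hW : ContDiffOn ℝ ∞ W S) (hz : z ∈ S) (a : X) :
    dd S a (fun w => G (F w) (V w) (W w)) z =
      G (F z) (cov Γ F S a V z) (W z) + G (F z) (V z) (cov Γ F S a W z) :=
  LorentzFlow.dd_metric H.uniqueDiff H.isOpen H.smooth_metric H.compat H.smooth_map H.mapsTo hV hW
    hz

lemma smooth_dd (H : UnitNormalMap G Γ O F ν S e) (a : X) : ContDiffOn ℝ ∞ (dd S a F) S :=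
  contDiffOn_dd H.uniqueDiff H.smooth_map

lemma smooth_cov (H : UnitNormalMap G Γ O F ν S e) {V : X → Y} (hV : ContDiffOn ℝ ∞ V S) (a : X) :
    ContDiffOn ℝ ∞ (cov Γ F S a V) S :=
  contDiffOn_cov H.uniqueDiff H.smooth_connection H.smooth_map H.mapsTo hV

lemma cov_normal_normal (H : UnitNormalMap G Γ O F ν S e) (hz : z ∈ S) (a : X) :
    G (F z) (cov Γ F S a ν z) (ν z) = 0 := by
  have h1 := H.dd_metric H.smooth_normal H.smooth_normal hz a
  rw [dd_congr (g := fun _ => (-1 : ℝ)) (fun w hw => H.unit w hw) hz, dd_const,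
    H.metric_symm _ (H.mapsTo hz) (ν z)] at h1
  linarith

/-- Differentiate `G(Fⱼ, ν) = 0`. The direction `a` is arbitrary on purpose: a spatial one gives the
Weingarten equation, the time direction gives the evolution of `ν`. -/
lemma cov_tangent_normal (H : UnitNormalMap G Γ O F ν S e) (hz : z ∈ S) (a : X) (j : Fin n) :
    G (F z) (cov Γ F S a ν z) (dd S (e j) F z) =
      - G (F z) (cov Γ F S a (dd S (e j) F) z) (ν z) := by
  have h1 := H.dd_metric (H.smooth_dd (e j)) H.smooth_normal hz a
  rw [dd_congr (g := fun _ => (0 : ℝ)) (fun w hw => H.normal w hw j) hz, dd_const,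
    H.metric_symm _ (H.mapsTo hz) (dd S (e j) F z)] at h1
  linarith

lemma formII_eq (H : UnitNormalMap G Γ O F ν S e) (hz : z ∈ S) (i j : Fin n) :
    formII G Γ F ν S e z i j = G (F z) (cov Γ F S (e i) ν z) (dd S (e j) F z) :=
  (H.cov_tangent_normal hz (e i) j).symm

lemma formI_symm (H : UnitNormalMap G Γ O F ν S e) (hz : z ∈ S) (i j : Fin n) :
    formI G F S e z i j = formI G F S e z j i :=
  H.metric_symm _ (H.mapsTo hz) _ _

lemma formII_symm (H : UnitNormalMap G Γ O F ν S e) (hz : z ∈ S) (i j : Fin n) :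
    formII G Γ F ν S e z i j = formII G Γ F ν S e z j i := by
  simp only [formII, of_apply]
  rw [cov_dd_comm H.uniqueDiff H.subset_closure H.smooth_map H.connection_symm H.mapsTo hz]

lemma smooth_formI (H : UnitNormalMap G Γ O F ν S e) (i j : Fin n) :
    ContDiffOn ℝ ∞ (fun w => formI G F S e w i j) S :=
  ((H.smooth_metric.comp H.smooth_map H.mapsTo).clm_apply (H.smooth_dd _)).clm_apply (H.smooth_dd _)

lemma smooth_formII (H : UnitNormalMap G Γ O F ν S e) (i j : Fin n) :
    ContDiffOn ℝ ∞ (fun w => formII G Γ F ν S e w i j) S :=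
  (((H.smooth_metric.comp H.smooth_map H.mapsTo).clm_apply
    (H.smooth_cov (H.smooth_dd _) _)).clm_apply H.smooth_normal).neg

/-- `G(∇_{Fᵢ} Fⱼ, Fₗ)` is given by the Christoffel symbols of the induced metric. -/
lemma metric_cov_tangent (H : UnitNormalMap G Γ O F ν S e) (hz : z ∈ S) (i j l : Fin n) :
    dd S (e i) (fun w => formI G F S e w j l) z + dd S (e j) (fun w => formI G F S e w i l) z
      - dd S (e l) (fun w => formI G F S e w i j) z =
    2 * G (F z) (cov Γ F S (e i) (dd S (e j) F) z) (dd S (e l) F z) := by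
  have h1 : ∀ i j l, dd S (e i) (fun w => formI G F S e w j l) z = _ := fun i j l =>
    H.dd_metric (H.smooth_dd (e j)) (H.smooth_dd (e l)) hz (e i)
  have hc : ∀ i j, cov Γ F S (e i) (dd S (e j) F) z = cov Γ F S (e j) (dd S (e i) F) z :=
    fun i j => cov_dd_comm H.uniqueDiff H.subset_closure H.smooth_map H.connection_symm H.mapsTo hz
  rw [h1, h1, h1, hc j i, hc l i, hc l j, H.metric_symm _ (H.mapsTo hz) (dd S (e j) F z),
    H.metric_symm _ (H.mapsTo hz) (dd S (e i) F z)]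
  ring

end UnitNormalMap

namespace NormalFlow

/-- `∇ₜFₐ = ∇ₐFₜ = ∇ₐ(φν)`. Both evolution equations rest on this exchange. -/
lemma cov_time_map (H : NormalFlow G Γ O F ν φ S e τ) (hz : z ∈ S) (a : X) :
    cov Γ F S τ (dd S a F) z = dd S a φ z • ν z + φ z • cov Γ F S a ν z := by
  rw [cov_dd_comm H.uniqueDiff H.subset_closure H.smooth_map H.connection_symm H.mapsTo hz,
    cov_congr (W := fun w => φ w • ν w) (fun w hw => H.flow w hw) hz,
    cov_smul H.uniqueDiff H.smooth_speed H.smooth_normal hz]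

/-- The tangential part of `∇ₜν` is the gradient of `φ`; the sign is positive because `G(ν, ν) =
-1`. -/
lemma cov_time_normal (H : NormalFlow G Γ O F ν φ S e τ) (hz : z ∈ S) (j : Fin n) :
    G (F z) (cov Γ F S τ ν z) (dd S (e j) F z) = dd S (e j) φ z := by
  rw [H.cov_tangent_normal hz, H.cov_time_map hz]
  simp [H.unit z hz, H.cov_normal_normal hz]

/-- In `G(∇ₜFᵢ, Fⱼ) + G(Fᵢ, ∇ₜFⱼ)` the `dφ` terms are normal and drop out; each remaining term is `φ
hᵢⱼ`. -/
lemma dd_time_formI (H : NormalFlow G Γ O F ν φ S e τ) (hz : z ∈ S) (i j : Fin n) :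
    dd S τ (fun w => formI G F S e w i j) z = ((2 * φ z) • formII G Γ F ν S e z) i j := by
  have h1 := H.dd_metric (H.smooth_dd (e i)) (H.smooth_dd (e j)) hz τ
  have h2 : dd S τ (fun w => formI G F S e w i j) z = _ := h1
  rw [h2, H.cov_time_map hz, H.cov_time_map hz]
  simp only [map_add, map_smul, _root_.add_apply, _root_.smul_apply,
    smul_eq_mul, Matrix.smul_apply]
  rw [H.metric_symm _ (H.mapsTo hz) (ν z), H.normal z hz, H.normal z hz,
    H.metric_symm _ (H.mapsTo hz) _ (cov Γ F S (e j) ν z), ← H.formII_eq hz, ← H.formII_eq hz,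
    H.formII_symm hz j i]
  ring

/-- Differentiate `hᵢⱼ = G(∇ᵢν, Fⱼ)` in time. The factor `∇ₜFⱼ` contributes `φ G(∇ᵢν, ∇ⱼν) = φ(h g⁻¹
h)ᵢⱼ`. Commuting `∇ₜ` past `∇ᵢ` contributes the curvature term, and `G(∇ᵢ∇ₜν, Fⱼ)` is the Hessian
because `∇ₜν` is the gradient of `φ`. The hypothesis `hdec` expands vectors in the frame `Fₖ, ν`. -/
lemma dd_time_formII (H : NormalFlow G Γ O F ν φ S e τ) (hz : z ∈ S)
    (hdec : ∀ V, V = ∑ k, (∑ l, (formI G F S e z)⁻¹ k l * G (F z) V (dd S (e l) F z)) •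
      dd S (e k) F z - G (F z) V (ν z) • ν z) (i j : Fin n) :
    dd S τ (fun w => formII G Γ F ν S e w i j) z =
      (flowHessian G F φ S e z
        + φ z • (formII G Γ F ν S e z * (formI G F S e z)⁻¹ * formII G Γ F ν S e z)
        + φ z • Matrix.of fun i j => G (F z)
          (curv Γ (F z) (ν z) (dd S (e i) F z) (ν z)) (dd S (e j) F z)) i j := by
  have hdiff := H.uniqueDiff
  have e1 : dd S τ (fun w => formII G Γ F ν S e w i j) z =
      dd S τ (fun w => G (F w) (cov Γ F S (e i) ν w) (dd S (e j) F w)) z :=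
    dd_congr (fun w hw => H.formII_eq hw i j) hz
  have e2 : cov Γ F S τ (cov Γ F S (e i) ν) z = cov Γ F S (e i) (cov Γ F S τ ν) z
      + φ z • curv Γ (F z) (ν z) (dd S (e i) F z) (ν z) := by
    rw [cov_cov_sub hdiff H.subset_closure H.isOpen H.smooth_connection H.smooth_map H.mapsTo
      H.smooth_normal hz, H.flow z hz]
    rw [curv_smul]
  -- This is `∂ⱼφ = G(∇ₜν, Fⱼ)` differentiated in the direction `i`. Its second term will be the
  -- Christoffel part of the Hessian.
  have e3 : dd S (e i) (dd S (e j) φ) z =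
      G (F z) (cov Γ F S (e i) (cov Γ F S τ ν) z) (dd S (e j) F z) +
      G (F z) (cov Γ F S τ ν z) (cov Γ F S (e i) (dd S (e j) F) z) := by
    rw [← H.dd_metric (H.smooth_cov H.smooth_normal τ) (H.smooth_dd (e j)) hz (e i)]
    exact dd_congr (fun w hw => (H.cov_time_normal hw j).symm) hz
  have hd1 := hdec (cov Γ F S τ ν z)
  simp only [H.cov_normal_normal hz, zero_smul, sub_zero, H.cov_time_normal hz] at hd1
  have e4 : G (F z) (cov Γ F S τ ν z) (cov Γ F S (e i) (dd S (e j) F) z) =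
      ∑ k, (1 / 2) * (∑ l, (formI G F S e z)⁻¹ k l *
        (dd S (e i) (fun w => formI G F S e w j l) z + dd S (e j) (fun w => formI G F S e w i l) z
      - dd S (e l) (fun w => formI G F S e w i j) z)) * dd S (e k) φ z := by
    have hT : (formI G F S e z)ᵀ = formI G F S e z := by
      ext i j; exact H.formI_symm hz j i
    have hsymm : ∀ k l, (formI G F S e z)⁻¹ k l = (formI G F S e z)⁻¹ l k := by
      intro k l
      conv_lhs => rw [← hT, ← transpose_nonsing_inv, transpose_apply]
    rw [hd1]
    simp only [map_sum, map_smul, _root_.sum_apply, _root_.smul_apply,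
      smul_eq_mul, H.metric_cov_tangent hz, Finset.sum_mul, Finset.mul_sum]
    rw [Finset.sum_comm]
    refine Finset.sum_congr rfl fun k _ => Finset.sum_congr rfl fun l _ => ?_
    rw [hsymm l k, H.metric_symm _ (H.mapsTo hz) (dd S (e l) F z)]
    ring
  -- `∇ᵢν` has no normal part, so it is `∇ᵢν = gᵏˡ hᵢₗ Fₖ`.
  have hd2 := hdec (cov Γ F S (e i) ν z)
  simp only [H.cov_normal_normal hz, zero_smul, sub_zero, ← H.formII_eq hz] at hd2
  have e5 : G (F z) (cov Γ F S (e i) ν z) (cov Γ F S (e j) ν z) =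
      (formII G Γ F ν S e z * (formI G F S e z)⁻¹ * formII G Γ F ν S e z) i j := by
    have hT : (formI G F S e z)ᵀ = formI G F S e z := by
      ext i j; exact H.formI_symm hz j i
    have hsymm : ∀ k l, (formI G F S e z)⁻¹ k l = (formI G F S e z)⁻¹ l k := by
      intro k l
      conv_lhs => rw [← hT, ← transpose_nonsing_inv, transpose_apply]
    rw [hd2]
    simp only [map_sum, map_smul, _root_.sum_apply, _root_.smul_apply,
      smul_eq_mul, Matrix.mul_apply]
    refine Finset.sum_congr rfl fun k _ => ?_
    rw [H.metric_symm _ (H.mapsTo hz) (dd S (e k) F z), ← H.formII_eq hz, H.formII_symm hz j k]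
    congr 1
    refine Finset.sum_congr rfl fun l _ => ?_
    rw [hsymm k l, mul_comm]
  rw [e1, H.dd_metric (H.smooth_cov H.smooth_normal (e i)) (H.smooth_dd (e j)) hz τ, e2,
    H.cov_time_map hz]
  simp only [map_add, map_smul, _root_.add_apply, _root_.smul_apply,
    smul_eq_mul, Matrix.smul_apply, Matrix.add_apply, flowHessian, of_apply,
    H.cov_normal_normal hz, e5]
  rw [← e4, e3]
  ring

end NormalFlow

end Evolution

/-! ### Tensors with given components -/

section Components

variable {m : ℕ}

/-- The bilinear form with components `A i j`. -/
noncomputable def bil (A : Matrix (Fin m) (Fin m) ℝ) : E m →L[ℝ] E m →L[ℝ] ℝ :=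
  ∑ p : Fin m × Fin m, A p.1 p.2 • (EuclideanSpace.proj p.1 : E m →L[ℝ] ℝ).smulRight
    (EuclideanSpace.proj p.2 : E m →L[ℝ] ℝ)

/-- The vector valued bilinear map with components `C k i j`. -/
noncomputable def vbil (C : Fin m → Fin m → Fin m → ℝ) : E m →L[ℝ] E m →L[ℝ] E m :=
  ∑ p : Fin m × Fin m × Fin m, C p.1 p.2.1 p.2.2 •
    (EuclideanSpace.proj p.2.1 : E m →L[ℝ] ℝ).smulRight
      ((EuclideanSpace.proj p.2.2 : E m →L[ℝ] ℝ).smulRight (EuclideanSpace.single p.1 (1 : ℝ)))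

lemma bil_apply (A : Matrix (Fin m) (Fin m) ℝ) (u v : E m) :
    bil A u v = ∑ i, ∑ j, A i j * u i * v j := by
  simp [bil, mul_assoc, Fintype.sum_prod_type]

lemma vbil_apply (C : Fin m → Fin m → Fin m → ℝ) (u v : E m) (k : Fin m) :
    vbil C u v k = ∑ i, ∑ j, C k i j * u i * v j := by
  simp [vbil, mul_assoc, Finset.sum_apply, Pi.single_apply, Finset.sum_ite_eq,
    Fintype.sum_prod_type]

lemma bil_symm {A : Matrix (Fin m) (Fin m) ℝ} (hA : ∀ i j, A i j = A j i) (u v : E m) :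
    bil A u v = bil A v u := by
  rw [bil_apply, bil_apply, Finset.sum_comm]
  refine Finset.sum_congr rfl fun i _ => Finset.sum_congr rfl fun j _ => ?_
  rw [hA j i]; ring

variable {X : Type*} [NormedAddCommGroup X] [NormedSpace ℝ X]

lemma contDiffOn_sum_smul {ι V : Type*} [Fintype ι] [NormedAddCommGroup V] [NormedSpace ℝ V]
    {c : X → ι → ℝ} {O : Set X} (hc : ∀ i, ContDiffOn ℝ ∞ (fun q => c q i) O) (B : ι → V) :
    ContDiffOn ℝ ∞ (fun q => ∑ i, c q i • B i) O :=
  ContDiffOn.sum fun i _ => (hc i).smul contDiffOn_const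

lemma fderiv_sum_smul {ι V : Type*} [Fintype ι] [NormedAddCommGroup V] [NormedSpace ℝ V]
    {c : X → ι → ℝ} {q : X} (hc : ∀ i, DifferentiableAt ℝ (fun q => c q i) q) (B : ι → V)
    (u : X) : fderiv ℝ (fun q => ∑ i, c q i • B i) q u =
      ∑ i, fderiv ℝ (fun q => c q i) q u • B i := by
  have h1 : HasFDerivAt (fun q => ∑ i, c q i • B i) _ q :=
    HasFDerivAt.fun_sum fun i (_ : i ∈ Finset.univ) => (hc i).hasFDerivAt.smul_const (B i)
  rw [h1.fderiv]
  simp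

lemma contDiffOn_bil {A : X → Matrix (Fin m) (Fin m) ℝ} {O : Set X}
    (hA : ∀ i j, ContDiffOn ℝ ∞ (fun q => A q i j) O) : ContDiffOn ℝ ∞ (fun q => bil (A q)) O := by
  unfold bil
  apply contDiffOn_sum_smul (c := fun q (p : Fin m × Fin m) => A q p.1 p.2)
  exact fun p => hA p.1 p.2

lemma contDiffOn_vbil {C : X → Fin m → Fin m → Fin m → ℝ} {O : Set X}
    (hC : ∀ k i j, ContDiffOn ℝ ∞ (fun q => C q k i j) O) :
    ContDiffOn ℝ ∞ (fun q => vbil (C q)) O := by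
  unfold vbil
  apply contDiffOn_sum_smul (c := fun q (p : Fin m × Fin m × Fin m) => C q p.1 p.2.1 p.2.2)
  exact fun p => hC p.1 p.2.1 p.2.2

lemma fderiv_bil {A : X → Matrix (Fin m) (Fin m) ℝ} {q : X}
    (hA : ∀ i j, DifferentiableAt ℝ (fun q => A q i j) q) (u : X) :
    fderiv ℝ (fun q => bil (A q)) q u =
      bil (Matrix.of fun i j => fderiv ℝ (fun q => A q i j) q u) := by
  have h := fun B : Fin m × Fin m → (E m →L[ℝ] E m →L[ℝ] ℝ) =>
    fderiv_sum_smul (c := fun q (p : Fin m × Fin m) => A q p.1 p.2) (fun p => hA p.1 p.2) B u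
  exact h _

lemma fderiv_vbil {C : X → Fin m → Fin m → Fin m → ℝ} {q : X}
    (hC : ∀ k i j, DifferentiableAt ℝ (fun q => C q k i j) q) (u : X) :
    fderiv ℝ (fun q => vbil (C q)) q u = vbil fun k i j => fderiv ℝ (fun q => C q k i j) q u := by
  have h := fun B : Fin m × Fin m × Fin m → (E m →L[ℝ] E m →L[ℝ] E m) =>
    fderiv_sum_smul (c := fun q (p : Fin m × Fin m × Fin m) => C q p.1 p.2.1 p.2.2)
      (fun p => hC p.1 p.2.1 p.2.2) B u
  exact h _

lemma fderiv_eq_sum_pd (f : E m → ℝ) (q u : E m) : fderiv ℝ f q u = ∑ i, pd i f q * u i := by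
  have : u = ∑ i, u i • EuclideanSpace.single i (1 : ℝ) := by
    ext j; simp [Finset.sum_apply, Pi.single_apply]
  conv_lhs => rw [this]
  simp [pd, mul_comm]

lemma contDiffOn_pd {f : E m → ℝ} {O : Set (E m)} (hO : IsOpen O) (hf : ContDiffOn ℝ ∞ f O)
    (i : Fin m) : ContDiffOn ℝ ∞ (pd i f) O :=
  (hf.fderiv_of_isOpen hO (m := ∞) (by simp)).clm_apply contDiffOn_const

end Components

/-! ### The Levi-Civita connection in coordinates -/

section LeviCivita

variable {m : ℕ} {g : E m → Matrix (Fin m) (Fin m) ℝ} {O : Set (E m)} {q : E m}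

/-- The metric with components `g`. -/
noncomputable def metricForm (g : E m → Matrix (Fin m) (Fin m) ℝ) (q : E m) :
    E m →L[ℝ] E m →L[ℝ] ℝ := bil (g q)

/-- The Levi-Civita connection of the metric with components `g`. -/
noncomputable def connectionForm (g : E m → Matrix (Fin m) (Fin m) ℝ) (q : E m) :
    E m →L[ℝ] E m →L[ℝ] E m := vbil fun k i j => christoffel g k i j q

lemma smooth_metricForm (hg : ∀ i j, ContDiffOn ℝ ∞ (fun q => g q i j) O) :
    ContDiffOn ℝ ∞ (metricForm g) O := contDiffOn_bil hg

lemma smooth_christoffel (hO : IsOpen O) (hg : ∀ i j, ContDiffOn ℝ ∞ (fun q => g q i j) O)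
    (hdet : ∀ q ∈ O, (g q).det ≠ 0) (k i j : Fin m) :
    ContDiffOn ℝ ∞ (christoffel g k i j) O := by
  refine contDiffOn_const.mul (ContDiffOn.sum fun l _ => ContDiffOn.mul ?_ ?_)
  · exact fun q hq => contDiffWithinAt_matrix_inv (fun i j => hg i j q hq) (hdet q hq) k l
  · exact ((contDiffOn_pd hO (hg j l) i).add (contDiffOn_pd hO (hg i l) j)).sub
      (contDiffOn_pd hO (hg i j) l)

lemma smooth_connectionForm (hO : IsOpen O) (hg : ∀ i j, ContDiffOn ℝ ∞ (fun q => g q i j) O)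
    (hdet : ∀ q ∈ O, (g q).det ≠ 0) : ContDiffOn ℝ ∞ (connectionForm g) O :=
  contDiffOn_vbil fun k i j => smooth_christoffel hO hg hdet k i j

lemma christoffel_symm (hsymm : ∀ q i j, g q i j = g q j i) (k i j : Fin m) (q : E m) :
    christoffel g k i j q = christoffel g k j i q := by
  unfold christoffel
  congr 1
  refine Finset.sum_congr rfl fun l _ => ?_
  simp only [hsymm _ i j]
  ring

lemma connectionForm_symm (hsymm : ∀ q i j, g q i j = g q j i) (q u v : E m) :
    connectionForm g q u v = connectionForm g q v u := by
  ext k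
  rw [connectionForm, vbil_apply, vbil_apply, Finset.sum_comm]
  refine Finset.sum_congr rfl fun i _ => Finset.sum_congr rfl fun j _ => ?_
  rw [christoffel_symm hsymm k j i]; ring

/-- Lowering the upper index cancels the inverse metric and leaves the Christoffel symbols of the
first kind. -/
lemma sum_metric_mul_christoffel (hsymm : ∀ q i j, g q i j = g q j i) (hdet : (g q).det ≠ 0)
    (l i j : Fin m) : ∑ k, g q k l * christoffel g k i j q =
      (1 / 2) * (pd i (fun w => g w j l) q + pd j (fun w => g w i l) q
        - pd l (fun w => g w i j) q) := by
  set c : Fin m → ℝ := fun l => pd i (fun w => g w j l) q + pd j (fun w => g w i l) q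
        - pd l (fun w => g w i j) q with hc
  have h1 : (g q *ᵥ ((g q)⁻¹ *ᵥ c)) l = c l := by
    rw [mulVec_mulVec, mul_nonsing_inv _ hdet.isUnit, one_mulVec]
  have h2 : ∑ k, g q k l * christoffel g k i j q = (1 / 2) * (g q *ᵥ ((g q)⁻¹ *ᵥ c)) l := by
    simp only [mulVec, dotProduct, christoffel, Finset.mul_sum]
    refine Finset.sum_congr rfl fun k _ => Finset.sum_congr rfl fun a _ => ?_
    rw [hsymm q k l]
    simp only [hc]
    ring
  rw [h2, h1]

lemma fderiv_metricForm (hg : ∀ i j, DifferentiableAt ℝ (fun q => g q i j) q) (u v w : E m) :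
    fderiv ℝ (metricForm g) q u v w =
      ∑ i, ∑ j, ∑ k, pd i (fun w => g w j k) q * u i * v j * w k := by
  have h1 : fderiv ℝ (metricForm g) q u = _ := fderiv_bil hg u
  simp only [h1, bil_apply, of_apply, fderiv_eq_sum_pd, Finset.sum_mul]
  rw [Finset.sum_comm]
  conv_rhs => rw [Finset.sum_comm]
  rw [Finset.sum_comm]
  refine Finset.sum_congr rfl fun i _ => ?_
  rw [Finset.sum_comm]

/-- The Koszul formula. -/
lemma metricForm_connectionForm (hg : ∀ i j, DifferentiableAt ℝ (fun q => g q i j) q)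
    (hsymm : ∀ q i j, g q i j = g q j i) (hdet : (g q).det ≠ 0) (u v w : E m) :
    metricForm g q (connectionForm g q u v) w = (1 / 2) * (fderiv ℝ (metricForm g) q u v w
      + fderiv ℝ (metricForm g) q v u w - fderiv ℝ (metricForm g) q w u v) := by
  have h1 : metricForm g q (connectionForm g q u v) w =
      ∑ i, ∑ j, ∑ l, (∑ k, g q k l * christoffel g k i j q) * u i * v j * w l := by
    simp only [metricForm, connectionForm, bil_apply, vbil_apply, Finset.sum_mul, Finset.mul_sum]
    calc _ = ∑ k, ∑ i, ∑ l, ∑ j, g q k l * (christoffel g k i j q * u i * v j) * w l :=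
          Finset.sum_congr rfl fun k _ => Finset.sum_comm
      _ = ∑ i, ∑ k, ∑ l, ∑ j, g q k l * (christoffel g k i j q * u i * v j) * w l :=
          Finset.sum_comm
      _ = ∑ i, ∑ j, ∑ l, ∑ k, g q k l * (christoffel g k i j q * u i * v j) * w l := by
          refine Finset.sum_congr rfl fun i _ => ?_
          calc _ = ∑ k, ∑ j, ∑ l, g q k l * (christoffel g k i j q * u i * v j) * w l :=
                Finset.sum_congr rfl fun k _ => Finset.sum_comm
            _ = ∑ j, ∑ k, ∑ l, g q k l * (christoffel g k i j q * u i * v j) * w l :=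
                Finset.sum_comm
            _ = _ := Finset.sum_congr rfl fun j _ => Finset.sum_comm
      _ = _ := by
          refine Finset.sum_congr rfl fun i _ => Finset.sum_congr rfl fun j _ =>
            Finset.sum_congr rfl fun l _ => Finset.sum_congr rfl fun k _ => ?_
          ring
  have h2 : fderiv ℝ (metricForm g) q v u w =
      ∑ i, ∑ j, ∑ l, pd j (fun w => g w i l) q * u i * v j * w l := by
    rw [fderiv_metricForm hg, Finset.sum_comm]
    refine Finset.sum_congr rfl fun i _ => Finset.sum_congr rfl fun j _ =>
      Finset.sum_congr rfl fun l _ => ?_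
    ring
  have h3 : fderiv ℝ (metricForm g) q w u v =
      ∑ i, ∑ j, ∑ l, pd l (fun w => g w i j) q * u i * v j * w l := by
    rw [fderiv_metricForm hg, Finset.sum_comm]
    refine Finset.sum_congr rfl fun i _ => ?_
    rw [Finset.sum_comm]
    refine Finset.sum_congr rfl fun j _ => Finset.sum_congr rfl fun l _ => ?_
    ring
  rw [h1, fderiv_metricForm hg, h2, h3]
  simp only [← Finset.sum_add_distrib, ← Finset.sum_sub_distrib, Finset.mul_sum]
  refine Finset.sum_congr rfl fun i _ => Finset.sum_congr rfl fun j _ =>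
      Finset.sum_congr rfl fun l _ => ?_
  rw [sum_metric_mul_christoffel hsymm hdet]
  ring

lemma metricForm_symm (hsymm : ∀ q i j, g q i j = g q j i) (q u v : E m) :
    metricForm g q u v = metricForm g q v u := bil_symm (hsymm q) u v

lemma fderiv_metricForm_symm (hg : ∀ i j, DifferentiableAt ℝ (fun q => g q i j) q)
    (hsymm : ∀ q i j, g q i j = g q j i) (u v w : E m) :
    fderiv ℝ (metricForm g) q u v w = fderiv ℝ (metricForm g) q u w v := by
  rw [fderiv_metricForm hg, fderiv_metricForm hg]
  refine Finset.sum_congr rfl fun i _ => ?_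
  rw [Finset.sum_comm]
  refine Finset.sum_congr rfl fun j _ => Finset.sum_congr rfl fun l _ => ?_
  simp only [hsymm _ l j]
  ring

/-- Add the Koszul formulas for `(u, v, w)` and `(u, w, v)`: the derivatives in the directions `v`
and `w` cancel, and the two halves of the `u`-derivative add up. -/
lemma metricForm_compat (hg : ∀ i j, DifferentiableAt ℝ (fun q => g q i j) q)
    (hsymm : ∀ q i j, g q i j = g q j i) (hdet : (g q).det ≠ 0) (u v w : E m) :
    fderiv ℝ (metricForm g) q u v w = metricForm g q (connectionForm g q u v) w
      + metricForm g q v (connectionForm g q u w) := by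
  rw [metricForm_symm hsymm q v, metricForm_connectionForm hg hsymm hdet,
    metricForm_connectionForm hg hsymm hdet, fderiv_metricForm_symm hg hsymm u w v,
    fderiv_metricForm_symm hg hsymm w u v, fderiv_metricForm_symm hg hsymm v u w]
  ring

lemma curv_connectionForm_apply
    (hΓ : ∀ k i j, DifferentiableAt ℝ (christoffel g k i j) q) (u v w : E m) (l : Fin m) :
    curv (connectionForm g) q u v w l =
      ∑ i, ∑ j, ∑ k, curvature g l k i j q * u i * v j * w k := by
  have h1 : ∀ u v w : E m, fderiv ℝ (connectionForm g) q u v w l =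
      ∑ i, ∑ j, ∑ k, pd i (christoffel g l j k) q * u i * v j * w k := by
    intro u v w
    have h1 : fderiv ℝ (connectionForm g) q u = _ := fderiv_vbil hΓ u
    simp only [h1, vbil_apply, fderiv_eq_sum_pd, Finset.sum_mul]
    rw [Finset.sum_comm]
    conv_rhs => rw [Finset.sum_comm]
    rw [Finset.sum_comm]
    refine Finset.sum_congr rfl fun i _ => ?_
    rw [Finset.sum_comm]
  have h2 : ∀ u v w : E m, connectionForm g q u (connectionForm g q v w) l =
      ∑ i, ∑ j, ∑ k, (∑ a, christoffel g l i a q * christoffel g a j k q) * u i * v j * w k := by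
    intro u v w
    simp only [connectionForm, vbil_apply, Finset.mul_sum, Finset.sum_mul]
    refine Finset.sum_congr rfl fun i _ => ?_
    rw [Finset.sum_comm]
    refine Finset.sum_congr rfl fun j _ => ?_
    rw [Finset.sum_comm]
    refine Finset.sum_congr rfl fun k _ => Finset.sum_congr rfl fun a _ => ?_
    ring
  have h3 : curv (connectionForm g) q u v w l = fderiv ℝ (connectionForm g) q u v w l
    - fderiv ℝ (connectionForm g) q v u w l + connectionForm g q u (connectionForm g q v w) l
    - connectionForm g q v (connectionForm g q u w) l := by
    simp [curv]
  have hsw : ∀ f : Fin m → Fin m → Fin m → ℝ, ∑ i, ∑ j, ∑ k, f i j k * v i * u j * w k =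
      ∑ i, ∑ j, ∑ k, f j i k * u i * v j * w k := by
    intro f
    rw [Finset.sum_comm]
    refine Finset.sum_congr rfl fun i _ => Finset.sum_congr rfl fun j _ =>
      Finset.sum_congr rfl fun k _ => ?_
    ring
  rw [h3, h1, h1, h2, h2, hsw fun i j k => pd i (christoffel g l j k) q,
    hsw fun i j k => ∑ a, christoffel g l i a q * christoffel g a j k q]
  simp only [← Finset.sum_add_distrib, ← Finset.sum_sub_distrib]
  refine Finset.sum_congr rfl fun i _ => Finset.sum_congr rfl fun j _ =>
      Finset.sum_congr rfl fun k _ => ?_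
  rw [curvature, Finset.sum_sub_distrib]
  ring

/-- Allows the curvature hypothesis, given in components, to be used for the operator `curv` that
arises from commuting covariant derivatives. -/
lemma curvatureForm_eq (hsymm : ∀ q i j, g q i j = g q j i)
    (hΓ : ∀ k i j, DifferentiableAt ℝ (christoffel g k i j) q) (u v : E m) :
    curvatureForm g q u v = metricForm g q (curv (connectionForm g) q u v v) u := by
  simp only [metricForm, bil_apply, curv_connectionForm_apply hΓ, curvatureForm, Finset.mul_sum,
    Finset.sum_mul]
  symm
  calc _ = ∑ l, ∑ i, ∑ a, ∑ j, ∑ k, g q l a * (curvature g l k i j q * u i * v j * v k) * u a :=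
        Finset.sum_congr rfl fun l _ => Finset.sum_comm
    _ = ∑ i, ∑ l, ∑ a, ∑ j, ∑ k, g q l a * (curvature g l k i j q * u i * v j * v k) * u a :=
        Finset.sum_comm
    _ = _ := by
      refine Finset.sum_congr rfl fun i _ => ?_
      calc _ = ∑ l, ∑ j, ∑ a, ∑ k, g q l a * (curvature g l k i j q * u i * v j * v k) * u a :=
            Finset.sum_congr rfl fun l _ => Finset.sum_comm
        _ = ∑ j, ∑ l, ∑ a, ∑ k, g q l a * (curvature g l k i j q * u i * v j * v k) * u a :=
            Finset.sum_comm
        _ = _ := by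
          refine Finset.sum_congr rfl fun j _ => ?_
          calc _ = ∑ l, ∑ k, ∑ a, g q l a * (curvature g l k i j q * u i * v j * v k) * u a :=
                Finset.sum_congr rfl fun l _ => Finset.sum_comm
            _ = ∑ k, ∑ l, ∑ a, g q l a * (curvature g l k i j q * u i * v j * v k) * u a :=
                Finset.sum_comm
            _ = _ := by
              refine Finset.sum_congr rfl fun k _ => Finset.sum_congr rfl fun l _ =>
                Finset.sum_congr rfl fun a _ => ?_
              rw [hsymm q l a]; ring

end LeviCivita

/-! ### Time slices -/

section Slices

variable {n d : ℕ} {U : Set (E n)} {J : Set ℝ}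

/-- The spatial coordinate directions of `ℝⁿ × ℝ`. -/
noncomputable def spaceDir (n : ℕ) (i : Fin n) : E n × ℝ := (EuclideanSpace.single i 1, 0)

/-- `U` is open, so spatial derivatives at a fixed time are genuine ones even if `s` is an endpoint
of `J`. This ties the coordinate formulas in `pd` to the space-time calculus in `dd`. -/
lemma hasFDerivAt_slice {V : Type*} [NormedAddCommGroup V] [NormedSpace ℝ V] (hU : IsOpen U)
    {f : E n × ℝ → V} {z : E n} {s : ℝ} (hz : z ∈ U) (hs : s ∈ J)
    (hf : DifferentiableWithinAt ℝ f (U ×ˢ J) (z, s)) :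
    HasFDerivAt (fun w => f (w, s))
      ((fderivWithin ℝ f (U ×ˢ J) (z, s)).comp (ContinuousLinearMap.inl ℝ (E n) ℝ)) z := by
  have h1 : HasFDerivWithinAt (fun w : E n => (w, s)) (ContinuousLinearMap.inl ℝ (E n) ℝ) U z :=
    (hasFDerivAt_prodMk_left z s).hasFDerivWithinAt
  have h2 : MapsTo (fun w : E n => (w, s)) U (U ×ˢ J) := fun w hw => ⟨hw, hs⟩
  exact (hf.hasFDerivWithinAt.comp z h1 h2).hasFDerivAt (hU.mem_nhds hz)

lemma pd_slice (hU : IsOpen U) {f : E n × ℝ → ℝ} {z : E n} {s : ℝ} (hz : z ∈ U) (hs : s ∈ J)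
    (hf : DifferentiableWithinAt ℝ f (U ×ˢ J) (z, s)) (i : Fin n) :
    pd i (fun w => f (w, s)) z = dd (U ×ˢ J) (spaceDir n i) f (z, s) := by
  rw [pd, (hasFDerivAt_slice hU hz hs hf).fderiv]
  rfl

lemma dd_component {S : Set (E n × ℝ)} (hS : UniqueDiffOn ℝ S) {f : E n × ℝ → E d} {z : E n × ℝ}
    (hz : z ∈ S) (hf : DifferentiableWithinAt ℝ f S z) (a : E n × ℝ) (α : Fin d) :
    dd S a (fun w => f w α) z = dd S a f z α := by
  have h1 := ((EuclideanSpace.proj α : E d →L[ℝ] ℝ).hasFDerivAt.comp_hasFDerivWithinAt z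
    hf.hasFDerivWithinAt).fderivWithin (hS z hz)
  have h2 : dd S a (fun w => f w α) z = fderivWithin ℝ
    ((EuclideanSpace.proj α : E d →L[ℝ] ℝ) ∘ f) S z a := rfl
  rw [h2, h1]
  rfl

lemma differentiable_component {S : Set (E n × ℝ)} {f : E n × ℝ → E d}
    (hf : ContDiffOn ℝ ∞ f S) (α : Fin d) : ContDiffOn ℝ ∞ (fun w => f w α) S :=
  (EuclideanSpace.proj α : E d →L[ℝ] ℝ).contDiff.comp_contDiffOn hf

lemma pd_congr {f h : E n → ℝ} {z : E n} (hU : IsOpen U) (hz : z ∈ U) (hfh : EqOn f h U)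
    (i : Fin n) : pd i f z = pd i h z := by
  rw [pd, pd, (hfh.eventuallyEq_of_mem (hU.mem_nhds hz)).fderiv_eq]

variable {F : E n × ℝ → E d} {z : E n} {s : ℝ} {g : E d → Matrix (Fin d) (Fin d) ℝ}

lemma pd_slice_component (hU : IsOpen U) (hS : UniqueDiffOn ℝ (U ×ˢ J))
    (hF : ContDiffOn ℝ ∞ F (U ×ˢ J)) (hz : z ∈ U) (hs : s ∈ J) (i : Fin n) (α : Fin d) :
    pd i (fun w => F (w, s) α) z = dd (U ×ˢ J) (spaceDir n i) F (z, s) α := by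
  rw [pd_slice (f := fun w => F w α) hU hz hs
    (differentiableWithinAt_of_smooth (differentiable_component hF α) ⟨hz, hs⟩),
    dd_component hS ⟨hz, hs⟩ (differentiableWithinAt_of_smooth hF ⟨hz, hs⟩)]

lemma pd_pd_slice_component (hU : IsOpen U) (hS : UniqueDiffOn ℝ (U ×ˢ J))
    (hF : ContDiffOn ℝ ∞ F (U ×ˢ J)) (hz : z ∈ U) (hs : s ∈ J) (i j : Fin n) (α : Fin d) :
    pd i (pd j (fun w => F (w, s) α)) z =
      dd (U ×ˢ J) (spaceDir n i) (dd (U ×ˢ J) (spaceDir n j) F) (z, s) α := by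
  rw [pd_congr hU hz (fun w hw => pd_slice_component hU hS hF hw hs j α),
    pd_slice_component hU hS (contDiffOn_dd hS hF) hz hs]

lemma inducedMetric_slice (hU : IsOpen U) (hS : UniqueDiffOn ℝ (U ×ˢ J))
    (hF : ContDiffOn ℝ ∞ F (U ×ˢ J)) (hz : z ∈ U) (hs : s ∈ J) :
    inducedMetric g (fun w => F (w, s)) z =
      formI (metricForm g) F (U ×ˢ J) (spaceDir n) (z, s) := by
  ext i j
  simp only [inducedMetric, of_apply, formI, metricForm, bil_apply,
    pd_slice_component hU hS hF hz hs]

/-- The Christoffel term of the induced metric in `∇dF` is a combination of the `Fₖ` and is killed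
by the normal, so `cov` alone computes `h`. -/
lemma secondFundamentalForm_slice (hU : IsOpen U) (hS : UniqueDiffOn ℝ (U ×ˢ J))
    (hF : ContDiffOn ℝ ∞ F (U ×ˢ J)) (hz : z ∈ U) (hs : s ∈ J) {ν : E n × ℝ → E d}
    (hν : ∀ i, metricForm g (F (z, s)) (dd (U ×ˢ J) (spaceDir n i) F (z, s)) (ν (z, s)) = 0) :
    secondFundamentalForm g (fun w => F (w, s)) (ν (z, s)) z =
      formII (metricForm g) (connectionForm g) F ν (U ×ˢ J) (spaceDir n) (z, s) := by
  ext i j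
  have h1 : ∀ α, secondFundamentalTensor g (fun w => F (w, s)) z α i j =
      (cov (connectionForm g) F (U ×ˢ J) (spaceDir n i) (dd (U ×ˢ J) (spaceDir n j) F) (z, s) -
      ∑ k, christoffel (inducedMetric g fun w => F (w, s)) k i j z •
        dd (U ×ˢ J) (spaceDir n k) F (z, s)) α := by
    intro α
    simp only [secondFundamentalTensor, pd_slice_component hU hS hF hz hs,
      pd_pd_slice_component hU hS hF hz hs, cov]
    simp [connectionForm, vbil_apply, Finset.sum_apply]
    ring
  simp only [secondFundamentalForm, of_apply, formII, h1]
  rw [← bil_apply]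
  have h2 : ∀ V, bil (g (F (z, s))) V (ν (z, s)) = metricForm g (F (z, s)) V (ν (z, s)) :=
    fun V => rfl
  rw [h2, map_sub, map_sum]
  simp [hν]

lemma hessian_slice (hU : IsOpen U) (hS : UniqueDiffOn ℝ (U ×ˢ J))
    (hF : ContDiffOn ℝ ∞ F (U ×ˢ J)) (hz : z ∈ U) (hs : s ∈ J) {φ : E n × ℝ → ℝ}
    (hφ : ContDiffOn ℝ ∞ φ (U ×ˢ J))
    (hI : ∀ i j, ContDiffOn ℝ ∞ (fun w => formI (metricForm g) F (U ×ˢ J) (spaceDir n) w i j)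
      (U ×ˢ J)) :
    hessian (inducedMetric g fun w => F (w, s)) (fun w => φ (w, s)) z =
      flowHessian (metricForm g) F φ (U ×ˢ J) (spaceDir n) (z, s) := by
  have h1 : ∀ i, EqOn (pd i fun w => φ (w, s))
      (fun w => dd (U ×ˢ J) (spaceDir n i) φ (w, s)) U := fun i w hw =>
    pd_slice hU hw hs (differentiableWithinAt_of_smooth hφ ⟨hw, hs⟩) i
  have h2 : ∀ i j l, pd i (fun w => inducedMetric g (fun w => F (w, s)) w j l) z =
      dd (U ×ˢ J) (spaceDir n i)
        (fun w => formI (metricForm g) F (U ×ˢ J) (spaceDir n) w j l) (z, s) := by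
    intro i j l
    rw [pd_congr (h := fun w => formI (metricForm g) F (U ×ˢ J) (spaceDir n) (w, s) j l) hU hz
      (fun w hw => by rw [inducedMetric_slice hU hS hF hw hs])]
    exact pd_slice (f := fun w => formI (metricForm g) F (U ×ˢ J) (spaceDir n) w j l) hU hz hs
      (differentiableWithinAt_of_smooth (hI j l) ⟨hz, hs⟩) i
  ext i j
  simp only [hessian, of_apply, flowHessian, christoffel, h2, inducedMetric_slice hU hS hF hz hs]
  rw [pd_congr hU hz (h1 j), pd_slice hU hz hs
    (differentiableWithinAt_of_smooth (contDiffOn_dd hS hφ) ⟨hz, hs⟩)]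
  congr 1
  refine Finset.sum_congr rfl fun k _ => ?_
  rw [h1 k hz]

end Slices

/-! ### Charts of the maximal atlas -/

section Charts

variable {m : ℕ} {N : Type*} [TopologicalSpace N] [ChartedSpace (E m) N]
  {y : OpenPartialHomeomorph N (E m)}

lemma chart_mdifferentiable (hy : y ∈ IsManifold.maximalAtlas 𝓘(ℝ, E m) ∞ N) :
    y.MDifferentiable 𝓘(ℝ, E m) 𝓘(ℝ, E m) :=
  ⟨(contMDiffOn_of_mem_maximalAtlas hy).mdifferentiableOn (by simp),
    (contMDiffOn_symm_of_mem_maximalAtlas hy).mdifferentiableOn (by simp)⟩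

lemma mfderiv_symm_mfderiv (hy : y ∈ IsManifold.maximalAtlas 𝓘(ℝ, E m) ∞ N) {q : N}
    (hq : q ∈ y.source) (v : TangentSpace 𝓘(ℝ, E m) q) :
    mfderiv 𝓘(ℝ, E m) 𝓘(ℝ, E m) y.symm (y q) (mfderiv 𝓘(ℝ, E m) 𝓘(ℝ, E m) y q v) = v :=
  congrArg (fun L => L v) ((chart_mdifferentiable hy).symm_comp_deriv hq)

lemma mfderiv_mfderiv_symm (hy : y ∈ IsManifold.maximalAtlas 𝓘(ℝ, E m) ∞ N) {z : E m}
    (hz : z ∈ y.target) (v : E m) :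
    mfderiv 𝓘(ℝ, E m) 𝓘(ℝ, E m) y (y.symm z) (mfderiv 𝓘(ℝ, E m) 𝓘(ℝ, E m) y.symm z v) = v :=
  congrArg (fun L => L v) ((chart_mdifferentiable hy).comp_symm_deriv hz)

variable [IsManifold 𝓘(ℝ, E m) ∞ N]

lemma contMDiffOn_coordinateField (hy : y ∈ IsManifold.maximalAtlas 𝓘(ℝ, E m) ∞ N) (v : E m) :
    ContMDiffOn 𝓘(ℝ, E m) 𝓘(ℝ, E m).tangent ∞
      (fun z => (⟨y.symm z, mfderiv 𝓘(ℝ, E m) 𝓘(ℝ, E m) y.symm z v⟩ : TangentBundle 𝓘(ℝ, E m) N))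
      y.target := by
  have h1 := (contMDiffOn_symm_of_mem_maximalAtlas hy).contMDiffOn_tangentMapWithin (m := ∞)
    (by simp) y.open_target.uniqueMDiffOn
  have h2 : ContMDiff 𝓘(ℝ, E m) 𝓘(ℝ, E m).tangent ∞
      (fun z : E m => (⟨z, v⟩ : TangentBundle 𝓘(ℝ, E m) (E m))) := by
    exact contMDiff_vectorSpace_iff_contDiff.2 contDiff_const
  refine (h1.comp h2.contMDiffOn (s := y.target) fun z hz => hz).congr fun z hz => ?_
  simp only [Function.comp_apply, tangentMapWithin]
  rw [mfderivWithin_of_isOpen y.open_target hz]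

end Charts

/-! ### The components of a Lorentzian metric in a chart -/

lemma bilinear_expand {m : ℕ} {V : Type*} [AddCommGroup V] [Module ℝ V] [TopologicalSpace V]
    (L : V →L[ℝ] V →L[ℝ] ℝ) (A : E m →L[ℝ] V) (u v : E m) : L (A u) (A v) = ∑ i, ∑ j,
      L (A (EuclideanSpace.single i 1)) (A (EuclideanSpace.single j 1)) * u i * v j := by
  have hexp : ∀ u : E m, u = ∑ i, u i • EuclideanSpace.single i (1 : ℝ) := by
    intro u
    ext j; simp [Finset.sum_apply, Pi.single_apply]
  conv_lhs => rw [hexp u, hexp v]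
  simp only [map_sum, map_smul, _root_.sum_apply, _root_.smul_apply, smul_eq_mul, Finset.mul_sum]
  rw [Finset.sum_comm]
  refine Finset.sum_congr rfl fun i _ => Finset.sum_congr rfl fun j _ => ?_
  ring

section LorentzianComponents

variable {n : ℕ} {N : Type*} [TopologicalSpace N] [ChartedSpace (E (n + 1)) N]
  [IsManifold 𝓘(ℝ, E (n + 1)) ∞ N] {g : LorentzianMetric n N}
  {y : OpenPartialHomeomorph N (E (n + 1))}

lemma inChart_symm (z : E (n + 1)) (α β : Fin (n + 1)) :
    g.inChart y z α β = g.inChart y z β α := g.symm _ _ _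

lemma smooth_inChart (hy : y ∈ IsManifold.maximalAtlas 𝓘(ℝ, E (n + 1)) ∞ N) (α β : Fin (n + 1)) :
    ContDiffOn ℝ ∞ (fun z => g.inChart y z α β) y.target := by
  rw [← contMDiffOn_iff_contDiffOn]
  have h1 := g.contMDiff.comp_contMDiffOn (contMDiffOn_symm_of_mem_maximalAtlas hy)
  have h2 := ContMDiffOn.clm_bundle_apply₂ (n := ∞) (E₃ := Bundle.Trivial N ℝ) (F₃ := ℝ)
    (b := y.symm) (ψ := fun z => g.val (y.symm z)) h1
    (contMDiffOn_coordinateField hy (EuclideanSpace.single α (1 : ℝ)))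
    (contMDiffOn_coordinateField hy (EuclideanSpace.single β (1 : ℝ)))
  intro z hz
  have h3 := h2 z hz
  rw [Bundle.contMDiffWithinAt_totalSpace] at h3
  exact h3.2

lemma metricForm_inChart (z u v : E (n + 1)) : metricForm (g.inChart y) z u v =
    g.val (y.symm z) (mfderiv 𝓘(ℝ, E (n + 1)) 𝓘(ℝ, E (n + 1)) y.symm z u)
      (mfderiv 𝓘(ℝ, E (n + 1)) 𝓘(ℝ, E (n + 1)) y.symm z v) := by
  rw [metricForm, bil_apply]
  exact (bilinear_expand (g.val (y.symm z))
    (mfderiv 𝓘(ℝ, E (n + 1)) 𝓘(ℝ, E (n + 1)) y.symm z) u v).symm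

lemma metricForm_components (hy : y ∈ IsManifold.maximalAtlas 𝓘(ℝ, E (n + 1)) ∞ N) {q : N}
    (hq : q ∈ y.source) (u v : TangentSpace 𝓘(ℝ, E (n + 1)) q) :
    metricForm (g.inChart y) (y q) (components y u) (components y v) = g.val q u v := by
  rw [metricForm_inChart]
  have h1 := mfderiv_symm_mfderiv hy hq u
  have h2 := mfderiv_symm_mfderiv hy hq v
  -- The base points `y.symm (y q)` and `q` agree only propositionally, and the tangent vectors live
  -- over them. All three are generalized together before substitution.
  have h3 : ∀ (q' : N) (u' v' : E (n + 1)), q' = q → u' = u → v' = v →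
      g.val q' u' v' = g.val q u v := by
    rintro q' u' v' rfl rfl rfl; rfl
  exact h3 _ _ _ (y.left_inv hq) h1 h2

lemma LorentzianMetric.nondegenerate (g : LorentzianMetric n N) (q : N)
    (u : TangentSpace 𝓘(ℝ, E (n + 1)) q) (hu : ∀ v, g.val q u v = 0) : u = 0 := by
  obtain ⟨b, hb⟩ := g.signature q
  rw [← b.sum_repr u]
  refine Finset.sum_eq_zero fun α _ => ?_
  have h1 := hu (b α)
  rw [← b.sum_repr u] at h1
  simp only [map_sum, map_smul, _root_.sum_apply, _root_.smul_apply, hb] at h1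
  simp only [smul_eq_mul, mul_ite, mul_zero, Finset.sum_ite_eq', Finset.mem_univ, if_true] at h1
  have h2 : b.repr u α = 0 := by
    split_ifs at h1 <;> linarith
  rw [h2, zero_smul]

/-- A kernel vector of the component matrix would push forward to a nonzero vector orthogonal to the
whole tangent space. -/
lemma det_inChart_ne_zero (hy : y ∈ IsManifold.maximalAtlas 𝓘(ℝ, E (n + 1)) ∞ N)
    {z : E (n + 1)} (hz : z ∈ y.target) : (g.inChart y z).det ≠ 0 := by
  intro h0
  obtain ⟨v, hv, hv0⟩ := Matrix.exists_mulVec_eq_zero_iff.2 h0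
  have h1 : ∀ u : E (n + 1), metricForm (g.inChart y) z u (WithLp.toLp 2 v) = 0 := by
    intro u
    rw [metricForm, bil_apply]
    have h2 : ∀ i, ∑ j, g.inChart y z i j * v j = 0 := fun i => congrFun hv0 i
    refine Finset.sum_eq_zero fun i _ => ?_
    calc _ = u i * ∑ j, g.inChart y z i j * v j := by
          rw [Finset.mul_sum]; exact Finset.sum_congr rfl fun j _ => by simp; ring
      _ = 0 := by rw [h2, mul_zero]
  have h2 : mfderiv 𝓘(ℝ, E (n + 1)) 𝓘(ℝ, E (n + 1)) y.symm z (WithLp.toLp 2 v) = 0 := by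
    apply g.nondegenerate
    intro w
    have h3 := (metricForm_inChart z _ _).symm.trans
      (h1 (mfderiv 𝓘(ℝ, E (n + 1)) 𝓘(ℝ, E (n + 1)) y (y.symm z) w))
    rw [g.symm] at h3
    have h4 := mfderiv_symm_mfderiv hy (y.map_target hz) w
    rw [y.right_inv hz] at h4
    rw [← h3]
    congr 1
    exact h4.symm
  have h3 := mfderiv_mfderiv_symm hy hz (WithLp.toLp 2 v)
  rw [h2, map_zero] at h3
  apply hv
  have h4 : (WithLp.toLp 2 v : E (n + 1)) = 0 := h3.symm
  ext i
  exact congrArg (fun w : E (n + 1) => w i) h4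

end LorentzianComponents

/-! ### Transformation of the fundamental forms -/

section Transformation

variable {X X' Y Y' : Type*} [NormedAddCommGroup X] [NormedSpace ℝ X]
  [NormedAddCommGroup X'] [NormedSpace ℝ X'] [NormedAddCommGroup Y] [NormedSpace ℝ Y]
  [NormedAddCommGroup Y'] [NormedSpace ℝ Y']

/-- The second fundamental form of `f` at `z` with respect to a normal vector `ν`, written with the
Christoffel symbols of the first kind of the target metric. -/
noncomputable def staticII (G : Y → Y →L[ℝ] Y →L[ℝ] ℝ) (f : X → Y) (ν : Y) (z a b : X) : ℝ :=
  -(G (f z) (fderiv ℝ (fderiv ℝ f) z a b) ν + (1 / 2) *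
    (fderiv ℝ G (f z) (fderiv ℝ f z a) (fderiv ℝ f z b) ν
      + fderiv ℝ G (f z) (fderiv ℝ f z b) (fderiv ℝ f z a) ν
      - fderiv ℝ G (f z) ν (fderiv ℝ f z a) (fderiv ℝ f z b)))

lemma staticII_congr {G : Y → Y →L[ℝ] Y →L[ℝ] ℝ} {f h : X → Y} {ν : Y} {z : X}
    (hf : f =ᶠ[nhds z] h) (a b : X) : staticII G f ν z a b = staticII G h ν z a b := by
  rw [staticII, staticII, hf.fderiv_eq, hf.fderiv.fderiv_eq, hf.eq_of_nhds]

/-- Bilinearity in the directions is what lets the second fundamental form transform by congruence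
with a Jacobian. -/
lemma exists_bilinear_staticII (G : Y → Y →L[ℝ] Y →L[ℝ] ℝ) (f : X → Y) (ν : Y) (z : X) :
    ∃ B : X →ₗ[ℝ] X →ₗ[ℝ] ℝ, ∀ a b, B a b = staticII G f ν z a b := by
  obtain ⟨D, hD⟩ : ∃ D : Y → Y → Y → ℝ, D = fun u v w => fderiv ℝ G (f z) u v w := ⟨_, rfl⟩
  have a1 : ∀ u u' v w, D (u + u') v w = D u v w + D u' v w := fun u u' v w => by
    rw [hD]; simp only [ContinuousLinearMap.map_add (fderiv ℝ G (f z))]; rfl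
  have a2 : ∀ u v v' w, D u (v + v') w = D u v w + D u v' w := fun u v v' w => by
    rw [hD]; simp only [map_add]; rfl
  have a3 : ∀ u v w w', D u v (w + w') = D u v w + D u v w' := fun u v w w' => by
    rw [hD]; exact map_add _ _ _
  have s1 : ∀ (c : ℝ) u v w, D (c • u) v w = c * D u v w := fun c u v w => by
    rw [hD]; simp only [ContinuousLinearMap.map_smul (fderiv ℝ G (f z))]; rfl
  have s2 : ∀ (c : ℝ) u v w, D u (c • v) w = c * D u v w := fun c u v w => by
    rw [hD]; simp only [map_smul]; rfl
  have s3 : ∀ (c : ℝ) u v w, D u v (c • w) = c * D u v w := fun c u v w => by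
    rw [hD]; exact map_smul _ _ _
  have key : ∀ a b, staticII G f ν z a b = -(G (f z) (fderiv ℝ (fderiv ℝ f) z a b) ν + (1 / 2) *
      (D (fderiv ℝ f z a) (fderiv ℝ f z b) ν + D (fderiv ℝ f z b) (fderiv ℝ f z a) ν
      - D ν (fderiv ℝ f z a) (fderiv ℝ f z b))) := fun a b => by rw [hD]; rfl
  refine ⟨LinearMap.mk₂ ℝ (staticII G f ν z) ?_ ?_ ?_ ?_, fun a b => rfl⟩ <;>
  · intros
    simp only [key, map_add, map_smul, _root_.add_apply, _root_.smul_apply, smul_eq_mul,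
      a1, a2, a3, s1, s2, s3]
    ring

lemma hasFDerivAt_comp_fun {V : Type*} [NormedAddCommGroup V] [NormedSpace ℝ V] {G : Y → V}
    {θ : X → Y} {q : X} (hG : DifferentiableAt ℝ G (θ q)) (hθ : DifferentiableAt ℝ θ q) :
    HasFDerivAt (fun r => G (θ r)) ((fderiv ℝ G (θ q)).comp (fderiv ℝ θ q)) q :=
  hG.hasFDerivAt.comp q hθ.hasFDerivAt

lemma fderiv_fderiv_comp {f : X → Y} {h : Y → Y'} {z : X} (hf : ContDiffAt ℝ ∞ f z)
    (hh : ContDiffAt ℝ ∞ h (f z)) (a b : X) :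
    fderiv ℝ (fderiv ℝ (h ∘ f)) z a b =
      fderiv ℝ (fderiv ℝ h) (f z) (fderiv ℝ f z a) (fderiv ℝ f z b) +
        fderiv ℝ h (f z) (fderiv ℝ (fderiv ℝ f) z a b) := by
  have h1 : ∀ᶠ w in nhds z, ContDiffAt ℝ 1 f w :=
    (hf.of_le (by simp)).eventually (by simp)
  have h2 : ∀ᶠ w in nhds z, ContDiffAt ℝ 1 h (f w) :=
    hf.continuousAt.eventually ((hh.of_le (by simp)).eventually (by simp))
  have h3 : fderiv ℝ (h ∘ f) =ᶠ[nhds z] fun w => (fderiv ℝ h (f w)).comp (fderiv ℝ f w) := by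
    filter_upwards [h1, h2] with w hw1 hw2
    exact fderiv_comp w (hw2.differentiableAt (by simp)) (hw1.differentiableAt (by simp))
  have h4 : DifferentiableAt ℝ (fderiv ℝ f) z :=
    (hf.fderiv_right (m := ∞) (by simp)).differentiableAt (by simp)
  have h5 : DifferentiableAt ℝ (fderiv ℝ h) (f z) :=
    (hh.fderiv_right (m := ∞) (by simp)).differentiableAt (by simp)
  have h6 : HasFDerivAt (fun w => fderiv ℝ h (f w)) _ z :=
    h5.hasFDerivAt.comp z (hf.differentiableAt (by simp)).hasFDerivAt
  have h7 := h6.clm_comp h4.hasFDerivAt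
  rw [h3.fderiv_eq, h7.fderiv]
  simp [add_comm]

/-- The second derivative of `ψ` enters only through `df(d²ψ(a, b))`, which is tangent and therefore
orthogonal to `ν`. -/
lemma staticII_comp_source {G : Y → Y →L[ℝ] Y →L[ℝ] ℝ} {f : X' → Y} {ψ : X → X'} {ν : Y} {z : X}
    (hf : ContDiffAt ℝ ∞ f (ψ z)) (hψ : ContDiffAt ℝ ∞ ψ z)
    (hν : ∀ c, G (f (ψ z)) (fderiv ℝ f (ψ z) c) ν = 0) (a b : X) :
    staticII G (f ∘ ψ) ν z a b = staticII G f ν (ψ z) (fderiv ℝ ψ z a) (fderiv ℝ ψ z b) := by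
  have h1 : fderiv ℝ (f ∘ ψ) z = (fderiv ℝ f (ψ z)).comp (fderiv ℝ ψ z) :=
    fderiv_comp z (hf.differentiableAt (by simp)) (hψ.differentiableAt (by simp))
  simp only [staticII, fderiv_fderiv_comp hψ hf, h1, ContinuousLinearMap.comp_apply, map_add,
    _root_.add_apply, Function.comp_apply, hν, add_zero]

set_option synthInstance.maxHeartbeats 200000 in
lemma fderiv_pullback {G : Y → Y →L[ℝ] Y →L[ℝ] ℝ} {G' : Y' → Y' →L[ℝ] Y' →L[ℝ] ℝ} {θ : Y' → Y}
    {q : Y'} (hG : DifferentiableAt ℝ G (θ q)) (hG' : DifferentiableAt ℝ G' q)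
    (hθ : ContDiffAt ℝ ∞ θ q)
    (hpull : ∀ᶠ r in nhds q, ∀ v w, G' r v w = G (θ r) (fderiv ℝ θ r v) (fderiv ℝ θ r w))
    (u v w : Y') : fderiv ℝ G' q u v w =
      fderiv ℝ G (θ q) (fderiv ℝ θ q u) (fderiv ℝ θ q v) (fderiv ℝ θ q w)
        + G (θ q) (fderiv ℝ (fderiv ℝ θ) q u v) (fderiv ℝ θ q w)
        + G (θ q) (fderiv ℝ θ q v) (fderiv ℝ (fderiv ℝ θ) q u w) := by
  have h1 : HasFDerivAt (fun r => G' r v w) _ q :=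
    (hG'.hasFDerivAt.clm_apply (hasFDerivAt_const v q)).clm_apply (hasFDerivAt_const w q)
  have h2 := hasFDerivAt_comp_fun (V := Y →L[ℝ] Y →L[ℝ] ℝ) (G := G) hG
    (hθ.differentiableAt (by simp))
  have h3 : HasFDerivAt (fderiv ℝ θ) _ q :=
    ((hθ.fderiv_right (m := ∞) (by simp)).differentiableAt (by simp)).hasFDerivAt
  have h4 : ∀ v, HasFDerivAt (fun r => fderiv ℝ θ r v) _ q := fun v =>
    h3.clm_apply (hasFDerivAt_const v q)
  have h5 := (h2.clm_apply (h4 v)).clm_apply (h4 w)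
  have h6 : (fun r => G' r v w) =ᶠ[nhds q]
      fun r => G (θ r) (fderiv ℝ θ r v) (fderiv ℝ θ r w) := by
    filter_upwards [hpull] with r hr using hr v w
  have h7 := congrArg (fun L => L u) (h1.unique (h5.congr_of_eventuallyEq h6))
  simp at h7
  rw [h7]
  ring

/-- Differentiating the pulled-back metric produces six terms with `d²θ`. In the Koszul combination
four of them cancel, and the other two give exactly the `d²θ` term in the second derivative of `θ ∘
f`. -/
lemma staticII_comp_target {G : Y → Y →L[ℝ] Y →L[ℝ] ℝ} {G' : Y' → Y' →L[ℝ] Y' →L[ℝ] ℝ}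
    {θ : Y' → Y} {f : X → Y'} {ν : Y'} {z : X}
    (hG : DifferentiableAt ℝ G (θ (f z))) (hG' : DifferentiableAt ℝ G' (f z))
    (hsymm : ∀ u v, G (θ (f z)) u v = G (θ (f z)) v u)
    (hθ : ContDiffAt ℝ ∞ θ (f z)) (hf : ContDiffAt ℝ ∞ f z)
    (hpull : ∀ᶠ r in nhds (f z), ∀ v w, G' r v w = G (θ r) (fderiv ℝ θ r v) (fderiv ℝ θ r w))
    (a b : X) :
    staticII G (θ ∘ f) (fderiv ℝ θ (f z) ν) z a b = staticII G' f ν z a b := by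
  have h1 : fderiv ℝ (θ ∘ f) z = (fderiv ℝ θ (f z)).comp (fderiv ℝ f z) :=
    fderiv_comp z (hθ.differentiableAt (by simp)) (hf.differentiableAt (by simp))
  have h2 := hpull.self_of_nhds
  have h3 : ∀ u v, fderiv ℝ (fderiv ℝ θ) (f z) u v = fderiv ℝ (fderiv ℝ θ) (f z) v u :=
    fun u v => (hθ.isSymmSndFDerivAt (by simpa using WithTop.coe_le_coe.2 (le_top (a := (2 : ℕ∞)))))
      u v
  simp only [staticII, fderiv_fderiv_comp hf hθ, h1, ContinuousLinearMap.comp_apply, map_add,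
    _root_.add_apply, Function.comp_apply, h2, fderiv_pullback hG hG' hθ hpull]
  rw [h3 (fderiv ℝ f z b) (fderiv ℝ f z a), h3 ν (fderiv ℝ f z a), h3 ν (fderiv ℝ f z b),
    hsymm (fderiv ℝ θ (f z) (fderiv ℝ f z a)), hsymm (fderiv ℝ θ (f z) (fderiv ℝ f z b))]
  ring

end Transformation

/-! ### The fundamental forms of a fixed map -/

section Static

variable {n d : ℕ} {g : E d → Matrix (Fin d) (Fin d) ℝ} {f : E n → E d} {z : E n}

lemma pd_component (hf : DifferentiableAt ℝ f z) (i : Fin n) (α : Fin d) :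
    pd i (fun w => f w α) z = fderiv ℝ f z (EuclideanSpace.single i 1) α := by
  have h1 := ((EuclideanSpace.proj α : E d →L[ℝ] ℝ).hasFDerivAt.comp z hf.hasFDerivAt).fderiv
  have h2 : pd i (fun w => f w α) z = fderiv ℝ
    ((EuclideanSpace.proj α : E d →L[ℝ] ℝ) ∘ f) z (EuclideanSpace.single i 1) := rfl
  rw [h2, h1]
  rfl

lemma pd_pd_component (hf : ContDiffAt ℝ ∞ f z) (i j : Fin n) (α : Fin d) :
    pd i (pd j (fun w => f w α)) z = fderiv ℝ (fderiv ℝ f) z (EuclideanSpace.single i 1)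
      (EuclideanSpace.single j 1) α := by
  have h1 : ∀ᶠ w in nhds z, ContDiffAt ℝ 1 f w := (hf.of_le (by simp)).eventually (by simp)
  have h2 : pd j (fun w => f w α) =ᶠ[nhds z]
      fun w => fderiv ℝ f w (EuclideanSpace.single j 1) α := by
    filter_upwards [h1] with w hw using pd_component (hw.differentiableAt (by simp)) j α
  have h3 : DifferentiableAt ℝ (fderiv ℝ f) z :=
    (hf.fderiv_right (m := ∞) (by simp)).differentiableAt (by simp)
  have h4 := h3.hasFDerivAt.clm_apply (hasFDerivAt_const (EuclideanSpace.single j (1 : ℝ)) z)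
  rw [pd, h2.fderiv_eq]
  have h5 := pd_component h4.differentiableAt i α
  rw [pd] at h5
  rw [h5, h4.fderiv]
  simp

lemma inducedMetric_eq (hf : DifferentiableAt ℝ f z) (i j : Fin n) :
    inducedMetric g f z i j = metricForm g (f z) (fderiv ℝ f z (EuclideanSpace.single i 1))
      (fderiv ℝ f z (EuclideanSpace.single j 1)) := by
  simp only [inducedMetric, of_apply, metricForm, bil_apply, pd_component hf]

/-- The Koszul formula replaces the connection by first derivatives of the metric, and the induced
Christoffel term is again tangential. -/
lemma secondFundamentalForm_eq (hf : ContDiffAt ℝ ∞ f z) {ν : E d}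
    (hg : ∀ i j, DifferentiableAt ℝ (fun q => g q i j) (f z))
    (hsymm : ∀ q i j, g q i j = g q j i) (hdet : (g (f z)).det ≠ 0)
    (hν : ∀ c, metricForm g (f z) (fderiv ℝ f z c) ν = 0) (i j : Fin n) :
    secondFundamentalForm g f ν z i j = staticII (metricForm g) f ν z
      (EuclideanSpace.single i 1) (EuclideanSpace.single j 1) := by
  have h1 : ∀ α, secondFundamentalTensor g f z α i j =
      (fderiv ℝ (fderiv ℝ f) z (EuclideanSpace.single i 1) (EuclideanSpace.single j 1)
        + connectionForm g (f z) (fderiv ℝ f z (EuclideanSpace.single i 1))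
          (fderiv ℝ f z (EuclideanSpace.single j 1))
        - ∑ k, christoffel (inducedMetric g f) k i j z •
          fderiv ℝ f z (EuclideanSpace.single k 1)) α := by
    intro α
    simp only [secondFundamentalTensor, pd_component (hf.differentiableAt (by simp)),
      pd_pd_component hf]
    simp [connectionForm, vbil_apply, Finset.sum_apply]
    ring
  simp only [secondFundamentalForm, of_apply, h1, staticII]
  rw [← bil_apply]
  have h2 : ∀ V, bil (g (f z)) V ν = metricForm g (f z) V ν := fun V => rfl
  rw [h2, map_sub, map_sum, ← metricForm_connectionForm hg hsymm hdet]
  simp [hν]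

lemma sum_smul_single (u : E n) : ∑ i, u i • EuclideanSpace.single i (1 : ℝ) = u := by
  ext j; simp [Finset.sum_apply, Pi.single_apply]

/-- The matrix of a linear map of `ℝⁿ`. -/
noncomputable def jacobian (L : E n →L[ℝ] E n) : Matrix (Fin n) (Fin n) ℝ :=
  Matrix.of fun a i => L (EuclideanSpace.single i 1) a

lemma bilinear_jacobian (B : E n →ₗ[ℝ] E n →ₗ[ℝ] ℝ) (L : E n →L[ℝ] E n) :
    (Matrix.of fun i j => B (L (EuclideanSpace.single i 1)) (L (EuclideanSpace.single j 1))) =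
      (jacobian L)ᵀ * (Matrix.of fun i j => B (EuclideanSpace.single i 1)
        (EuclideanSpace.single j 1)) * jacobian L := by
  ext i j
  simp only [of_apply, mul_apply, transpose_apply, jacobian]
  conv_lhs => rw [← sum_smul_single (L (EuclideanSpace.single i 1)),
    ← sum_smul_single (L (EuclideanSpace.single j 1))]
  simp only [map_sum, map_smul, LinearMap.sum_apply, LinearMap.smul_apply, smul_eq_mul,
    Finset.mul_sum, Finset.sum_mul]
  refine Finset.sum_congr rfl fun a _ => Finset.sum_congr rfl fun b _ => ?_
  ring

lemma isUnit_det_jacobian {L : E n →L[ℝ] E n} (hL : Function.Injective L) :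
    IsUnit (jacobian L).det := by
  rw [isUnit_iff_ne_zero]
  intro h0
  obtain ⟨v, hv, hv0⟩ := Matrix.exists_mulVec_eq_zero_iff.2 h0
  have h1 : L (WithLp.toLp 2 v) = 0 := by
    rw [← sum_smul_single (WithLp.toLp 2 v)]
    ext a
    have h2 : ∑ i, L (EuclideanSpace.single i 1) a * v i = 0 := congrFun hv0 a
    simpa [Finset.sum_apply, mul_comm] using h2
  have h2 : (WithLp.toLp 2 v : E n) = 0 := hL (by rw [h1, map_zero])
  apply hv
  ext i
  exact congrArg (fun w : E n => w i) h2

/-- If both forms change by congruence with `J`, then `g⁻¹h` changes by conjugation: `J⁻¹(g⁻¹h)J`.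
-/
lemma charpoly_congruence {J g h : Matrix (Fin n) (Fin n) ℝ} (hJ : IsUnit J.det) :
    ((Jᵀ * g * J)⁻¹ * (Jᵀ * h * J)).charpoly = (g⁻¹ * h).charpoly := by
  have hJT : IsUnit (Jᵀ).det := by rwa [det_transpose]
  have h1 : (Jᵀ * g * J)⁻¹ * (Jᵀ * h * J) = J⁻¹ * (g⁻¹ * h) * J := by
    rw [Matrix.mul_inv_rev, Matrix.mul_inv_rev]
    calc _ = J⁻¹ * g⁻¹ * ((Jᵀ)⁻¹ * Jᵀ) * h * J := by simp only [Matrix.mul_assoc]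
      _ = _ := by
        rw [nonsing_inv_mul _ hJT, Matrix.mul_one]; simp only [Matrix.mul_assoc]
  rw [h1, charpoly_conj (mul_nonsing_inv _ hJ)]

end Static

/-! ### Changes of charts -/

section Transition

variable {m : ℕ} {N : Type*} [TopologicalSpace N] [ChartedSpace (E m) N]
  {y y' : OpenPartialHomeomorph N (E m)} {z : E m}

lemma contDiffAt_transition (hy : y ∈ IsManifold.maximalAtlas 𝓘(ℝ, E m) ∞ N)
    (hy' : y' ∈ IsManifold.maximalAtlas 𝓘(ℝ, E m) ∞ N) (hz : z ∈ y'.target)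
    (hz' : y'.symm z ∈ y.source) : ContDiffAt ℝ ∞ (y ∘ y'.symm) z := by
  rw [← contMDiffAt_iff_contDiffAt]
  exact (contMDiffAt_of_mem_maximalAtlas hy hz').comp z (contMDiffAt_symm_of_mem_maximalAtlas hy' hz)

lemma fderiv_transition (hy : y ∈ IsManifold.maximalAtlas 𝓘(ℝ, E m) ∞ N)
    (hy' : y' ∈ IsManifold.maximalAtlas 𝓘(ℝ, E m) ∞ N) (hz : z ∈ y'.target)
    (hz' : y'.symm z ∈ y.source) (v : E m) : fderiv ℝ (y ∘ y'.symm) z v =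
      mfderiv 𝓘(ℝ, E m) 𝓘(ℝ, E m) y (y'.symm z) (mfderiv 𝓘(ℝ, E m) 𝓘(ℝ, E m) y'.symm z v) := by
  rw [← mfderiv_eq_fderiv, mfderiv_comp z ((chart_mdifferentiable hy).mdifferentiableAt hz')
    ((chart_mdifferentiable hy').mdifferentiableAt_symm hz)]
  rfl

end Transition

lemma localMap_eventuallyEq {n : ℕ} {M N : Type*} [TopologicalSpace M] [TopologicalSpace N]
    {f : M → N} {x x' : OpenPartialHomeomorph M (E n)}
    {y y' : OpenPartialHomeomorph N (E (n + 1))} {p : M} (hp : p ∈ x.source)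
    (hp' : p ∈ x'.source) (hf : ContinuousAt f p) (hq' : f p ∈ y'.source) :
    localMap f x y =ᶠ[nhds (x p)]
      ((y ∘ y'.symm) ∘ localMap f x' y') ∘ (x' ∘ x.symm) := by
  have h0 : x.symm (x p) = p := x.left_inv hp
  have h1 : ContinuousAt x.symm (x p) := x.continuousAt_symm (x.map_source hp)
  have h2 : ∀ᶠ w in nhds (x p), x.symm w ∈ x'.source :=
    h1.eventually (by rw [h0]; exact x'.open_source.mem_nhds hp')
  have h3 : ContinuousAt (fun w => f (x.symm w)) (x p) :=
    ContinuousAt.comp (g := f) (by rwa [h0]) h1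
  have h4 : ∀ᶠ w in nhds (x p), f (x.symm w) ∈ y'.source :=
    h3.eventually (by simp only [h0]; exact y'.open_source.mem_nhds hq')
  filter_upwards [h2, h4] with w hw2 hw4
  simp only [Function.comp_apply, localMap, x'.left_inv hw2, y'.left_inv hw4]

/-! ### Independence of the Lagrangian angle from the charts. -/

section ChartInvariance

variable {n : ℕ} {M : Type*} [TopologicalSpace M] [ChartedSpace (E n) M]
  {N : Type*} [TopologicalSpace N] [ChartedSpace (E (n + 1)) N] {f : M → N}
  {x x' : OpenPartialHomeomorph M (E n)} {y y' : OpenPartialHomeomorph N (E (n + 1))} {z : E n}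

lemma contDiffAt_localMap (hx : x ∈ IsManifold.maximalAtlas 𝓘(ℝ, E n) ∞ M)
    (hy : y ∈ IsManifold.maximalAtlas 𝓘(ℝ, E (n + 1)) ∞ N) (hz : z ∈ x.target)
    (hf : ContMDiffAt 𝓘(ℝ, E n) 𝓘(ℝ, E (n + 1)) ∞ f (x.symm z)) (hfz : f (x.symm z) ∈ y.source) :
    ContDiffAt ℝ ∞ (localMap f x y) z := by
  rw [← contMDiffAt_iff_contDiffAt]
  exact (contMDiffAt_of_mem_maximalAtlas hy hfz).comp z
    (hf.comp z (contMDiffAt_symm_of_mem_maximalAtlas hx hz))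

lemma fderiv_localMap (hx : x ∈ IsManifold.maximalAtlas 𝓘(ℝ, E n) ∞ M)
    (hy : y ∈ IsManifold.maximalAtlas 𝓘(ℝ, E (n + 1)) ∞ N) (hz : z ∈ x.target)
    (hf : MDifferentiableAt 𝓘(ℝ, E n) 𝓘(ℝ, E (n + 1)) f (x.symm z))
    (hfz : f (x.symm z) ∈ y.source) (v : E n) :
    fderiv ℝ (localMap f x y) z v = components y (mfderiv 𝓘(ℝ, E n) 𝓘(ℝ, E (n + 1)) f (x.symm z)
      (mfderiv 𝓘(ℝ, E n) 𝓘(ℝ, E n) x.symm z v)) := by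
  have h1 : localMap f x y = y ∘ (f ∘ x.symm) := rfl
  have h2 := (chart_mdifferentiable hx).mdifferentiableAt_symm hz
  rw [← mfderiv_eq_fderiv, h1, mfderiv_comp z ((chart_mdifferentiable hy).mdifferentiableAt hfz)
    (hf.comp z h2), mfderiv_comp z hf h2]
  rfl

variable [IsManifold 𝓘(ℝ, E (n + 1)) ∞ N] {g : LorentzianMetric n N}

lemma metricForm_pullback (hy : y ∈ IsManifold.maximalAtlas 𝓘(ℝ, E (n + 1)) ∞ N)
    (hy' : y' ∈ IsManifold.maximalAtlas 𝓘(ℝ, E (n + 1)) ∞ N) {r : E (n + 1)} (hr : r ∈ y'.target)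
    (hr' : y'.symm r ∈ y.source) (v w : E (n + 1)) :
    metricForm (g.inChart y') r v w = metricForm (g.inChart y) ((y ∘ y'.symm) r)
      (fderiv ℝ (y ∘ y'.symm) r v) (fderiv ℝ (y ∘ y'.symm) r w) := by
  rw [fderiv_transition hy hy' hr hr', fderiv_transition hy hy' hr hr', metricForm_inChart]
  exact (metricForm_components hy hr' _ _).symm

lemma metricForm_fderiv_localMap (hx : x ∈ IsManifold.maximalAtlas 𝓘(ℝ, E n) ∞ M)
    (hy : y ∈ IsManifold.maximalAtlas 𝓘(ℝ, E (n + 1)) ∞ N) (hz : z ∈ x.target)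
    (hf : MDifferentiableAt 𝓘(ℝ, E n) 𝓘(ℝ, E (n + 1)) f (x.symm z))
    (hfz : f (x.symm z) ∈ y.source) (v : E n)
    (V : TangentSpace 𝓘(ℝ, E (n + 1)) (f (x.symm z))) :
    metricForm (g.inChart y) (localMap f x y z) (fderiv ℝ (localMap f x y) z v)
      (components y V) = g.val (f (x.symm z)) (mfderiv 𝓘(ℝ, E n) 𝓘(ℝ, E (n + 1)) f (x.symm z)
      (mfderiv 𝓘(ℝ, E n) 𝓘(ℝ, E n) x.symm z v)) V := by
  rw [fderiv_localMap hx hy hz hf hfz]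
  exact metricForm_components hy hfz _ _

lemma smooth_inChart_at (hy : y ∈ IsManifold.maximalAtlas 𝓘(ℝ, E (n + 1)) ∞ N) {r : E (n + 1)}
    (hr : r ∈ y.target) (α β : Fin (n + 1)) :
    DifferentiableAt ℝ (fun q => g.inChart y q α β) r :=
  ((smooth_inChart hy α β).contDiffAt (y.open_target.mem_nhds hr)).differentiableAt (by simp)

lemma secondForm_eq (hx : x ∈ IsManifold.maximalAtlas 𝓘(ℝ, E n) ∞ M)
    (hy : y ∈ IsManifold.maximalAtlas 𝓘(ℝ, E (n + 1)) ∞ N)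
    {ν : ∀ p : M, TangentSpace 𝓘(ℝ, E (n + 1)) (f p)} {p : M} (hp : p ∈ x.source)
    (hf : ContMDiffAt 𝓘(ℝ, E n) 𝓘(ℝ, E (n + 1)) ∞ f p) (hq : f p ∈ y.source)
    (hν : ∀ c, metricForm (g.inChart y) (localMap f x y (x p)) (fderiv ℝ (localMap f x y) (x p) c)
      (components y (ν p)) = 0) (i j : Fin n) :
    secondForm g f ν x y p i j = staticII (metricForm (g.inChart y)) (localMap f x y)
      (components y (ν p)) (x p) (EuclideanSpace.single i 1) (EuclideanSpace.single j 1) := by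
  have h0 : x.symm (x p) = p := x.left_inv hp
  have ht : localMap f x y (x p) ∈ y.target := by
    rw [localMap, h0]; exact y.map_source hq
  exact secondFundamentalForm_eq
    (contDiffAt_localMap hx hy (x.map_source hp) (by rwa [h0]) (by rwa [h0]))
    (fun α β => smooth_inChart_at hy ht α β) (fun q α β => inChart_symm q α β)
    (det_inChart_ne_zero hy ht) hν i j

lemma metricForm_localMap_normal (hx : x ∈ IsManifold.maximalAtlas 𝓘(ℝ, E n) ∞ M)
    (hy : y ∈ IsManifold.maximalAtlas 𝓘(ℝ, E (n + 1)) ∞ N)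
    {ν : ∀ p : M, TangentSpace 𝓘(ℝ, E (n + 1)) (f p)} {p : M} (hp : p ∈ x.source)
    (hf : ContMDiffAt 𝓘(ℝ, E n) 𝓘(ℝ, E (n + 1)) ∞ f p) (hq : f p ∈ y.source)
    (hν : ∀ v, g.val (f p) (mfderiv 𝓘(ℝ, E n) 𝓘(ℝ, E (n + 1)) f p v) (ν p) = 0) (c : E n) :
    metricForm (g.inChart y) (localMap f x y (x p)) (fderiv ℝ (localMap f x y) (x p) c)
      (components y (ν p)) = 0 := by
  obtain ⟨z, hz, rfl⟩ : ∃ z ∈ x.target, x.symm z = p := ⟨x p, x.map_source hp, x.left_inv hp⟩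
  rw [x.right_inv hz, metricForm_fderiv_localMap hx hy hz (hf.mdifferentiableAt (by simp)) hq]
  exact hν _

/-- The characteristic polynomial of the Weingarten map does not depend on the charts. -/
theorem charpoly_weingarten_invariant (hx : x ∈ IsManifold.maximalAtlas 𝓘(ℝ, E n) ∞ M)
    (hx' : x' ∈ IsManifold.maximalAtlas 𝓘(ℝ, E n) ∞ M)
    (hy : y ∈ IsManifold.maximalAtlas 𝓘(ℝ, E (n + 1)) ∞ N)
    (hy' : y' ∈ IsManifold.maximalAtlas 𝓘(ℝ, E (n + 1)) ∞ N)
    {ν : ∀ p : M, TangentSpace 𝓘(ℝ, E (n + 1)) (f p)} {p : M} (hp : p ∈ x.source)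
    (hp' : p ∈ x'.source) (hf : ContMDiffAt 𝓘(ℝ, E n) 𝓘(ℝ, E (n + 1)) ∞ f p)
    (hq : f p ∈ y.source) (hq' : f p ∈ y'.source)
    (hν : ∀ v, g.val (f p) (mfderiv 𝓘(ℝ, E n) 𝓘(ℝ, E (n + 1)) f p v) (ν p) = 0) :
    ((firstForm g f x y (x p))⁻¹ * secondForm g f ν x y p).charpoly =
      ((firstForm g f x' y' (x' p))⁻¹ * secondForm g f ν x' y' p).charpoly := by
  have h0 : x.symm (x p) = p := x.left_inv hp
  have h0' : x'.symm (x' p) = p := x'.left_inv hp'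
  set θ := y ∘ y'.symm with hθ
  set ψ := x' ∘ x.symm with hψ
  set F := localMap f x y with hF
  set F' := localMap f x' y' with hF'
  set G := metricForm (g.inChart y) with hG
  set G' := metricForm (g.inChart y') with hG'
  have hψz : ψ (x p) = x' p := by rw [hψ, Function.comp_apply, h0]
  have hF'z : F' (x' p) = y' (f p) := by rw [hF', localMap, h0']
  have hFz : F (x p) = y (f p) := by rw [hF, localMap, h0]
  have hθz : θ (F' (x' p)) = y (f p) := by
    rw [hF'z, hθ, Function.comp_apply, y'.left_inv hq']
  have hev : F =ᶠ[nhds (x p)] (θ ∘ F') ∘ ψ :=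
    localMap_eventuallyEq hp hp' hf.continuousAt hq'
  have cF' : ContDiffAt ℝ ∞ F' (x' p) :=
    contDiffAt_localMap hx' hy' (x'.map_source hp') (by rwa [h0']) (by rwa [h0'])
  have cψ : ContDiffAt ℝ ∞ ψ (x p) :=
    contDiffAt_transition hx' hx (x.map_source hp) (by rwa [h0])
  have hq'' : y'.symm (F' (x' p)) ∈ y.source := by rw [hF'z, y'.left_inv hq']; exact hq
  have ht' : F' (x' p) ∈ y'.target := by rw [hF'z]; exact y'.map_source hq'
  have ht : θ (F' (x' p)) ∈ y.target := by rw [hθz]; exact y.map_source hq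
  have cθ : ContDiffAt ℝ ∞ θ (F' (x' p)) := contDiffAt_transition hy hy' ht' hq''
  -- The transition `θ` is an isometry between the two coordinate metrics. It is needed on a
  -- neighbourhood, since the metric will be differentiated.
  have hpull : ∀ᶠ r in nhds (F' (x' p)), ∀ v w,
      G' r v w = G (θ r) (fderiv ℝ θ r v) (fderiv ℝ θ r w) := by
    filter_upwards [y'.open_target.mem_nhds ht', (y'.continuousAt_symm ht').preimage_mem_nhds
      (y.open_source.mem_nhds hq'')] with r hr hr' v w
    exact metricForm_pullback hy hy' hr hr' v w
  have hcomp : components y (ν p) = fderiv ℝ θ (F' (x' p)) (components y' (ν p)) := by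
    rw [fderiv_transition hy hy' ht' hq'', hF'z]
    have h1 := mfderiv_symm_mfderiv hy' hq' (ν p)
    have h3 : ∀ (q' : N) (u' : E (n + 1)), q' = f p → u' = ν p →
      (mfderiv 𝓘(ℝ, E (n + 1)) 𝓘(ℝ, E (n + 1)) y q' : E (n + 1) → E (n + 1)) u' =
        components y (ν p) := by
      rintro q' u' rfl rfl; rfl
    exact (h3 _ _ (y'.left_inv hq') h1).symm
  have hFψ : fderiv ℝ F (x p) = ((fderiv ℝ θ (F' (x' p))).comp (fderiv ℝ F' (x' p))).comp
      (fderiv ℝ ψ (x p)) := by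
    have d1 : HasFDerivAt F' (fderiv ℝ F' (x' p)) (ψ (x p)) := by
      rw [hψz]; exact (cF'.differentiableAt (by simp)).hasFDerivAt
    have d2 : HasFDerivAt θ (fderiv ℝ θ (F' (x' p))) (F' (ψ (x p))) := by
      rw [hψz]; exact (cθ.differentiableAt (by simp)).hasFDerivAt
    have d3 := (d2.comp (ψ (x p)) d1).comp (x p) (cψ.differentiableAt (by simp)).hasFDerivAt
    rw [hev.fderiv_eq, d3.fderiv]
  have hN := metricForm_localMap_normal hx hy hp hf hq hν
  have hN' := metricForm_localMap_normal hx' hy' hp' hf hq' hν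
  have hI : firstForm g f x y (x p) = Matrix.of fun i j =>
      G' (F' (x' p)) (fderiv ℝ F' (x' p) (fderiv ℝ ψ (x p) (EuclideanSpace.single i 1)))
        (fderiv ℝ F' (x' p) (fderiv ℝ ψ (x p) (EuclideanSpace.single j 1))) := by
    ext i j
    have c1 : DifferentiableAt ℝ F (x p) := (contDiffAt_localMap hx hy (x.map_source hp)
      (by rwa [h0]) (by rwa [h0])).differentiableAt (by simp)
    rw [firstForm, inducedMetric_eq c1, of_apply, hpull.self_of_nhds, hθz, ← hFz, hFψ]
    rfl
  have hI' : firstForm g f x' y' (x' p) = Matrix.of fun i j =>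
      G' (F' (x' p)) (fderiv ℝ F' (x' p) (EuclideanSpace.single i 1))
        (fderiv ℝ F' (x' p) (EuclideanSpace.single j 1)) := by
    ext i j
    rw [firstForm, inducedMetric_eq (cF'.differentiableAt (by simp)), of_apply]
  -- Near `x p` the map is `θ ∘ F' ∘ ψ`; the source change `ψ` and the target change `θ` are treated
  -- separately.
  have hII : ∀ a b, staticII G F (components y (ν p)) (x p) a b =
      staticII G' F' (components y' (ν p)) (x' p) (fderiv ℝ ψ (x p) a) (fderiv ℝ ψ (x p) b) := by
    intro a b
    have dG : DifferentiableAt ℝ G (θ (F' (x' p))) :=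
      ((smooth_metricForm (fun α β => smooth_inChart hy α β)).contDiffAt
        (y.open_target.mem_nhds ht)).differentiableAt (by simp)
    have dG' : DifferentiableAt ℝ G' (F' (x' p)) :=
      ((smooth_metricForm (fun α β => smooth_inChart hy' α β)).contDiffAt
        (y'.open_target.mem_nhds ht')).differentiableAt (by simp)
    rw [staticII_congr hev, staticII_comp_source (hν := ?_) (hψ := cψ), hψz, hcomp,
      staticII_comp_target dG dG' (fun u v => metricForm_symm inChart_symm _ u v) cθ cF' hpull]
    · rw [hψz]
      exact cθ.comp (x' p) cF'
    · intro c
      have d1 : fderiv ℝ (θ ∘ F') (x' p) = (fderiv ℝ θ (F' (x' p))).comp (fderiv ℝ F' (x' p)) :=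
        fderiv_comp _ (cθ.differentiableAt (by simp)) (cF'.differentiableAt (by simp))
      rw [hψz, d1, hcomp]
      exact (hpull.self_of_nhds _ _).symm.trans (hN' c)
  obtain ⟨B, hB⟩ := exists_bilinear_staticII G' F' (components y' (ν p)) (x' p)
  obtain ⟨C, hC⟩ : ∃ C : E n →ₗ[ℝ] E n →ₗ[ℝ] ℝ, ∀ a b, C a b =
      G' (F' (x' p)) (fderiv ℝ F' (x' p) a) (fderiv ℝ F' (x' p) b) :=
    ⟨LinearMap.mk₂ ℝ (fun a b => G' (F' (x' p)) (fderiv ℝ F' (x' p) a) (fderiv ℝ F' (x' p) b))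
      (by intros; simp) (by intros; simp) (by intros; simp) (by intros; simp), fun a b => rfl⟩
  have e1 : firstForm g f x y (x p) = (jacobian (fderiv ℝ ψ (x p)))ᵀ *
      firstForm g f x' y' (x' p) * jacobian (fderiv ℝ ψ (x p)) := by
    rw [hI, hI']
    simp only [← hC]
    exact bilinear_jacobian C _
  have e2 : secondForm g f ν x y p = (jacobian (fderiv ℝ ψ (x p)))ᵀ *
      secondForm g f ν x' y' p * jacobian (fderiv ℝ ψ (x p)) := by
    have f1 : secondForm g f ν x y p = Matrix.of fun i j =>
        B (fderiv ℝ ψ (x p) (EuclideanSpace.single i 1))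
          (fderiv ℝ ψ (x p) (EuclideanSpace.single j 1)) := by
      ext i j
      rw [secondForm_eq hx hy hp hf hq hN, of_apply, hB]
      exact hII _ _
    have f2 : secondForm g f ν x' y' p = Matrix.of fun i j =>
        B (EuclideanSpace.single i 1) (EuclideanSpace.single j 1) := by
      ext i j
      rw [secondForm_eq hx' hy' hp' hf hq' hN', of_apply, hB]
    rw [f1, f2]
    exact bilinear_jacobian B _
  -- The reverse transition is a local left inverse of `ψ`, so the chain rule gives a left inverse
  -- of its derivative.
  have hinj : Function.Injective (fderiv ℝ ψ (x p)) := by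
    have hψ' : ContDiffAt ℝ ∞ (x ∘ x'.symm) (x' p) :=
      contDiffAt_transition hx hx' (x'.map_source hp') (by rwa [h0'])
    have h1 : (x ∘ x'.symm) ∘ ψ =ᶠ[nhds (x p)] id := by
      filter_upwards [x.open_target.mem_nhds (x.map_source hp),
        (x.continuousAt_symm (x.map_source hp)).preimage_mem_nhds
          (by rw [h0]; exact x'.open_source.mem_nhds hp')] with w hw hw'
      simp only [hψ, Function.comp_apply, x'.left_inv hw', x.right_inv hw, id]
    have h2 : ((fderiv ℝ (x ∘ x'.symm) (x' p)).comp (fderiv ℝ ψ (x p))) =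
        ContinuousLinearMap.id ℝ (E n) := by
      rw [← fderiv_id (𝕜 := ℝ) (x := x p), ← h1.fderiv_eq]
      conv_lhs => rw [← hψz]
      symm
      exact fderiv_comp (x p) (by rw [hψz]; exact hψ'.differentiableAt (by simp))
        (cψ.differentiableAt (by simp))
    intro u v huv
    have h3 := congrArg (fderiv ℝ (x ∘ x'.symm) (x' p)) huv
    have h4 : ∀ u, fderiv ℝ (x ∘ x'.symm) (x' p) (fderiv ℝ ψ (x p) u) = u := fun u =>
      congrArg (fun L => L u) h2
    rwa [h4, h4] at h3
  rw [e1, e2, charpoly_congruence (isUnit_det_jacobian hinj)]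

lemma posDef_firstForm (hx : x ∈ IsManifold.maximalAtlas 𝓘(ℝ, E n) ∞ M)
    (hy : y ∈ IsManifold.maximalAtlas 𝓘(ℝ, E (n + 1)) ∞ N) (hz : z ∈ x.target)
    (hf : IsSpacelikeImmersion g f) (hq : f (x.symm z) ∈ y.source) :
    (firstForm g f x y z).PosDef := by
  have c1 := contDiffAt_localMap hx hy hz (hf.1 _) hq
  have d1 := c1.differentiableAt (by simp)
  refine Matrix.PosDef.of_dotProduct_mulVec_pos ?_ ?_
  · rw [Matrix.IsHermitian, conjTranspose_eq_transpose_of_trivial]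
    ext i j
    rw [transpose_apply, firstForm, inducedMetric_eq d1, inducedMetric_eq d1]
    exact metricForm_symm inChart_symm _ _ _
  · intro v hv
    set u : E n := WithLp.toLp 2 v with hu
    have h1 : star v ⬝ᵥ firstForm g f x y z *ᵥ v =
        metricForm (g.inChart y) (localMap f x y z) (fderiv ℝ (localMap f x y) z u)
          (fderiv ℝ (localMap f x y) z u) := by
      rw [bilinear_expand (metricForm (g.inChart y) (localMap f x y z))
        (fderiv ℝ (localMap f x y) z) u u]
      simp only [dotProduct, mulVec, Finset.mul_sum]
      refine Finset.sum_congr rfl fun i _ => Finset.sum_congr rfl fun j _ => ?_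
      rw [firstForm, inducedMetric_eq d1]
      simp [hu]
      ring
    have hw : mfderiv 𝓘(ℝ, E n) 𝓘(ℝ, E n) x.symm z u ≠ 0 := by
      intro h0
      have h2 := mfderiv_mfderiv_symm hx hz u
      rw [h0, map_zero] at h2
      apply hv
      ext i
      exact congrArg (fun w : E n => w i) h2.symm
    rw [h1]
    conv_rhs => rw [fderiv_localMap hx hy hz ((hf.1 _).mdifferentiableAt (by simp)) hq]
    exact lt_of_lt_of_eq (hf.2 _ _ hw) (metricForm_components hy hq _ _).symm

lemma secondForm_symm (hx : x ∈ IsManifold.maximalAtlas 𝓘(ℝ, E n) ∞ M)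
    (hy : y ∈ IsManifold.maximalAtlas 𝓘(ℝ, E (n + 1)) ∞ N)
    {ν : ∀ p : M, TangentSpace 𝓘(ℝ, E (n + 1)) (f p)} {p : M} (hp : p ∈ x.source)
    (hf : ContMDiffAt 𝓘(ℝ, E n) 𝓘(ℝ, E (n + 1)) ∞ f p) (hq : f p ∈ y.source)
    (hν : ∀ v, g.val (f p) (mfderiv 𝓘(ℝ, E n) 𝓘(ℝ, E (n + 1)) f p v) (ν p) = 0) :
    (secondForm g f ν x y p)ᵀ = secondForm g f ν x y p := by
  have h0 : x.symm (x p) = p := x.left_inv hp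
  have hN := metricForm_localMap_normal hx hy hp hf hq hν
  have ht : localMap f x y (x p) ∈ y.target := by
    rw [localMap, h0]; exact y.map_source hq
  have c1 : ContDiffAt ℝ ∞ (localMap f x y) (x p) :=
    contDiffAt_localMap hx hy (x.map_source hp) (by rwa [h0]) (by rwa [h0])
  ext i j
  rw [transpose_apply, secondForm_eq hx hy hp hf hq hN, secondForm_eq hx hy hp hf hq hN,
    staticII, staticII, (c1.isSymmSndFDerivAt
      (by simpa using WithTop.coe_le_coe.2 (le_top (a := (2 : ℕ∞))))) (EuclideanSpace.single j 1),
    fderiv_metricForm_symm (fun α β => smooth_inChart_at hy ht α β) inChart_symm (components y (ν p))]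
  ring

variable [IsManifold 𝓘(ℝ, E n) ∞ M]

/-- The Lagrangian angle in arbitrary charts. -/
theorem lagrangianAngle_eq_matrixAngle (κ : ℝ)
    (hx : x ∈ IsManifold.maximalAtlas 𝓘(ℝ, E n) ∞ M)
    (hy : y ∈ IsManifold.maximalAtlas 𝓘(ℝ, E (n + 1)) ∞ N)
    {ν : ∀ p : M, TangentSpace 𝓘(ℝ, E (n + 1)) (f p)} {p : M} (hp : p ∈ x.source)
    (hf : IsSpacelikeImmersion g f) (hq : f p ∈ y.source)
    (hν : ∀ v, g.val (f p) (mfderiv 𝓘(ℝ, E n) 𝓘(ℝ, E (n + 1)) f p v) (ν p) = 0) :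
    lagrangianAngle κ g f ν p =
      matrixAngle κ ((firstForm g f x y (x p))⁻¹ * secondForm g f ν x y p) := by
  rw [lagrangianAngle, principalCurvatures, weingarten,
    charpoly_weingarten_invariant (IsManifold.chart_mem_maximalAtlas p) hx
      (IsManifold.chart_mem_maximalAtlas (f p)) hy (mem_chart_source _ p) hp (hf.1 p)
      (mem_chart_source _ (f p)) hq hν]
  exact matrixAngle_eq_sum_roots κ
    (posDef_firstForm hx hy (x.map_source hp) hf (by rwa [x.left_inv hp]))
    (secondForm_symm hx hy hp (hf.1 p) hq hν)

end ChartInvariance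

/-! ### The unit normal of a spacelike hyperplane -/

section UnitNormal

variable {Y : Type*} [NormedAddCommGroup Y] [NormedSpace ℝ Y] {n : ℕ}

/-- The component of `V` tangent to the hyperplane spanned by `f`. -/
noncomputable def tangentPart (G : Y →L[ℝ] Y →L[ℝ] ℝ) (f : Fin n → Y) (V : Y) : Y :=
  ∑ k, (∑ l, (Matrix.of fun i j => G (f i) (f j))⁻¹ k l * G V (f l)) • f k

variable {G : Y →L[ℝ] Y →L[ℝ] ℝ} {f : Fin n → Y} {ν : Y}

/-- The Gram matrix of `f` is invertible and `ν` is a unit normal, so these `n + 1` vectors are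
independent and form a basis. The minus sign comes from `G(ν, ν) = -1`. -/
lemma eq_tangentPart_sub (hdim : Module.finrank ℝ Y = n + 1)
    (hG : ∀ u v, G u v = G v u) (hpos : (Matrix.of fun i j => G (f i) (f j)).PosDef)
    (hunit : G ν ν = -1) (hnormal : ∀ i, G (f i) ν = 0) (V : Y) :
    V = tangentPart G f V - G V ν • ν := by
  have hu : IsUnit (Matrix.of fun i j => G (f i) (f j)).det := hpos.det_pos.ne'.isUnit
  set I : Matrix (Fin n) (Fin n) ℝ := Matrix.of fun i j => G (f i) (f j) with hI
  have hGf : ∀ (c : Fin n → ℝ) (d : ℝ) (l : Fin n),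
      G (∑ k, c k • f k + d • ν) (f l) = (c ᵥ* I) l := by
    intro c d l
    simp [hI, vecMul, dotProduct, hG ν, hnormal]
  have hGν : ∀ (c : Fin n → ℝ) (d : ℝ), G (∑ k, c k • f k + d • ν) ν = -d := by
    intro c d
    simp [hnormal, hunit]
  have hrec : ∀ c : Fin n → ℝ, (c ᵥ* I) ᵥ* I⁻¹ = c := fun c => by
    rw [vecMul_vecMul, mul_nonsing_inv _ hu, vecMul_one]
  have hli : LinearIndependent ℝ (Sum.elim f (fun _ : Unit => ν)) := by
    rw [Fintype.linearIndependent_iff]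
    intro c hc
    simp only [Fintype.sum_sum_type, Sum.elim_inl, Sum.elim_inr, Finset.univ_unique,
      Finset.sum_singleton] at hc
    have h1 := hGν (fun k => c (Sum.inl k)) (c (Sum.inr default))
    have h2 : (fun k => c (Sum.inl k)) ᵥ* I = 0 := by
      ext l
      rw [← hGf _ (c (Sum.inr default)), hc]
      simp
    have h3 := hrec (fun k => c (Sum.inl k))
    rw [h2, zero_vecMul] at h3
    rw [hc] at h1
    simp only [map_zero, _root_.zero_apply] at h1
    rintro (k | ⟨⟩)
    · exact (congrFun h3 k).symm
    · have : c (Sum.inr default) = 0 := by linarith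
      exact this
  have : FiniteDimensional ℝ Y := .of_finrank_eq_succ hdim
  have hspan : ⊤ ≤ Submodule.span ℝ (Set.range (Sum.elim f (fun _ : Unit => ν))) :=
    (hli.span_eq_top_of_card_eq_finrank' (by simp [hdim])).ge
  obtain ⟨c, hc⟩ := (Submodule.mem_span_range_iff_exists_fun ℝ).1 (hspan (Submodule.mem_top (x := V)))
  simp only [Fintype.sum_sum_type, Sum.elim_inl, Sum.elim_inr, Finset.univ_unique,
      Finset.sum_singleton] at hc
  have hsymm : ∀ k l, I⁻¹ k l = I⁻¹ l k := by
    intro k l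
    have hT : Iᵀ = I := by
      ext i j; exact hG _ _
    conv_lhs => rw [← hT, ← transpose_nonsing_inv, transpose_apply]
  have h4 : tangentPart G f V = ∑ k, c (Sum.inl k) • f k := by
    refine Finset.sum_congr rfl fun k _ => ?_
    congr 1
    refine Eq.trans ?_ (congrFun (hrec fun k => c (Sum.inl k)) k)
    simp only [← hI, ← hc, hGf]
    conv_rhs => rw [vecMul, dotProduct]
    refine Finset.sum_congr rfl fun l _ => ?_
    rw [hsymm, mul_comm]
  rw [h4, ← hc, hGν]
  simp

lemma pos_of_normal (hpos : (Matrix.of fun i j => G (f i) (f j)).PosDef)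
    (hdec : ∀ V, V = tangentPart G f V - G V ν • ν) {W : Y} (hW : G W ν = 0) (hW0 : W ≠ 0) :
    0 < G W W := by
  have h1 := hdec W
  rw [hW, zero_smul, sub_zero] at h1
  obtain ⟨c, hc⟩ : ∃ c : Fin n → ℝ, W = ∑ k, c k • f k := ⟨_, h1⟩
  have hc0 : c ≠ 0 := by
    rintro rfl
    exact hW0 (by simp [hc])
  have h2 := hpos.dotProduct_mulVec_pos hc0
  have h3 : star c ⬝ᵥ (Matrix.of fun i j => G (f i) (f j)) *ᵥ c = G W W := by
    rw [hc]
    simp only [dotProduct, mulVec, Finset.mul_sum, map_sum, map_smul, _root_.sum_apply,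
      _root_.smul_apply, smul_eq_mul, of_apply]
    rw [Finset.sum_comm]
    refine Finset.sum_congr rfl fun i _ => Finset.sum_congr rfl fun j _ => ?_
    simp
    ring
  rwa [h3] at h2

lemma nonneg_of_normal (hpos : (Matrix.of fun i j => G (f i) (f j)).PosDef)
    (hdec : ∀ V, V = tangentPart G f V - G V ν • ν) {W : Y} (hW : G W ν = 0) : 0 ≤ G W W := by
  rcases eq_or_ne W 0 with rfl | hW0
  · simp
  · exact (pos_of_normal hpos hdec hW hW0).le

/-- Transitivity of time orientation. -/
lemma same_time_cone (hG : ∀ u v, G u v = G v u)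
    (hnonneg : ∀ W, G W ν = 0 → 0 ≤ G W W) {U V : Y} (hU : G U U < 0) (hV : G V V < 0)
    (hνU : G ν U < 0) (hUV : G U V < 0) : G V ν < 0 := by
  by_contra! h
  -- This combination is orthogonal to `ν`, hence has nonnegative square. If `G(V, ν) ≥ 0`, the
  -- expansion of its square has two nonpositive terms and the negative term `G(U, ν)² G(V, V)`.
  have h1 := hnonneg (G V ν • U - G U ν • V) (by simp; ring)
  simp only [map_sub, map_smul, _root_.sub_apply, _root_.smul_apply, smul_eq_mul, hG V U] at h1
  rw [hG] at hνU
  nlinarith [mul_pos_of_neg_of_neg hνU hνU, mul_nonneg h h, mul_nonneg h (mul_pos_of_neg_of_neg hνU hUV).le,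
    mul_nonneg (mul_nonneg h h) (neg_pos.2 hU).le, mul_pos (mul_pos_of_neg_of_neg hνU hνU) (neg_pos.2 hV)]

lemma sub_tangentPart {V : Y} (hdec : V = tangentPart G f V - G V ν • ν) :
    V - tangentPart G f V = (- G V ν) • ν := by
  rw [sub_eq_iff_eq_add, neg_smul, neg_add_eq_sub]
  exact hdec

/-- Removing from `V` its tangent part leaves `-G(V, ν)ν`, a positive multiple of `ν`. Normalizing
it recovers `ν` from the tangent vectors and `V`. -/
lemma unit_normal_eq (hunit : G ν ν = -1) {V : Y} (hdec : V = tangentPart G f V - G V ν • ν)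
    (hV : G V ν < 0) : ν = (√(- G (V - tangentPart G f V) (V - tangentPart G f V)))⁻¹ •
      (V - tangentPart G f V) := by
  rw [sub_tangentPart hdec]
  have h2 : - G ((- G V ν) • ν) ((- G V ν) • ν) = (- G V ν) ^ 2 := by
    simp only [map_smul, _root_.smul_apply, smul_eq_mul, hunit]
    ring
  rw [h2, Real.sqrt_sq (by linarith), smul_smul, inv_mul_cancel₀ (by linarith), one_smul]

variable {X : Type*} [NormedAddCommGroup X] [NormedSpace ℝ X]

/-- Nothing is assumed about the regularity of `ν`. With a constant `V`, the formula of
`unit_normal_eq` is smooth in the metric and the frame; the condition on `V` near `z` only fixes the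
sign. -/
lemma contDiffWithinAt_unit_normal {A : X → Y →L[ℝ] Y →L[ℝ] ℝ} {f : X → Fin n → Y} {ν : X → Y}
    {S : Set X} {z : X} (hz : z ∈ S) (hA : ContDiffWithinAt ℝ ∞ A S z)
    (hf : ∀ i, ContDiffWithinAt ℝ ∞ (fun w => f w i) S z) (V : Y)
    (hpos : (Matrix.of fun i j => A z (f z i) (f z j)).PosDef)
    (hunit : ∀ w ∈ S, A w (ν w) (ν w) = -1)
    (hdec : ∀ w ∈ S, V = tangentPart (A w) (f w) V - A w V (ν w) • ν w)
    (hV : ∀ᶠ w in nhdsWithin z S, A w V (ν w) < 0) : ContDiffWithinAt ℝ ∞ ν S z := by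
  have hI : ∀ i j, ContDiffWithinAt ℝ ∞ (fun w => (Matrix.of fun i j => A w (f w i) (f w j))⁻¹ i j) S z :=
    contDiffWithinAt_matrix_inv (f := fun w => Matrix.of fun i j => A w (f w i) (f w j))
      (fun i j => (hA.clm_apply (hf i)).clm_apply (hf j)) hpos.det_pos.ne'
  have hR : ContDiffWithinAt ℝ ∞ (fun w => V - tangentPart (A w) (f w) V) S z :=
    contDiffWithinAt_const.sub (ContDiffWithinAt.sum fun k _ => ContDiffWithinAt.smul
      (ContDiffWithinAt.sum fun l _ => (hI k l).mul
        ((hA.clm_apply contDiffWithinAt_const).clm_apply (hf l))) (hf k))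
  have hev : ∀ᶠ w in nhdsWithin z S, ν w = (√(- A w (V - tangentPart (A w) (f w) V)
      (V - tangentPart (A w) (f w) V)))⁻¹ • (V - tangentPart (A w) (f w) V) := by
    filter_upwards [hV, self_mem_nhdsWithin] with w hw hwS
    exact unit_normal_eq (hunit w hwS) (hdec w hwS) hw
  have hVz : A z V (ν z) < 0 := hV.self_of_nhdsWithin hz
  have hne : 0 < - A z (V - tangentPart (A z) (f z) V) (V - tangentPart (A z) (f z) V) := by
    rw [sub_tangentPart (hdec z hz)]
    simp only [map_smul, _root_.smul_apply, smul_eq_mul, hunit z hz]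
    nlinarith
  refine ContDiffWithinAt.congr_of_eventuallyEq ?_ hev (hev.self_of_nhdsWithin hz)
  have hQ := ((hA.clm_apply hR).clm_apply hR).neg
  exact ((hQ.sqrt hne.ne').inv (Real.sqrt_pos.2 hne).ne').smul hR

end UnitNormal

/-! ### Hypersurface flows in charts -/

section ChartFlow

lemma continuousOn_components {n : ℕ} {N : Type*} [TopologicalSpace N]
    [ChartedSpace (E (n + 1)) N] [IsManifold 𝓘(ℝ, E (n + 1)) ∞ N] {y : OpenPartialHomeomorph N (E (n + 1))}
    (hy : y ∈ IsManifold.maximalAtlas 𝓘(ℝ, E (n + 1)) ∞ N)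
    {X : ∀ q : N, TangentSpace 𝓘(ℝ, E (n + 1)) q}
    (hX : Continuous fun q => (⟨q, X q⟩ : TangentBundle 𝓘(ℝ, E (n + 1)) N)) :
    ContinuousOn (fun q => components y (X q)) y.source := by
  have h1 := (contMDiffOn_of_mem_maximalAtlas hy).continuousOn_tangentMapWithin
    (by simp) y.open_source.uniqueMDiffOn
  have h2 := h1.comp hX.continuousOn (s := y.source) fun q hq => hq
  have h3 := (continuous_snd.comp
    (tangentBundleModelSpaceHomeomorph 𝓘(ℝ, E (n + 1))).continuous).comp_continuousOn h2
  refine h3.congr fun q hq => ?_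
  simp only [Function.comp_apply, tangentMapWithin]
  rw [mfderivWithin_of_isOpen y.open_source hq]
  rfl

variable {n : ℕ} {M N : Type*} [TopologicalSpace M] [TopologicalSpace N]

/-- The coordinate expression of a family of maps. -/
def chartFlow (F : M → ℝ → N) (x : OpenPartialHomeomorph M (E n))
    (y : OpenPartialHomeomorph N (E (n + 1))) (w : E n × ℝ) : E (n + 1) :=
  y (F (x.symm w.1) w.2)

/-- A product domain on which the coordinate expression of `F` makes sense. -/
structure FlowDomain (F : M → ℝ → N) (x : OpenPartialHomeomorph M (E n))
    (y : OpenPartialHomeomorph N (E (n + 1))) (T : ℝ) (U : Set (E n)) (J : Set ℝ) : Prop where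
  isOpen : IsOpen U
  convex : Convex ℝ U
  nonempty : U.Nonempty
  subset_target : U ⊆ x.target
  convex_time : Convex ℝ J
  nonempty_time : (interior J).Nonempty
  subset_time : J ⊆ Ico 0 T
  mem_source : ∀ z ∈ U, ∀ s ∈ J, F (x.symm z) s ∈ y.source

variable {F : M → ℝ → N} {x : OpenPartialHomeomorph M (E n)}
  {y : OpenPartialHomeomorph N (E (n + 1))} {T : ℝ} {U : Set (E n)} {J : Set ℝ}

/-- A ball times a relatively open interval. Convexity of both factors is what secures unique
derivatives and the closure condition, also when `t = 0`. -/
lemma exists_flowDomain (hF : ContinuousOn (fun z : M × ℝ => F z.1 z.2) (univ ×ˢ Ico 0 T)) {p : M}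
    {t : ℝ} (ht : t ∈ Ico 0 T) (hp : p ∈ x.source) (hy : F p t ∈ y.source) :
    ∃ U J, FlowDomain F x y T U J ∧ x p ∈ U ∧ t ∈ J ∧ J ∈ nhdsWithin t (Ico 0 T) := by
  have h1 : ContinuousOn (fun w : E n × ℝ => F (x.symm w.1) w.2) (x.target ×ˢ Ico 0 T) :=
    hF.comp ((x.continuousOn_symm.comp continuousOn_fst fun w hw => hw.1).prodMk continuousOn_snd)
      fun w hw => ⟨mem_univ _, hw.2⟩
  have h2 := (h1 (x p, t) ⟨x.map_source hp, ht⟩).preimage_mem_nhdsWithin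
    (t := y.source) (by simpa only [x.left_inv hp] using y.open_source.mem_nhds hy)
  obtain ⟨ε, hε, h3⟩ := Metric.mem_nhdsWithin_iff.1 h2
  obtain ⟨r, hr, h4⟩ := Metric.isOpen_iff.1 x.open_target (x p) (x.map_source hp)
  have htJ : t ∈ Ico 0 T ∩ Metric.ball t ε := ⟨ht, Metric.mem_ball_self hε⟩
  refine ⟨Metric.ball (x p) (min r ε), Ico 0 T ∩ Metric.ball t ε,
    ⟨Metric.isOpen_ball, convex_ball _ _, ⟨x p, Metric.mem_ball_self (lt_min hr hε)⟩,
      (Metric.ball_subset_ball (min_le_left _ _)).trans h4,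
      (convex_Ico 0 T).inter (convex_ball _ _), ?_, inter_subset_left, ?_⟩,
    Metric.mem_ball_self (lt_min hr hε), htJ,
    inter_mem_nhdsWithin _ (Metric.ball_mem_nhds t hε)⟩
  · rw [interior_inter, interior_Ico, Metric.isOpen_ball.interior_eq]
    have h5 : t ∈ closure (Ioo 0 T) := by
      rw [closure_Ioo (ht.1.trans_lt ht.2).ne]
      exact ⟨ht.1, ht.2.le⟩
    have := mem_closure_iff.1 h5 (Metric.ball t ε) Metric.isOpen_ball (Metric.mem_ball_self hε)
    rwa [inter_comm]
  · intro z hz s hs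
    have hz1 : z ∈ Metric.ball (x p) r := Metric.ball_subset_ball (min_le_left r ε) hz
    have hz2 : z ∈ Metric.ball (x p) ε := Metric.ball_subset_ball (min_le_right r ε) hz
    have h5 : (z, s) ∈ Metric.ball (x p, t) ε := by
      rw [← ball_prod_same]
      exact mk_mem_prod hz2 hs.2
    exact h3 (mem_inter h5 (mk_mem_prod (h4 hz1) hs.1))

namespace FlowDomain

lemma uniqueDiffOn_time (D : FlowDomain F x y T U J) : UniqueDiffOn ℝ J :=
  uniqueDiffOn_convex D.convex_time D.nonempty_time

lemma uniqueDiffOn (D : FlowDomain F x y T U J) : UniqueDiffOn ℝ (U ×ˢ J) :=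
  D.isOpen.uniqueDiffOn.prod D.uniqueDiffOn_time

lemma subset_closure_interior (D : FlowDomain F x y T U J) :
    U ×ˢ J ⊆ closure (interior (U ×ˢ J)) := by
  rw [(D.convex.prod D.convex_time).closure_interior_eq_closure_of_nonempty_interior]
  · exact subset_closure
  · rw [interior_prod_eq, D.isOpen.interior_eq]
    exact D.nonempty.prod D.nonempty_time

lemma mapsTo (D : FlowDomain F x y T U J) : MapsTo (chartFlow F x y) (U ×ˢ J) y.target :=
  fun w hw => y.map_source (D.mem_source w.1 hw.1 w.2 hw.2)

end FlowDomain

lemma FlowDomain.fderiv_slice (D : FlowDomain F x y T U J)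
    (hsm : ContDiffOn ℝ ∞ (chartFlow F x y) (U ×ˢ J)) {z : E n} {s : ℝ} (hz : z ∈ U) (hs : s ∈ J)
    (i : Fin n) : dd (U ×ˢ J) (spaceDir n i) (chartFlow F x y) (z, s) =
      fderiv ℝ (localMap (fun p => F p s) x y) z (EuclideanSpace.single i 1) := by
  have h1 := hasFDerivAt_slice D.isOpen hz hs (differentiableWithinAt_of_smooth hsm ⟨hz, hs⟩)
  have h2 : localMap (fun p => F p s) x y = fun w => chartFlow F x y (w, s) := rfl
  rw [h2, h1.fderiv]
  rfl

lemma hasDerivWithinAt_slice {V : Type*} [NormedAddCommGroup V]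
    [NormedSpace ℝ V] {f : E n × ℝ → V}
    (hf : ContDiffOn ℝ ∞ f (U ×ˢ J)) {z : E n} {s : ℝ} (hz : z ∈ U) (hs : s ∈ J) :
    HasDerivWithinAt (fun r => f (z, r)) (dd (U ×ˢ J) (0, 1) f (z, s)) J s := by
  have h1 := (differentiableWithinAt_of_smooth hf (z := (z, s)) ⟨hz, hs⟩).hasFDerivWithinAt
  have h2 : HasFDerivWithinAt (fun r : ℝ => (z, r)) (ContinuousLinearMap.inr ℝ (E n) ℝ) J s :=
    (hasFDerivAt_prodMk_right z s).hasFDerivWithinAt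
  exact (h1.comp s h2 fun r hr => ⟨hz, hr⟩).hasDerivWithinAt

variable [ChartedSpace (E (n + 1)) N]

/-- The coordinate expression of a family of vector fields along a family of maps. -/
noncomputable def chartNormal {F : M → ℝ → N} (ν : ∀ p t, TangentSpace 𝓘(ℝ, E (n + 1)) (F p t))
    (x : OpenPartialHomeomorph M (E n)) (y : OpenPartialHomeomorph N (E (n + 1)))
    (w : E n × ℝ) : E (n + 1) :=
  components y (ν (x.symm w.1) w.2)

lemma FlowDomain.contDiffOn_chartFlow [ChartedSpace (E n) M] (D : FlowDomain F x y T U J)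
    (hx : x ∈ IsManifold.maximalAtlas 𝓘(ℝ, E n) ∞ M)
    (hy : y ∈ IsManifold.maximalAtlas 𝓘(ℝ, E (n + 1)) ∞ N)
    (hF : ContMDiffOn (𝓘(ℝ, E n).prod 𝓘(ℝ, ℝ)) 𝓘(ℝ, E (n + 1)) ∞
      (fun z : M × ℝ => F z.1 z.2) (univ ×ˢ Ico 0 T)) :
    ContDiffOn ℝ ∞ (chartFlow F x y) (U ×ˢ J) := by
  rw [← contMDiffOn_iff_contDiffOn]
  have h1 : ContMDiffOn 𝓘(ℝ, E n × ℝ) 𝓘(ℝ, E n) ∞ (fun w : E n × ℝ => x.symm w.1) (U ×ˢ J) :=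
    (contMDiffOn_symm_of_mem_maximalAtlas hx).comp contDiff_fst.contMDiff.contMDiffOn
      fun w hw => D.subset_target hw.1
  have h2 : ContMDiffOn 𝓘(ℝ, E n × ℝ) 𝓘(ℝ, ℝ) ∞ (fun w : E n × ℝ => w.2) (U ×ˢ J) :=
    contDiff_snd.contMDiff.contMDiffOn
  have h3 := hF.comp (h1.prodMk h2) fun w hw => ⟨mem_univ _, D.subset_time hw.2⟩
  exact (contMDiffOn_of_mem_maximalAtlas hy).comp h3 fun w hw => D.mem_source w.1 hw.1 w.2 hw.2

/-- The flow equation is restricted from `[0, T)` to `J` and pushed through the chart; derivatives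
within `J` are unique, so the two expressions agree. -/
lemma FlowDomain.dd_time_chartFlow (D : FlowDomain F x y T U J)
    (hy : y ∈ IsManifold.maximalAtlas 𝓘(ℝ, E (n + 1)) ∞ N)
    (hsm : ContDiffOn ℝ ∞ (chartFlow F x y) (U ×ˢ J))
    {ν : ∀ p t, TangentSpace 𝓘(ℝ, E (n + 1)) (F p t)} {φ : M → ℝ → ℝ}
    (hflow : ∀ (p : M), ∀ t ∈ Ico 0 T,
      HasMFDerivWithinAt 𝓘(ℝ, ℝ) 𝓘(ℝ, E (n + 1)) (fun s => F p s) (Ico 0 T) t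
        (ContinuousLinearMap.smulRight (1 : ℝ →L[ℝ] ℝ)
          (φ p t • ν p t : TangentSpace 𝓘(ℝ, E (n + 1)) (F p t))))
    {z : E n} {s : ℝ} (hz : z ∈ U) (hs : s ∈ J) :
    dd (U ×ˢ J) (0, 1) (chartFlow F x y) (z, s) = φ (x.symm z) s • chartNormal ν x y (z, s) := by
  have h1 := hasDerivWithinAt_slice hsm hz hs
  have h2 := (hflow (x.symm z) s (D.subset_time hs)).mono D.subset_time
  have h3 := (((chart_mdifferentiable hy).mdifferentiableAt
    (D.mem_source z hz s hs)).hasMFDerivAt.comp_hasMFDerivWithinAt s h2).hasFDerivWithinAt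
  have h4 : HasFDerivWithinAt (fun r => chartFlow F x y (z, r)) ((1 : ℝ →L[ℝ] ℝ).smulRight
      (φ (x.symm z) s • chartNormal ν x y (z, s))) J s := by
    refine HasFDerivWithinAt.congr_fderiv (F := E (n + 1)) h3 ?_
    ext1
    have h6 : ∀ (L : E (n + 1) →L[ℝ] E (n + 1)) (v : E (n + 1)) (c : ℝ),
        L ((1 : ℝ) • (c • v)) = (1 : ℝ) • (c • L v) := by
      intros; simp
    exact h6 _ _ _
  have h5 := h4.hasDerivWithinAt
  rw [← h1.derivWithin (D.uniqueDiffOn_time s hs), h5.derivWithin (D.uniqueDiffOn_time s hs)]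
  simp

end ChartFlow

/-! ### Smoothness of the unit normal and of the angle in charts. -/

section ChartFlowGeometry

variable {n : ℕ} {M : Type*} [TopologicalSpace M]
  {N : Type*} [TopologicalSpace N] [ChartedSpace (E (n + 1)) N]
  [IsManifold 𝓘(ℝ, E (n + 1)) ∞ N] {g : LorentzianMetric n N} {F : M → ℝ → N}
  {x : OpenPartialHomeomorph M (E n)} {y : OpenPartialHomeomorph N (E (n + 1))} {T : ℝ}
  {U : Set (E n)} {J : Set ℝ} {ν : ∀ p t, TangentSpace 𝓘(ℝ, E (n + 1)) (F p t)}

lemma formI_chartFlow (D : FlowDomain F x y T U J)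
    (hsm : ContDiffOn ℝ ∞ (chartFlow F x y) (U ×ˢ J)) {z : E n} {s : ℝ} (hz : z ∈ U) (hs : s ∈ J) :
    formI (metricForm (g.inChart y)) (chartFlow F x y) (U ×ˢ J) (spaceDir n) (z, s) =
      firstForm g (fun p => F p s) x y z :=
  (inducedMetric_slice D.isOpen D.uniqueDiffOn hsm hz hs).symm

lemma metricForm_chartNormal (D : FlowDomain F x y T U J)
    (hy : y ∈ IsManifold.maximalAtlas 𝓘(ℝ, E (n + 1)) ∞ N) {w : E n × ℝ} (hw : w ∈ U ×ˢ J)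
    (V : TangentSpace 𝓘(ℝ, E (n + 1)) (F (x.symm w.1) w.2)) :
    metricForm (g.inChart y) (chartFlow F x y w) (chartNormal ν x y w) (components y V) =
      g.val (F (x.symm w.1) w.2) (ν (x.symm w.1) w.2) V :=
  metricForm_components hy (D.mem_source w.1 hw.1 w.2 hw.2) _ _

lemma smooth_metric_chartFlow (D : FlowDomain F x y T U J)
    (hy : y ∈ IsManifold.maximalAtlas 𝓘(ℝ, E (n + 1)) ∞ N)
    (hsm : ContDiffOn ℝ ∞ (chartFlow F x y) (U ×ˢ J)) :
    ContDiffOn ℝ ∞ (fun w => metricForm (g.inChart y) (chartFlow F x y w)) (U ×ˢ J) :=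
  (smooth_metricForm (fun α β => smooth_inChart hy α β)).comp hsm D.mapsTo

variable [ChartedSpace (E n) M]

lemma posDef_formI_chartFlow (D : FlowDomain F x y T U J)
    (hx : x ∈ IsManifold.maximalAtlas 𝓘(ℝ, E n) ∞ M)
    (hy : y ∈ IsManifold.maximalAtlas 𝓘(ℝ, E (n + 1)) ∞ N)
    (hsm : ContDiffOn ℝ ∞ (chartFlow F x y) (U ×ˢ J))
    (hFs : ∀ t ∈ Ico 0 T, IsSpacelikeImmersion g (fun p => F p t)) {w : E n × ℝ}
    (hw : w ∈ U ×ˢ J) :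
    (formI (metricForm (g.inChart y)) (chartFlow F x y) (U ×ˢ J) (spaceDir n) w).PosDef := by
  obtain ⟨z, s⟩ := w
  rw [formI_chartFlow D hsm hw.1 hw.2]
  exact posDef_firstForm hx hy (D.subset_target hw.1) (hFs s (D.subset_time hw.2))
    (D.mem_source z hw.1 s hw.2)

lemma chartFlow_normal (D : FlowDomain F x y T U J)
    (hx : x ∈ IsManifold.maximalAtlas 𝓘(ℝ, E n) ∞ M)
    (hy : y ∈ IsManifold.maximalAtlas 𝓘(ℝ, E (n + 1)) ∞ N)
    (hsm : ContDiffOn ℝ ∞ (chartFlow F x y) (U ×ˢ J))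
    (hFs : ∀ t ∈ Ico 0 T, IsSpacelikeImmersion g (fun p => F p t)) {τ : TimeOrientation g}
    (hν : ∀ t ∈ Ico 0 T, IsFutureUnitNormal τ (fun p => F p t) (fun p => ν p t)) {w : E n × ℝ}
    (hw : w ∈ U ×ˢ J) (i : Fin n) :
    metricForm (g.inChart y) (chartFlow F x y w)
      (dd (U ×ˢ J) (spaceDir n i) (chartFlow F x y) w) (chartNormal ν x y w) = 0 := by
  obtain ⟨z, s⟩ := w
  have ht := D.subset_time hw.2
  rw [D.fderiv_slice hsm hw.1 hw.2]
  exact (metricForm_fderiv_localMap (f := fun p => F p s) hx hy (D.subset_target hw.1)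
    (((hFs s ht).1 _).mdifferentiableAt (by simp)) (D.mem_source z hw.1 s hw.2) _ _).trans
    ((hν s ht (x.symm z)).2.2 _)

lemma chartFlow_decomposition (D : FlowDomain F x y T U J)
    (hx : x ∈ IsManifold.maximalAtlas 𝓘(ℝ, E n) ∞ M)
    (hy : y ∈ IsManifold.maximalAtlas 𝓘(ℝ, E (n + 1)) ∞ N)
    (hsm : ContDiffOn ℝ ∞ (chartFlow F x y) (U ×ˢ J))
    (hFs : ∀ t ∈ Ico 0 T, IsSpacelikeImmersion g (fun p => F p t)) {τ : TimeOrientation g}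
    (hν : ∀ t ∈ Ico 0 T, IsFutureUnitNormal τ (fun p => F p t) (fun p => ν p t)) {w : E n × ℝ}
    (hw : w ∈ U ×ˢ J) (V : E (n + 1)) :
    V = tangentPart (metricForm (g.inChart y) (chartFlow F x y w))
      (fun i => dd (U ×ˢ J) (spaceDir n i) (chartFlow F x y) w) V -
      metricForm (g.inChart y) (chartFlow F x y w) V (chartNormal ν x y w) • chartNormal ν x y w :=
  eq_tangentPart_sub (by simp) (metricForm_symm inChart_symm _)
    (posDef_formI_chartFlow D hx hy hsm hFs hw)
    ((metricForm_chartNormal D hy hw _).trans (hν w.2 (D.subset_time hw.2) _).1)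
    (chartFlow_normal D hx hy hsm hFs hν hw) V

/-- The orienting field is only continuous, so its value at `w₀` is frozen as a constant coordinate
vector. By continuity this vector stays timelike and in the future cone nearby, which is all that
`contDiffWithinAt_unit_normal` requires. -/
lemma contDiffOn_chartNormal (D : FlowDomain F x y T U J)
    (hx : x ∈ IsManifold.maximalAtlas 𝓘(ℝ, E n) ∞ M)
    (hy : y ∈ IsManifold.maximalAtlas 𝓘(ℝ, E (n + 1)) ∞ N)
    (hsm : ContDiffOn ℝ ∞ (chartFlow F x y) (U ×ˢ J))
    (hFs : ∀ t ∈ Ico 0 T, IsSpacelikeImmersion g (fun p => F p t)) {τ : TimeOrientation g}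
    (hν : ∀ t ∈ Ico 0 T, IsFutureUnitNormal τ (fun p => F p t) (fun p => ν p t)) :
    ContDiffOn ℝ ∞ (chartNormal ν x y) (U ×ˢ J) := by
  intro w₀ hw₀
  set A : E n × ℝ → E (n + 1) →L[ℝ] E (n + 1) →L[ℝ] ℝ :=
    fun w => metricForm (g.inChart y) (chartFlow F x y w) with hA
  set R : E n × ℝ → E (n + 1) := fun w => components y (τ.field (F (x.symm w.1) w.2)) with hR
  have hAsm : ContDiffOn ℝ ∞ A (U ×ˢ J) := smooth_metric_chartFlow D hy hsm
  have hAc : ContinuousWithinAt A (U ×ˢ J) w₀ := hAsm.continuousOn w₀ hw₀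
  have hRc : ContinuousWithinAt R (U ×ˢ J) w₀ := by
    have h1 : ContinuousOn (fun w : E n × ℝ => F (x.symm w.1) w.2) (U ×ˢ J) := by
      refine (y.continuousOn_symm.comp hsm.continuousOn D.mapsTo).congr fun w hw => ?_
      exact (y.left_inv (D.mem_source w.1 hw.1 w.2 hw.2)).symm
    exact ((continuousOn_components hy τ.continuous).comp h1
      fun w hw => D.mem_source w.1 hw.1 w.2 hw.2) w₀ hw₀
  have hR0 : A w₀ (R w₀) (R w₀) < 0 :=
    (metricForm_components hy (D.mem_source w₀.1 hw₀.1 w₀.2 hw₀.2) _ _).trans_lt (τ.timelike _)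
  have e1 : ∀ᶠ w in nhdsWithin w₀ (U ×ˢ J), A w (R w₀) (R w₀) < 0 :=
    ((hAc.clm_apply continuousWithinAt_const).clm_apply continuousWithinAt_const).eventually_lt
      continuousWithinAt_const hR0
  have e2 : ∀ᶠ w in nhdsWithin w₀ (U ×ˢ J), A w (R w) (R w₀) < 0 :=
    ((hAc.clm_apply hRc).clm_apply continuousWithinAt_const).eventually_lt
      continuousWithinAt_const hR0
  refine contDiffWithinAt_unit_normal hw₀ (hAsm w₀ hw₀)
    (f := fun w i => dd (U ×ˢ J) (spaceDir n i) (chartFlow F x y) w)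
    (fun i => contDiffOn_dd D.uniqueDiffOn hsm w₀ hw₀) (R w₀)
    (posDef_formI_chartFlow D hx hy hsm hFs hw₀)
    (fun w hw => (metricForm_chartNormal D hy hw _).trans (hν w.2 (D.subset_time hw.2) _).1)
    (fun w hw => chartFlow_decomposition D hx hy hsm hFs hν hw _) ?_
  filter_upwards [e1, e2, self_mem_nhdsWithin] with w h1 h2 hw
  -- The orienting vector `R w` is the intermediary: both `ν` and the frozen `R w₀` lie in its cone.
  refine same_time_cone (metricForm_symm inChart_symm _) (U := R w) (fun W hW => nonneg_of_normal
    (posDef_formI_chartFlow D hx hy hsm hFs hw)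
    (chartFlow_decomposition D hx hy hsm hFs hν hw) hW) ?_ h1 ?_ h2
  · exact (metricForm_components hy (D.mem_source w.1 hw.1 w.2 hw.2) _ _).trans_lt (τ.timelike _)
  · exact (metricForm_chartNormal D hy hw _).trans_lt (hν w.2 (D.subset_time hw.2) _).2.1.2

theorem unitNormalMap_chartFlow (D : FlowDomain F x y T U J)
    (hx : x ∈ IsManifold.maximalAtlas 𝓘(ℝ, E n) ∞ M)
    (hy : y ∈ IsManifold.maximalAtlas 𝓘(ℝ, E (n + 1)) ∞ N)
    (hsm : ContDiffOn ℝ ∞ (chartFlow F x y) (U ×ˢ J))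
    (hFs : ∀ t ∈ Ico 0 T, IsSpacelikeImmersion g (fun p => F p t)) {τ : TimeOrientation g}
    (hν : ∀ t ∈ Ico 0 T, IsFutureUnitNormal τ (fun p => F p t) (fun p => ν p t)) :
    UnitNormalMap (metricForm (g.inChart y)) (connectionForm (g.inChart y)) y.target
      (chartFlow F x y) (chartNormal ν x y) (U ×ˢ J) (spaceDir n) where
  uniqueDiff := D.uniqueDiffOn
  subset_closure := D.subset_closure_interior
  isOpen := y.open_target
  mapsTo := D.mapsTo
  smooth_metric := smooth_metricForm (fun α β => smooth_inChart hy α β)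
  smooth_connection := smooth_connectionForm y.open_target (fun α β => smooth_inChart hy α β)
    fun _ hq => det_inChart_ne_zero hy hq
  smooth_map := hsm
  smooth_normal := contDiffOn_chartNormal D hx hy hsm hFs hν
  metric_symm := fun _ _ => metricForm_symm inChart_symm _
  connection_symm := fun _ _ => connectionForm_symm inChart_symm _
  compat := fun _ hq => metricForm_compat (fun α β => smooth_inChart_at hy hq α β) inChart_symm
    (det_inChart_ne_zero hy hq)
  unit := fun _ hw =>
    (metricForm_chartNormal D hy hw _).trans (hν _ (D.subset_time hw.2) _).1
  normal := fun _ hw => chartFlow_normal D hx hy hsm hFs hν hw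

lemma formII_chartFlow (D : FlowDomain F x y T U J)
    (hx : x ∈ IsManifold.maximalAtlas 𝓘(ℝ, E n) ∞ M)
    (hy : y ∈ IsManifold.maximalAtlas 𝓘(ℝ, E (n + 1)) ∞ N)
    (hsm : ContDiffOn ℝ ∞ (chartFlow F x y) (U ×ˢ J))
    (hFs : ∀ t ∈ Ico 0 T, IsSpacelikeImmersion g (fun p => F p t)) {τ : TimeOrientation g}
    (hν : ∀ t ∈ Ico 0 T, IsFutureUnitNormal τ (fun p => F p t) (fun p => ν p t)) {p : M} {s : ℝ}
    (hp : p ∈ x.source) (hz : x p ∈ U) (hs : s ∈ J) :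
    formII (metricForm (g.inChart y)) (connectionForm (g.inChart y)) (chartFlow F x y)
      (chartNormal ν x y) (U ×ˢ J) (spaceDir n) (x p, s) =
      secondForm g (fun q => F q s) (fun q => ν q s) x y p := by
  rw [← secondFundamentalForm_slice D.isOpen D.uniqueDiffOn hsm hz hs
    (fun i => chartFlow_normal D hx hy hsm hFs hν (w := (x p, s)) ⟨hz, hs⟩ i)]
  have h1 : ∀ p', p' = p → secondFundamentalForm (g.inChart y) (fun w => chartFlow F x y (w, s))
      (components y (ν p' s)) (x p) = secondForm g (fun q => F q s) (fun q => ν q s) x y p := by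
    rintro _ rfl; rfl
  exact h1 _ (x.left_inv hp)

lemma speed_eq_matrixAngle [IsManifold 𝓘(ℝ, E n) ∞ M] {κ : ℝ} (D : FlowDomain F x y T U J)
    (hx : x ∈ IsManifold.maximalAtlas 𝓘(ℝ, E n) ∞ M)
    (hy : y ∈ IsManifold.maximalAtlas 𝓘(ℝ, E (n + 1)) ∞ N)
    (hsm : ContDiffOn ℝ ∞ (chartFlow F x y) (U ×ˢ J))
    (hFs : ∀ t ∈ Ico 0 T, IsSpacelikeImmersion g (fun p => F p t)) {τ : TimeOrientation g}
    (hν : ∀ t ∈ Ico 0 T, IsFutureUnitNormal τ (fun p => F p t) (fun p => ν p t)) {φ : M → ℝ → ℝ}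
    (hφ : ∀ t ∈ Ico 0 T, ∀ p, φ p t = lagrangianAngle κ g (fun q => F q t) (fun q => ν q t) p)
    {w : E n × ℝ} (hw : w ∈ U ×ˢ J) : φ (x.symm w.1) w.2 = matrixAngle κ
      ((formI (metricForm (g.inChart y)) (chartFlow F x y) (U ×ˢ J) (spaceDir n) w)⁻¹ *
        formII (metricForm (g.inChart y)) (connectionForm (g.inChart y)) (chartFlow F x y)
          (chartNormal ν x y) (U ×ˢ J) (spaceDir n) w) := by
  obtain ⟨z, s⟩ := w
  have hzt := D.subset_target hw.1
  have ht := D.subset_time hw.2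
  have h0 : x (x.symm z) = z := x.right_inv hzt
  have h1 := formII_chartFlow D hx hy hsm hFs hν (x.map_target hzt) (by rw [h0]; exact hw.1) hw.2
  rw [h0] at h1
  rw [hφ s ht, lagrangianAngle_eq_matrixAngle κ hx hy (x.map_target hzt) (hFs s ht)
    (D.mem_source z hw.1 s hw.2) (hν s ht _).2.2, h0, h1, formI_chartFlow D hsm hw.1 hw.2]

/-- No eigenvalue is followed: the speed is `matrixAngle` of a matrix depending smoothly on space
and time together. -/
lemma contDiffOn_speed [IsManifold 𝓘(ℝ, E n) ∞ M] {κ : ℝ} (D : FlowDomain F x y T U J)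
    (hx : x ∈ IsManifold.maximalAtlas 𝓘(ℝ, E n) ∞ M)
    (hy : y ∈ IsManifold.maximalAtlas 𝓘(ℝ, E (n + 1)) ∞ N)
    (hsm : ContDiffOn ℝ ∞ (chartFlow F x y) (U ×ˢ J))
    (hFs : ∀ t ∈ Ico 0 T, IsSpacelikeImmersion g (fun p => F p t)) {τ : TimeOrientation g}
    (hν : ∀ t ∈ Ico 0 T, IsFutureUnitNormal τ (fun p => F p t) (fun p => ν p t)) {φ : M → ℝ → ℝ}
    (hφ : ∀ t ∈ Ico 0 T, ∀ p, φ p t = lagrangianAngle κ g (fun q => F q t) (fun q => ν q t) p) :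
    ContDiffOn ℝ ∞ (fun w : E n × ℝ => φ (x.symm w.1) w.2) (U ×ˢ J) := by
  have H := unitNormalMap_chartFlow D hx hy hsm hFs hν
  have h1 : ContDiffOn ℝ ∞ (fun w => matrixAngle κ
      ((formI (metricForm (g.inChart y)) (chartFlow F x y) (U ×ˢ J) (spaceDir n) w)⁻¹ *
        formII (metricForm (g.inChart y)) (connectionForm (g.inChart y)) (chartFlow F x y)
          (chartNormal ν x y) (U ×ˢ J) (spaceDir n) w)) (U ×ˢ J) := fun w hw =>
    contDiffWithinAt_matrixAngle (fun i j => H.smooth_formI i j w hw)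
      (fun i j => H.smooth_formII i j w hw) (posDef_formI_chartFlow D hx hy hsm hFs hw)
      (by ext i j; exact H.formII_symm hw j i)
  exact h1.congr fun w hw => speed_eq_matrixAngle D hx hy hsm hFs hν hφ hw

end ChartFlowGeometry

/-! ### Constant sectional curvature -/

section ConstantCurvature

set_option synthInstance.maxHeartbeats 200000 in
lemma curv_antisymm {Y : Type*} [NormedAddCommGroup Y] [NormedSpace ℝ Y]
    (Γ : Y → Y →L[ℝ] Y →L[ℝ] Y) (q u v w : Y) : curv Γ q u v w = - curv Γ q v u w := by
  simp only [curv]; abel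

set_option synthInstance.maxHeartbeats 200000 in
lemma curv_add {Y : Type*} [NormedAddCommGroup Y] [NormedSpace ℝ Y]
    (Γ : Y → Y →L[ℝ] Y →L[ℝ] Y) (q u u' v w : Y) :
    curv Γ q (u + u') v w = curv Γ q u v w + curv Γ q u' v w := by
  simp only [curv, map_add, _root_.add_apply]; abel

variable {n : ℕ} {N : Type*} [TopologicalSpace N] [ChartedSpace (E (n + 1)) N]
  [IsManifold 𝓘(ℝ, E (n + 1)) ∞ N] {g : LorentzianMetric n N}
  {y : OpenPartialHomeomorph N (E (n + 1))} {c : ℝ}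

lemma differentiableAt_christoffel (hy : y ∈ IsManifold.maximalAtlas 𝓘(ℝ, E (n + 1)) ∞ N)
    {r : E (n + 1)} (hr : r ∈ y.target) (k i j : Fin (n + 1)) :
    DifferentiableAt ℝ (christoffel (g.inChart y) k i j) r :=
  ((smooth_christoffel y.open_target (fun α β => smooth_inChart hy α β)
    (fun q hq => det_inChart_ne_zero hy hq) k i j).contDiffAt
      (y.open_target.mem_nhds hr)).differentiableAt (by simp)

lemma metricForm_curv_self (hg : g.HasConstantSectionalCurvature c)
    (hy : y ∈ IsManifold.maximalAtlas 𝓘(ℝ, E (n + 1)) ∞ N) {r : E (n + 1)} (hr : r ∈ y.target)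
    {u v : E (n + 1)}
    (hne : metricForm (g.inChart y) r u u * metricForm (g.inChart y) r v v -
      metricForm (g.inChart y) r u v ^ 2 ≠ 0) :
    metricForm (g.inChart y) r (curv (connectionForm (g.inChart y)) r u v v) u =
      c * (metricForm (g.inChart y) r u u * metricForm (g.inChart y) r v v -
        metricForm (g.inChart y) r u v ^ 2) := by
  have h1 := hg y hy (y.symm r) (y.map_target hr)
    (mfderiv 𝓘(ℝ, E (n + 1)) 𝓘(ℝ, E (n + 1)) y.symm r u)
    (mfderiv 𝓘(ℝ, E (n + 1)) 𝓘(ℝ, E (n + 1)) y.symm r v)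
  rw [LorentzianMetric.sectionalCurvature, ← metricForm_inChart, ← metricForm_inChart,
    ← metricForm_inChart] at h1
  have h2 := h1 hne
  have h3 : ∀ u : E (n + 1), components y (q := y.symm r)
    (mfderiv 𝓘(ℝ, E (n + 1)) 𝓘(ℝ, E (n + 1)) y.symm r u) = u := mfderiv_mfderiv_symm hy hr
  rw [h3, h3, y.right_inv hr, div_eq_iff hne, curvatureForm_eq inChart_symm
    (differentiableAt_christoffel hy hr)] at h2
  exact h2

/-- For `W ≠ 0` tangent, the plane of `W` and `ν` is nondegenerate because `W` is spacelike, and its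
sectional curvature gives `G(R(W, ν)ν, W) = -c G(W, W)`. Polarization determines the symmetric part
of the form; antisymmetry of `R(ν, W)` restores the sign. -/
lemma curvature_normal_add_transpose (hg : g.HasConstantSectionalCurvature c)
    (hy : y ∈ IsManifold.maximalAtlas 𝓘(ℝ, E (n + 1)) ∞ N) {r : E (n + 1)} (hr : r ∈ y.target)
    {ν : E (n + 1)} (hunit : metricForm (g.inChart y) r ν ν = -1) {f : Fin n → E (n + 1)}
    (hnormal : ∀ i, metricForm (g.inChart y) r (f i) ν = 0)
    (hpos : (Matrix.of fun i j => metricForm (g.inChart y) r (f i) (f j)).PosDef) :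
    (Matrix.of fun i j => metricForm (g.inChart y) r
        (curv (connectionForm (g.inChart y)) r ν (f i) ν) (f j)) +
      (Matrix.of fun i j => metricForm (g.inChart y) r
        (curv (connectionForm (g.inChart y)) r ν (f i) ν) (f j))ᵀ =
      (2 * c) • Matrix.of fun i j => metricForm (g.inChart y) r (f i) (f j) := by
  have hsymm := metricForm_symm (inChart_symm (g := g) (y := y)) r
  have hself : ∀ W : E (n + 1), metricForm (g.inChart y) r W ν = 0 →
      metricForm (g.inChart y) r (curv (connectionForm (g.inChart y)) r W ν ν) W =
        - c * metricForm (g.inChart y) r W W := by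
    intro W hW
    rcases eq_or_ne W 0 with rfl | hW0
    · simp
    · have h0 := pos_of_normal hpos (eq_tangentPart_sub (by simp) hsymm hpos hunit hnormal) hW hW0
      rw [metricForm_curv_self hg hy hr (by rw [hunit, hW]; simpa using h0.ne'), hunit, hW]
      ring
  ext i j
  have h1 := hself (f i + f j) (by simp [hnormal])
  simp only [curv_add, map_add, _root_.add_apply, hself _ (hnormal i), hself _ (hnormal j),
    hsymm (f j) (f i)] at h1
  simp only [Matrix.add_apply, transpose_apply, of_apply, Matrix.smul_apply, smul_eq_mul,
    curv_antisymm _ r ν, map_neg, _root_.neg_apply]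
  linarith

end ConstantCurvature

/-! ### The evolution equation in a flow domain. -/

section Evolution

variable {n : ℕ} {M : Type*} [TopologicalSpace M] [ChartedSpace (E n) M]
  [IsManifold 𝓘(ℝ, E n) ∞ M] {N : Type*} [TopologicalSpace N] [ChartedSpace (E (n + 1)) N]
  [IsManifold 𝓘(ℝ, E (n + 1)) ∞ N] {g : LorentzianMetric n N} {F : M → ℝ → N}
  {x : OpenPartialHomeomorph M (E n)} {y : OpenPartialHomeomorph N (E (n + 1))} {T κ : ℝ}
  {U : Set (E n)} {J : Set ℝ} {ν : ∀ p t, TangentSpace 𝓘(ℝ, E (n + 1)) (F p t)} {φ : M → ℝ → ℝ}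

/-- The evolution equations of `g` and `h` are inserted into the derivative of `matrixAngle`;
`trace_evolution` simplifies the result, and the slice lemmas translate it back to the coordinate
definitions. -/
theorem hasDerivWithinAt_speed (hκ : 0 < κ) (D : FlowDomain F x y T U J)
    (hx : x ∈ IsManifold.maximalAtlas 𝓘(ℝ, E n) ∞ M)
    (hy : y ∈ IsManifold.maximalAtlas 𝓘(ℝ, E (n + 1)) ∞ N)
    (hg : g.HasConstantSectionalCurvature (-κ))
    (hsm : ContDiffOn ℝ ∞ (chartFlow F x y) (U ×ˢ J))
    (hFs : ∀ t ∈ Ico 0 T, IsSpacelikeImmersion g (fun p => F p t)) {τ : TimeOrientation g}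
    (hν : ∀ t ∈ Ico 0 T, IsFutureUnitNormal τ (fun p => F p t) (fun p => ν p t))
    (hφ : ∀ t ∈ Ico 0 T, ∀ p, φ p t = lagrangianAngle κ g (fun q => F q t) (fun q => ν q t) p)
    (hflow : ∀ (p : M), ∀ t ∈ Ico 0 T,
      HasMFDerivWithinAt 𝓘(ℝ, ℝ) 𝓘(ℝ, E (n + 1)) (fun s => F p s) (Ico 0 T) t
        (ContinuousLinearMap.smulRight (1 : ℝ →L[ℝ] ℝ)
          (φ p t • ν p t : TangentSpace 𝓘(ℝ, E (n + 1)) (F p t))))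
    {p : M} {t : ℝ} (hp : p ∈ x.source) (hz : x p ∈ U) (ht : t ∈ J) :
    HasDerivWithinAt (fun s => φ p s)
      ((∑ i, ∑ j, (sigma κ g (fun q => F q t) (fun q => ν q t) x y p)⁻¹ i j *
        hessian (firstForm g (fun q => F q t) x y) (fun z => φ (x.symm z) t) (x p) i j)
        - n * φ p t) J t := by
  set G := metricForm (g.inChart y) with hG
  set Γ := connectionForm (g.inChart y) with hΓ
  have H : NormalFlow G Γ y.target (chartFlow F x y) (chartNormal ν x y)
      (fun w => φ (x.symm w.1) w.2) (U ×ˢ J) (spaceDir n) (0, 1) :=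
    { unitNormalMap_chartFlow D hx hy hsm hFs hν with
      smooth_speed := contDiffOn_speed D hx hy hsm hFs hν hφ
      flow := fun w hw => D.dd_time_chartFlow hy hsm hflow hw.1 hw.2 }
  have hw : (x p, t) ∈ U ×ˢ J := ⟨hz, ht⟩
  have hpos := posDef_formI_chartFlow D hx hy hsm hFs hw
  have hsymm : (formII G Γ (chartFlow F x y) (chartNormal ν x y) (U ×ˢ J) (spaceDir n) (x p, t))ᵀ =
      formII G Γ (chartFlow F x y) (chartNormal ν x y) (U ×ˢ J) (spaceDir n) (x p, t) := by
    ext i j; exact H.formII_symm hw j i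
  have h1 := hasDerivWithinAt_matrixAngle hκ (S := J) (t := t)
    (g := fun s => formI G (chartFlow F x y) (U ×ˢ J) (spaceDir n) (x p, s))
    (h := fun s => formII G Γ (chartFlow F x y) (chartNormal ν x y) (U ×ˢ J) (spaceDir n) (x p, s))
    (fun i j => (hasDerivWithinAt_slice (H.smooth_formI i j) hz ht).congr_deriv
      (H.dd_time_formI hw i j))
    (fun i j => (hasDerivWithinAt_slice (H.smooth_formII i j) hz ht).congr_deriv
      (H.dd_time_formII hw (chartFlow_decomposition D hx hy hsm hFs hν hw) i j)) hpos hsymm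
  have hB := curvature_normal_add_transpose hg hy (D.mapsTo hw) (H.unit _ hw) (H.normal _ hw) hpos
  rw [mul_neg] at hB
  rw [trace_evolution hκ hpos hsymm hB] at h1
  have h2 : sigma κ g (fun q => F q t) (fun q => ν q t) x y p =
      κ • formI G (chartFlow F x y) (U ×ˢ J) (spaceDir n) (x p, t) +
        formII G Γ (chartFlow F x y) (chartNormal ν x y) (U ×ˢ J) (spaceDir n) (x p, t) *
        (formI G (chartFlow F x y) (U ×ˢ J) (spaceDir n) (x p, t))⁻¹ *
        formII G Γ (chartFlow F x y) (chartNormal ν x y) (U ×ˢ J) (spaceDir n) (x p, t) := by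
    rw [sigma, formI_chartFlow D hsm hz ht, formII_chartFlow D hx hy hsm hFs hν hp hz ht]
  have h3 : hessian (firstForm g (fun q => F q t) x y) (fun z => φ (x.symm z) t) (x p) =
      flowHessian G (chartFlow F x y) (fun w => φ (x.symm w.1) w.2) (U ×ˢ J) (spaceDir n)
        (x p, t) :=
    hessian_slice D.isOpen D.uniqueDiffOn hsm hz ht H.smooth_speed H.smooth_formI
  -- The preferred chart at `F p s` may change with `s`. Chart independence permits the fixed pair
  -- `x`, `y` for all times in `J`, so the formula can be differentiated.
  have h4 : ∀ s ∈ J, φ p s = matrixAngle κ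
      ((formI G (chartFlow F x y) (U ×ˢ J) (spaceDir n) (x p, s))⁻¹ *
        formII G Γ (chartFlow F x y) (chartNormal ν x y) (U ×ˢ J) (spaceDir n) (x p, s)) := by
    intro s hs
    rw [← speed_eq_matrixAngle D hx hy hsm hFs hν hφ ⟨hz, hs⟩, x.left_inv hp]
  refine (h1.congr h4 (h4 t ht)).congr_deriv ?_
  simp only [h2, h3, x.left_inv hp]
  rfl

end Evolution

end LorentzFlow

/-! ### The evolution equation on the manifold. -/

open LorentzFlow in
theorem lemma3p5 (n : ℕ)
    {M : Type*} [TopologicalSpace M] [ChartedSpace (E n) M] [IsManifold 𝓘(ℝ, E n) ∞ M]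
    {N : Type*} [TopologicalSpace N] [ChartedSpace (E (n + 1)) N]
    [IsManifold 𝓘(ℝ, E (n + 1)) ∞ N]
    (κ : ℝ) (hκ : 0 < κ)
    (g : LorentzianMetric n N) (τ : TimeOrientation g)
    (hg : g.HasConstantSectionalCurvature (-κ))
    (T : ℝ) (hT : 0 < T)
    (F : M → ℝ → N)
    (hF : ContMDiffOn (𝓘(ℝ, E n).prod 𝓘(ℝ, ℝ)) 𝓘(ℝ, E (n + 1)) ∞
      (fun z : M × ℝ => F z.1 z.2) (univ ×ˢ Ico 0 T))
    (hFs : ∀ t ∈ Ico 0 T, IsSpacelikeImmersion g (fun p => F p t))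
    (ν : ∀ (p : M) (t : ℝ), TangentSpace 𝓘(ℝ, E (n + 1)) (F p t))
    (hν : ∀ t ∈ Ico 0 T, IsFutureUnitNormal τ (fun p => F p t) (fun p => ν p t))
    (φ : M → ℝ → ℝ)
    (hφ : ∀ t ∈ Ico 0 T, ∀ p, φ p t = lagrangianAngle κ g (fun q => F q t) (fun q => ν q t) p)
    (hflow : ∀ (p : M), ∀ t ∈ Ico 0 T,
      HasMFDerivWithinAt 𝓘(ℝ, ℝ) 𝓘(ℝ, E (n + 1)) (fun s => F p s) (Ico 0 T) t
        (ContinuousLinearMap.smulRight (1 : ℝ →L[ℝ] ℝ)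
          (φ p t • ν p t : TangentSpace 𝓘(ℝ, E (n + 1)) (F p t)))) :
    (∀ t ∈ Ico 0 T, ContMDiff 𝓘(ℝ, E n) 𝓘(ℝ, ℝ) ∞ (fun p => φ p t)) ∧
    ∀ (p : M), ∀ t ∈ Ico 0 T,
      ∀ x ∈ IsManifold.maximalAtlas 𝓘(ℝ, E n) ∞ M, p ∈ x.source →
      ∀ y ∈ IsManifold.maximalAtlas 𝓘(ℝ, E (n + 1)) ∞ N, F p t ∈ y.source →
        HasDerivWithinAt (fun s => φ p s)
          ((∑ i, ∑ j,
              (sigma κ g (fun q => F q t) (fun q => ν q t) x y p)⁻¹ i j *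
                hessian (firstForm g (fun q => F q t) x y) (fun z => φ (x.symm z) t) (x p) i j)
            - n * φ p t)
          (Ico 0 T) t := by
  refine ⟨fun t ht p => ?_, fun p t ht x hx hp y hy hq => ?_⟩
  · have hx := IsManifold.chart_mem_maximalAtlas (I := 𝓘(ℝ, E n)) (n := ∞) p
    have hy := IsManifold.chart_mem_maximalAtlas (I := 𝓘(ℝ, E (n + 1))) (n := ∞) (F p t)
    have hp := mem_chart_source (E n) p
    obtain ⟨U, J, D, hU, hJ, -⟩ := exists_flowDomain hF.continuousOn ht hp
      (mem_chart_source (E (n + 1)) (F p t))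
    have h1 := contDiffOn_speed D hx hy (D.contDiffOn_chartFlow hx hy hF) hFs hν hφ
    have h2 : ContDiffOn ℝ ∞ (fun w => φ ((chartAt (E n) p).symm w) t) U :=
      h1.comp (contDiff_prodMk_left t).contDiffOn fun w hw => ⟨hw, hJ⟩
    have h3 := ((h2.contDiffAt (D.isOpen.mem_nhds hU)).contMDiffAt).comp p
      (contMDiffAt_of_mem_maximalAtlas hx hp)
    refine h3.congr_of_eventuallyEq ?_
    filter_upwards [(chartAt (E n) p).open_source.mem_nhds hp] with q hq
    rw [Function.comp_apply, (chartAt (E n) p).left_inv hq]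
  · obtain ⟨U, J, D, hU, hJ, hJt⟩ := exists_flowDomain hF.continuousOn ht hp hq
    -- `J` is a neighbourhood of `t` within `[0, T)`, so the derivative within `J` is the one within
    -- `[0, T)`, one-sided exactly at `t = 0`.
    exact (hasDerivWithinAt_speed hκ D hx hy hg (D.contDiffOn_chartFlow hx hy hF) hFs hν hφ hflow
      hp hU hJ).mono_of_mem_nhdsWithin hJt
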